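/- **Conventions.** All Lie algebras are finite-dimensional over $\mathbb C$. Let $(\mathfrak g,[,])$ be a nonzero semisimple Lie algebra, $\mathfrak h\subset\mathfrak g$ a Cartan subalgebra, $R$ the set of roots, $\mathfrak g=\mathfrak h\oplus\bigoplus_{\alpha\in R}\mathfrak g_\alpha$ the root decomposition, and $B_{\mathfrak g}$ the Killing form; $\operatorname{End}(\mathfrak g)$ carries the trace form $(a,b)\mapsto\operatorname{Tr}(ab)$. For $W\in\operatorname{End}(\mathfrak g)$ put $[x,y]_W=[Wx,y]+[x,Wy]-W[x,y]$; $W$ is a *weak Nijenhuis operator* (WNO) if $[,]_W$ is a Lie bracket, and $W$ is *principal* if $W\perp\operatorname{ad}\mathfrak g$. A (semisimple) *bi-Lie structure* $(\mathfrak g,[,],[,]')$ is a bilinear operation $[,]'$ such that all linear combinations of $[,]$ and $[,]'$ are Lie brackets; then $[,]'=[,]_W$ for a unique principal WNO $W$. Its *principal primitive* $P$ is determined by requiring $\operatorname{ad}(Px)$ to be the orthogonal projection of $\frac12[W,[W,\operatorname{ad}x]]$ to $\operatorname{ad}\mathfrak g$. Put $[,]^t=[,]'-t[,]$ and let $\mathfrak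 z^t$ be the centre of $[,]^t$. The *times* of the structure are the $t\in\mathbb C$ for which the Killing form of $[,]^t$ is degenerate. The *central subalgebra* is $\mathfrak z=\sum_t\mathfrak z^t$, and the structure is *regular* if $\mathfrak z$ contains a Cartan subalgebra of $(\mathfrak g,[,])$. Suppose that $W$ preserves the root decomposition and that $W|_{\mathfrak h}$ is diagonalizable; then $W|_{\mathfrak g_{\alpha}}=\lambda_{\alpha}$ and $P|_{\mathfrak g_\alpha}=\pi_\alpha$ are scalars. Let $T_\alpha=\{t_{1,\alpha},t_{2,\alpha}\}$ be the unordered pair of solutions (with multiplicity) of $(t-\lambda_\alpha)(t-\lambda_{-\alpha})-2\pi_\alpha=0$. A regular structure with such a $W$ is of *Class I* (with respect to $\mathfrak h$) if there are no $\alpha,\beta,\gamma\in R$ with $\alpha+\beta+\gamma=0$ and $T_\alpha=T_\beta=T_\gamma=\{t_1,t_2\}$, $t_1\ne t_2$. Put $\mathfrak g_0^t=(\mathfrak h\cap\ker(W-t))\oplus\bigoplus_{T_\alpha=\{t,t\}}\mathfrak g_\alpha$; the *basic subalgebra* is $\sum_{t:\,\mathfrak z^t\neq0}\mathfrak g_0^t$.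 Two bi-Lie structures $(\mathfrak g,[,],[,]')$ and $(\mathfrak g,[,],[,]'_1)$ are *strongly isomorphic* if some automorphism $\varphi$ of $(\mathfrak g,[,])$ carries $[,]'$ to $[,]'_1$, and *isomorphic* if some automorphism $\varphi$ of $(\mathfrak g,[,])$ carries $[,]'$ to $c[,]'_1+d[,]$ for some $c,d\in\mathbb C$, $c\ne0$. A *toral symmetric pairoid quasigrading of Class I* (with respect to $\mathfrak h$) with finite base $X$ is a direct decomposition $\mathfrak g=\bigoplus\mathfrak g_{xy}$ indexed by the unordered pairs of (possibly equal) elements of $X$ such that: * $\mathfrak g_{xy}\ne0$ if $x\neq y$; * $[\mathfrak g_{xy},\mathfrak g_{yu}]\subset\mathfrak g_{xu}$ if $x\ne u$, and $[\mathfrak g_{xy},\mathfrak g_{xy}]\subset\mathfrak g_{xx}+\mathfrak g_{yy}$; * $[\mathfrak g_\alpha,\mathfrak g_\beta]=0$ for $\alpha,\beta\in R$ with $\mathfrak g_\alpha\subset\mathfrak g_{xy}$, $\mathfrak g_\beta\subset\mathfrak g_{zu}$ and $\{x,y\}\cap\{z,u\}=\emptyset$; * each $\mathfrak g_{xy}$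 is a sum of some root spaces and a subspace of $\mathfrak h$, and $\mathfrak h\subset\bigoplus_x\mathfrak g_{xx}$; * $\mathfrak g_\alpha\subset\mathfrak g_{xy}$ implies $\mathfrak g_{-\alpha}\subset\mathfrak g_{xy}$. Two quasigradings $(\mathfrak g_{xy})$, $(\mathfrak g'_{xy})$ of $\mathfrak g$ with bases $X,X'$ are *equivalent via* a bijection $\chi:X\to X'$ if some automorphism $\varphi$ of $(\mathfrak g,[,])$ satisfies $\varphi(\mathfrak g_{xy})=\mathfrak g'_{\chi(x)\chi(y)}$ for all $x,y\in X$. **Theorem 12.7.** 1. Let $X=\{t_1,\dots,t_n\}$ be a set of $n$ distinct complex numbers, and let $\mathfrak g=\bigoplus\mathfrak g_{t_it_j}$ be a toral symmetric pairoid quasigrading of Class I with base $X$. Let $W$ be the (unique) operator with $W|_{\mathfrak g_{t_it_j}}=\frac{t_i+t_j}2\operatorname{Id}$. Then $(\mathfrak g,[,],[,]_W)$ is a bi-Lie structure of Class I, and: (a) its set of times is $X$; the $\mathfrak g_{t_it_i}$ are subalgebras and $\mathfrak g_{t_it_i}=\mathfrak g_0^{t_i}$; the basic subalgebra is $\bigoplus_i\mathfrak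 g_{t_it_i}$, and it is a subalgebra; (b) its central subalgebra $\mathfrak z$ is a subalgebra containing $\mathfrak h$, $\mathfrak z=\bigoplus_{i=1}^n\mathfrak z^{t_i}$, and $\mathfrak z^{t_i}=(\mathfrak g_{t_it_i}\cap\mathfrak h)\oplus\bigoplus_{\alpha\in\tilde R^i}\mathfrak g_\alpha$, where $\tilde R^i$ is the set of roots $\alpha$ with $\mathfrak g_\alpha\subset\mathfrak g_{t_it_i}$ that vanish on $\bigoplus_{j\ne i}(\mathfrak g_{t_jt_j}\cap\mathfrak h)$; (c) $W$ preserves $\mathfrak h^\perp=\bigoplus_{\alpha\in R}\mathfrak g_\alpha$ and $W|_{\mathfrak h^\perp}$ is symmetric with respect to $B_{\mathfrak g}$; moreover, $W$ is the principal WNO of the structure. 2. If $\mathfrak g$ is simple, then every bi-Lie structure $(\mathfrak g,[,],[,]')$ of Class I with respect to $\mathfrak h$ is obtained as in 1: $[,]'=[,]_W$ for the operator $W$ of some toral symmetric pairoid quasigrading of Class I with respect to $\mathfrak h$ whose base is a finite set of complex numbers. 3. Let $W,W'$ be the operators built as in 1 from two toral symmetric pairoid quasigradings of Class I on $\mathfrak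 g$ (with respect to Cartan subalgebras $\mathfrak h,\mathfrak h'$) with bases $X,X'\subset\mathbb C$. The bi-Lie structures $(\mathfrak g,[,],[,]_W)$ and $(\mathfrak g,[,],[,]_{W'})$ are strongly isomorphic if and only if $X=X'$ and the quasigradings are equivalent via $\chi=\mathrm{id}$. They are isomorphic if and only if the quasigradings are equivalent via some bijection $\chi:X\to X'$ of the form $\chi(x)=\lambda x+\lambda'$ with $\lambda,\lambda'\in\mathbb C$. -/

import Mathlib

namespace BiLie

section Brackets

variable {L : Type*} [LieRing L] [LieAlgebra ℂ L]

/-- The Lie bracket of `L` as a bilinear map, `x ↦ ad x`. -/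
def lieBr : L →ₗ[ℂ] L →ₗ[ℂ] L := (LieAlgebra.ad ℂ L : L →ₗ[ℂ] Module.End ℂ L)

/-- A bilinear operation is a Lie bracket: it is alternating and satisfies the Jacobi identity. -/
def IsLieBracket (br : L →ₗ[ℂ] L →ₗ[ℂ] L) : Prop :=
  (∀ x, br x x = 0) ∧ ∀ x y z, br x (br y z) + br y (br z x) + br z (br x y) = 0

/-- `(L, [,], br)` is a bi-Lie structure: every linear combination of the two brackets is a Lie
bracket. -/
def IsBiLie (br : L →ₗ[ℂ] L →ₗ[ℂ] L) : Prop :=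
  ∀ a b : ℂ, IsLieBracket (a • lieBr + b • br)

/-- The modified bracket `[x, y]_W = [W x, y] + [x, W y] - W [x, y]`. -/
def modBr (W : Module.End ℂ L) : L →ₗ[ℂ] L →ₗ[ℂ] L :=
  lieBr ∘ₗ W + lieBr.compl₂ W - lieBr.compr₂ W

theorem modBr_apply (W : Module.End ℂ L) (x y : L) :
    modBr W x y = ⁅W x, y⁆ + ⁅x, W y⁆ - W ⁅x, y⁆ := by
  simp [modBr, lieBr]

/-- Weak Nijenhuis operators. -/
def IsWNO (W : Module.End ℂ L) : Prop := IsLieBracket (modBr W)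

/-- An operator is principal if it is orthogonal to `ad L` for the trace form of `End L`. -/
def IsPrincipal (W : Module.End ℂ L) : Prop :=
  ∀ x : L, LinearMap.trace ℂ L (W * LieAlgebra.ad ℂ L x) = 0

/-- `W` is the principal weak Nijenhuis operator of the bi-Lie structure `(L, [,], br)`. -/
def IsPrincipalWNO (br : L →ₗ[ℂ] L →ₗ[ℂ] L) (W : Module.End ℂ L) : Prop :=
  IsWNO W ∧ br = modBr W ∧ IsPrincipal W

/-- `P` is the principal primitive of `W`: `ad (P x)` is the orthogonal projection of
`(1/2) [W, [W, ad x]]` to `ad L` with respect to the trace form of `End L`. (The trace form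
restricts to the Killing form on `ad L ≅ L`; as the latter is nondegenerate for semisimple `L`,
exactly one operator `P` satisfies this.) -/
def IsPrincipalPrimitive (W P : Module.End ℂ L) : Prop :=
  ∀ x y : L, killingForm ℂ L (P x) y =
    (1 / 2 : ℂ) * LinearMap.trace ℂ L (⁅W, ⁅W, LieAlgebra.ad ℂ L x⁆⁆ * LieAlgebra.ad ℂ L y)

/-- The bracket `[,]^t = br - t [,]` of the pencil. -/
def pencilBr (br : L →ₗ[ℂ] L →ₗ[ℂ] L) (t : ℂ) : L →ₗ[ℂ] L →ₗ[ℂ] L := br - t • lieBr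

/-- The times of `(L, [,], br)`: those `t` for which the Killing form of the bracket `br - t [,]`
is degenerate. -/
def times (br : L →ₗ[ℂ] L →ₗ[ℂ] L) : Set ℂ :=
  {t | ∃ x : L, x ≠ 0 ∧ ∀ y : L,
    LinearMap.trace ℂ L (pencilBr br t x ∘ₗ pencilBr br t y) = 0}

/-- The centre of the bracket `br - t [,]`. -/
def centre (br : L →ₗ[ℂ] L →ₗ[ℂ] L) (t : ℂ) : Submodule ℂ L := LinearMap.ker (pencilBr br t)

/-- The central subalgebra (as a subspace): the sum of the centres of the brackets `br - t [,]`
(only finitely many of them are nonzero when `L` is semisimple). -/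
def central (br : L →ₗ[ℂ] L →ₗ[ℂ] L) : Submodule ℂ L := ⨆ t : ℂ, centre br t

/-- Regularity: the central subalgebra contains some Cartan subalgebra. -/
def IsRegular (br : L →ₗ[ℂ] L →ₗ[ℂ] L) : Prop :=
  ∃ H : LieSubalgebra ℂ L, H.IsCartanSubalgebra ∧ H.toSubmodule ≤ central br

/-- Strong isomorphism of the bi-Lie structures `(L, [,], br)` and `(L', [,], br')`. -/
def StronglyIsomorphic {L' : Type*} [LieRing L'] [LieAlgebra ℂ L']
    (br : L →ₗ[ℂ] L →ₗ[ℂ] L) (br' : L' →ₗ[ℂ] L' →ₗ[ℂ] L') : Prop :=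
  ∃ φ : L ≃ₗ⁅ℂ⁆ L', ∀ x y, φ (br x y) = br' (φ x) (φ y)

/-- Isomorphism of the bi-Lie structures `(L, [,], br)` and `(L', [,], br')`: the first bracket is
carried to the first bracket and the second one to a linear combination of the two brackets
which together with the first bracket spans the same pencil (`c ≠ 0`). -/
def Isomorphic {L' : Type*} [LieRing L'] [LieAlgebra ℂ L']
    (br : L →ₗ[ℂ] L →ₗ[ℂ] L) (br' : L' →ₗ[ℂ] L' →ₗ[ℂ] L') : Prop :=
  ∃ φ : L ≃ₗ⁅ℂ⁆ L', ∃ c d : ℂ, c ≠ 0 ∧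
    ∀ x y, φ (br x y) = c • br' (φ x) (φ y) + d • ⁅φ x, φ y⁆

end Brackets

section Cartan

variable {L : Type*} [LieRing L] [LieAlgebra ℂ L] [FiniteDimensional ℂ L]
variable (H : LieSubalgebra ℂ L) [H.IsCartanSubalgebra]

/-- The root space of `χ : H → ℂ` as a subspace of `L`. The roots are the weights
`α : LieModule.Weight ℂ H L` with `α.IsNonZero`. -/
def rootSub (χ : H → ℂ) : Submodule ℂ L := (LieAlgebra.rootSpace H χ).toSubmodule

/-- The orthogonal complement of the Cartan subalgebra with respect to the Killing form. -/
noncomputable def cartanPerp : Submodule ℂ L := (killingForm ℂ L).orthogonal H.toSubmodule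

/-- `W` preserves the root grading with respect to `H`, and its restriction to `H` is
diagonalizable. -/
def PreservesRootGrading (W : Module.End ℂ L) : Prop :=
  (∀ h ∈ H, W h ∈ H) ∧
  (∀ α : LieModule.Weight ℂ H L, α.IsNonZero → ∀ e ∈ rootSub H α, W e ∈ rootSub H α) ∧
  H.toSubmodule ≤ ⨆ t : ℂ, H.toSubmodule ⊓ Module.End.eigenspace W t

/-- The unordered pair of times of the root `α` is `{t₁, t₂}`, i.e. `t₁, t₂` are (with
multiplicity) the solutions of `(t - lam_α) (t - lam_{-α}) - 2 pi_α = 0`, where the principal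
operator `W` acts as `lam_α`, `lam_{-α}` on the root spaces of `α`, `-α` and the principal primitive
of `W` acts as `pi_α` on the root space of `α`. -/
def IsTimesPair (W : Module.End ℂ L) (α : LieModule.Weight ℂ H L) (t₁ t₂ : ℂ) : Prop :=
  ∃ P : Module.End ℂ L, IsPrincipalPrimitive W P ∧ ∃ l l' p : ℂ,
    (∀ e ∈ rootSub H α, W e = l • e) ∧
    (∀ e ∈ rootSub H (-α), W e = l' • e) ∧
    (∀ e ∈ rootSub H α, P e = p • e) ∧
    ∀ t : ℂ, (t - l) * (t - l') - 2 * p = (t - t₁) * (t - t₂)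

/-- `(L, [,], br)` is a regular bi-Lie structure whose principal operator `W` preserves the root
grading of `H` and is diagonalizable on `H`, and the diagram of pairs of times of `W` is of Class I:
there is no triangle of roots `α + β + γ = 0` all of whose pairs of times are equal to the same
`{t₁, t₂}` with `t₁ ≠ t₂`. -/
def IsClassI (br : L →ₗ[ℂ] L →ₗ[ℂ] L) : Prop :=
  IsBiLie br ∧ IsRegular br ∧ ∃ W : Module.End ℂ L, IsPrincipalWNO br W ∧
    PreservesRootGrading H W ∧
    ¬ ∃ α β γ : LieModule.Weight ℂ H L, α.IsNonZero ∧ β.IsNonZero ∧ γ.IsNonZero ∧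
      (α : H → ℂ) + β + γ = 0 ∧ ∃ t₁ t₂ : ℂ, t₁ ≠ t₂ ∧
        IsTimesPair H W α t₁ t₂ ∧ IsTimesPair H W β t₁ t₂ ∧ IsTimesPair H W γ t₁ t₂

/-- The subspace `𝔤₀ᵗ`: the sum of `H ∩ ker (W - t)` and of the root spaces of those roots whose
pair of times is `{t, t}`. -/
def basicPart (W : Module.End ℂ L) (t : ℂ) : Submodule ℂ L :=
  (H.toSubmodule ⊓ Module.End.eigenspace W t) ⊔
    ⨆ α ∈ {α : LieModule.Weight ℂ H L | α.IsNonZero ∧ IsTimesPair H W α t t}, rootSub H α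

/-- The basic subalgebra (as a subspace) of a bi-Lie structure with principal operator `W`: the sum
of the `𝔤₀ᵗ` over those `t` for which the centre of `br - t [,]` is nonzero. -/
def basic (br : L →ₗ[ℂ] L →ₗ[ℂ] L) (W : Module.End ℂ L) : Submodule ℂ L :=
  ⨆ t ∈ {t : ℂ | centre br t ≠ ⊥}, basicPart H W t

/-- A toral (with respect to `H`) symmetric pairoid quasigrading of Class I on `L` with the finite
base `ι`. The vanishing condition for disjoint pairs (`lie_disjoint`) is imposed on the root spaces
only: for the toral parts `G s(x,x) ∩ H`, which normalize every component, it is not required. -/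
structure IsToralQuasigrading {ι : Type*} [Finite ι] (G : Sym2 ι → Submodule ℂ L) : Prop where
  /-- `L` is the direct sum of the `G p`. -/
  indep : iSupIndep G
  iSup_eq_top : ⨆ p, G p = ⊤
  ne_bot : ∀ x y : ι, x ≠ y → G s(x, y) ≠ ⊥
  lie_mem : ∀ x y u : ι, x ≠ u → ∀ a ∈ G s(x, y), ∀ b ∈ G s(y, u), ⁅a, b⁆ ∈ G s(x, u)
  lie_mem_diag : ∀ x y : ι, ∀ a ∈ G s(x, y), ∀ b ∈ G s(x, y), ⁅a, b⁆ ∈ G s(x, x) ⊔ G s(y, y)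
  lie_disjoint : ∀ p q : Sym2 ι, (∀ x, ¬ (x ∈ p ∧ x ∈ q)) →
    ∀ α β : LieModule.Weight ℂ H L, α.IsNonZero → β.IsNonZero →
      rootSub H α ≤ G p → rootSub H β ≤ G q →
      ∀ a ∈ rootSub H α, ∀ b ∈ rootSub H β, ⁅a, b⁆ = 0
  /-- Each component is the sum of some root spaces and a subspace of `H`. -/
  toral : ∀ p, ∃ V ≤ H.toSubmodule, ∃ S : Set (LieModule.Weight ℂ H L),
    (∀ α ∈ S, α.IsNonZero) ∧ G p = V ⊔ ⨆ α ∈ S, rootSub H α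
  cartan_le : H.toSubmodule ≤ ⨆ x : ι, G s(x, x)
  symm : ∀ p, ∀ α : LieModule.Weight ℂ H L, α.IsNonZero →
    rootSub H α ≤ G p → rootSub H (-α) ≤ G p

end Cartan

section Quasigradings

variable {L : Type*} [LieRing L] [LieAlgebra ℂ L]

/-- `W` acts on the component of the pair `{s, t}` as the scalar `(s + t) / 2`. -/
def IsOperatorOf (X : Finset ℂ) (G : Sym2 X → Submodule ℂ L) (W : Module.End ℂ L) : Prop :=
  ∀ s t : X, ∀ a ∈ G s(s, t), W a = (((s : ℂ) + (t : ℂ)) / 2) • a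

/-- Two quasigradings of `L` are equivalent via the bijection `χ` of their bases. -/
def EquivalentVia {ι ι' : Type*} (G : Sym2 ι → Submodule ℂ L) (G' : Sym2 ι' → Submodule ℂ L)
    (χ : ι ≃ ι') : Prop :=
  ∃ φ : L ≃ₗ⁅ℂ⁆ L, ∀ x y : ι,
    (G s(x, y)).map (φ : L →ₗ[ℂ] L) = G' s(χ x, χ y)

end Quasigradings

end BiLie

/-! From a quasigrading to a pencil. For t outside the base choose square roots s_x of x - t and let
φ act on 𝔤_{xy} as s_x s_y. The pairoid axioms say exactly that φ carries [,]_W - t[,] to [,]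
(`map_pencilBr`). So one bracket of the pencil with a nonzero coefficient at [,]_W satisfies Jacobi.
Jacobi is quadratic along the pencil and its mixed term vanishes for any coboundary [,]_W, so the
whole pencil is Lie (`isBiLie_modBr`). The same φ shows that t is not a time and that the centre at
t is zero; at t in the base, degeneracy follows by continuity from nearby parameters.

The principal primitive. Jacobi for [,]_W makes the torsion of W a 2-cocycle, and for principal W it
is the coboundary of P (`IsPrincipal.torsion_eq`, an explicit form of the second Whitehead lemma).
For a root-graded W this yields two relations: one for the action of W on a coroot
(`coroot_relation`), one for the eigenvalues on a triangle of roots (`triangle_relation`). For the W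
of a quasigrading, P acts on 𝔤_{xy} as (x - y)²/8. The numbers (x + y)/2 and (x - y)²/8 determine
{x, y}, so the components are the joint eigenspaces of W and P, and the times of a root are its
indices. Since W and P are determined by the bracket, an isomorphism of pencils carries components
to components and acts on the base by an affine map; this is part 3.

From Class I to a quasigrading. If the eigenvalues of W on the roots of some triangle and on the
opposite roots have different sums, the triangle relations force a common pair of distinct times
(`times_of_triangle`), which Class I forbids. So the odd part of the eigenvalues is additive on
triangles and defines a derivation orthogonal to ad 𝔤, which must vanish (`scalar_neg_eq`). With
even eigenvalues the triangle relations say that a triangle has pairs of times {x, y}, {y, z}, {x,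
z}, while each coroot splits into W-eigenvectors for the times of its root. These are the pairoid
axioms. Simplicity enters only to make 𝔤_{xy} nonzero for all x ≠ y: the roots with time x span a
reflection-invariant subspace, hence everything (`exists_pair_eq`). -/

namespace BiLie

open LieAlgebra LieModule

/-! ### Weak Nijenhuis operators, their primitives and the centres of the pencil -/

section Operators

variable {L : Type*} [LieRing L] [LieAlgebra ℂ L]

theorem lieBr_apply (x y : L) : lieBr x y = ⁅x, y⁆ := rfl

theorem pencilBr_apply (br : L →ₗ[ℂ] L →ₗ[ℂ] L) (t : ℂ) (x y : L) :
    pencilBr br t x y = br x y - t • ⁅x, y⁆ := rfl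

/-- Jacobi for a[,] + b[,]_W is quadratic in (a, b). The a² term is Jacobi for [,], and the ab term
vanishes for every W because [,]_W is a coboundary. Hence one bracket with b ≠ 0 settles the b²
term. -/
theorem isBiLie_modBr {W : Module.End ℂ L} {t : ℂ}
    (h : IsLieBracket (pencilBr (modBr W) t)) : IsBiLie (modBr W) := by
  have hself : ∀ x, modBr W x x = 0 := fun x => by
    rw [modBr_apply, lie_self, map_zero, sub_zero, ← lie_skew, neg_add_cancel]
  have hlie : ∀ x y z : L, ⁅x, ⁅y, z⁆⁆ + ⁅y, ⁅z, x⁆⁆ + ⁅z, ⁅x, y⁆⁆ = 0 := lie_jacobi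
  have hcompat : ∀ x y z : L, ⁅x, modBr W y z⁆ + ⁅y, modBr W z x⁆ + ⁅z, modBr W x y⁆ +
      (modBr W x ⁅y, z⁆ + modBr W y ⁅z, x⁆ + modBr W z ⁅x, y⁆) = 0 := fun x y z => by
    have h1 := hlie (W x) y z
    have h2 := hlie x (W y) z
    have h3 := hlie x y (W z)
    have h4 : W ⁅x, ⁅y, z⁆⁆ + W ⁅y, ⁅z, x⁆⁆ + W ⁅z, ⁅x, y⁆⁆ = 0 := by
      rw [← map_add, ← map_add, hlie, map_zero]
    simp only [modBr_apply, lie_add, lie_sub]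
    linear_combination (norm := module) h1 + h2 + h3 - h4
  have hmod : ∀ x y z : L, modBr W x (modBr W y z) + modBr W y (modBr W z x) +
      modBr W z (modBr W x y) = 0 := fun x y z => by
    have h1 := h.2 x y z
    simp only [pencilBr_apply, map_sub, map_smul] at h1
    linear_combination (norm := module) h1 + t • hcompat x y z - (t * t) • hlie x y z
  intro a b
  refine ⟨fun x => ?_, fun x y z => ?_⟩
  · simp [lieBr_apply, hself]
  · simp only [LinearMap.add_apply, LinearMap.smul_apply, lieBr_apply, map_add, map_smul]
    linear_combination (norm := module) (a * a) • hlie x y z + (a * b) • hcompat x y z +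
      (b * b) • hmod x y z

theorem IsBiLie.isLieBracket {br : L →ₗ[ℂ] L →ₗ[ℂ] L} (h : IsBiLie br) : IsLieBracket br := by
  simpa using h 0 1

variable [FiniteDimensional ℂ L]

theorem killingForm_eq_trace (x y : L) :
    killingForm ℂ L x y = LinearMap.trace ℂ L (ad ℂ L x * ad ℂ L y) := rfl

theorem ad_lie_eq (x y : L) : ad ℂ L ⁅x, y⁆ = ad ℂ L x * ad ℂ L y - ad ℂ L y * ad ℂ L x := by
  ext z
  simp only [ad_apply, LinearMap.sub_apply, Module.End.mul_apply, lie_lie]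

/-- The trace form of a double commutator, expanded. -/
theorem trace_lie_lie (W A B : Module.End ℂ L) :
    LinearMap.trace ℂ L (⁅W, ⁅W, A⁆⁆ * B) =
      LinearMap.trace ℂ L (W * W * A * B) + LinearMap.trace ℂ L (W * W * B * A) -
        2 * LinearMap.trace ℂ L (W * A * W * B) := by
  have e : ⁅W, ⁅W, A⁆⁆ * B = W * W * A * B - W * A * W * B - W * A * W * B + A * (W * W * B) := by
    simp only [Ring.lie_def]; noncomm_ring
  rw [e, map_add, map_sub, map_sub, LinearMap.trace_mul_comm ℂ A]
  ring

theorem trace_WAWB_comm (W A B : Module.End ℂ L) :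
    LinearMap.trace ℂ L (W * A * W * B) = LinearMap.trace ℂ L (W * B * W * A) := by
  rw [mul_assoc (W * A), LinearMap.trace_mul_comm ℂ (W * A), ← mul_assoc]

variable [IsKilling ℂ L]

theorem eq_of_killingForm {x y : L} (h : ∀ z, killingForm ℂ L x z = killingForm ℂ L y z) :
    x = y := by
  have hk := IsKilling.ker_killingForm_eq_bot ℂ L
  exact LinearMap.ker_eq_bot.mp hk (LinearMap.ext h)

/-- Operators which are adjoint to each other for the Killing form have the same trace. -/
theorem trace_eq_of_adjoint {A B : Module.End ℂ L}
    (h : ∀ x y, killingForm ℂ L (A x) y = killingForm ℂ L x (B y)) :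
    LinearMap.trace ℂ L A = LinearMap.trace ℂ L B := by
  have hinj : Function.Injective (killingForm ℂ L) :=
    LinearMap.ker_eq_bot.mp (IsKilling.ker_killingForm_eq_bot ℂ L)
  let e : L ≃ₗ[ℂ] Module.Dual ℂ L :=
    LinearEquiv.ofInjectiveOfFinrankEq (killingForm ℂ L) hinj
      (Subspace.dual_finrank_eq).symm
  have he : ∀ x, e x = killingForm ℂ L x := fun x => rfl
  have h1 : e.conj A = Module.Dual.transpose B := by
    refine LinearMap.ext fun f => ?_
    obtain ⟨x, rfl⟩ := e.surjective f
    rw [LinearEquiv.conj_apply_apply, e.symm_apply_apply]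
    ext y
    rw [he, h, he]
    rfl
  rw [← LinearMap.trace_conj' A e, h1, LinearMap.trace_transpose']

/-- The operator representing a bilinear form through the Killing form. -/
theorem exists_killingForm_eq (B : LinearMap.BilinForm ℂ L) :
    ∃ P : Module.End ℂ L, ∀ x y, killingForm ℂ L (P x) y = B x y := by
  have hinj : Function.Injective (killingForm ℂ L) :=
    LinearMap.ker_eq_bot.mp (IsKilling.ker_killingForm_eq_bot ℂ L)
  let e : L ≃ₗ[ℂ] Module.Dual ℂ L :=
    LinearEquiv.ofInjectiveOfFinrankEq (killingForm ℂ L) hinj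
      (Subspace.dual_finrank_eq).symm
  refine ⟨e.symm.toLinearMap ∘ₗ B, fun x y => ?_⟩
  have : killingForm ℂ L (e.symm (B x)) = B x := e.apply_symm_apply (B x)
  exact LinearMap.congr_fun this y

theorem exists_isPrincipalPrimitive (W : Module.End ℂ L) : ∃ P, IsPrincipalPrimitive W P := by
  let B : LinearMap.BilinForm ℂ L := LinearMap.mk₂ ℂ
    (fun x y => (1 / 2 : ℂ) * LinearMap.trace ℂ L (⁅W, ⁅W, ad ℂ L x⁆⁆ * ad ℂ L y))
    (fun x x' y => by
      simp only [Ring.lie_def, map_add, mul_add, add_mul, mul_sub, sub_mul, map_sub]; ring)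
    (fun c x y => by
      simp only [Ring.lie_def, map_smul, smul_mul_assoc, mul_smul_comm, ← smul_sub, smul_eq_mul]
      ring)
    (fun x y y' => by simp only [map_add, mul_add])
    (fun c x y => by simp only [map_smul, mul_smul_comm, smul_eq_mul]; ring)
  exact exists_killingForm_eq B

theorem IsPrincipalPrimitive.unique {W P P' : Module.End ℂ L} (h : IsPrincipalPrimitive W P)
    (h' : IsPrincipalPrimitive W P') : P = P' :=
  LinearMap.ext fun x => eq_of_killingForm fun z => (h x z).trans (h' x z).symm

theorem IsPrincipalPrimitive.symm {W P : Module.End ℂ L} (h : IsPrincipalPrimitive W P) (x y : L) :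
    killingForm ℂ L (P x) y = killingForm ℂ L x (P y) := by
  rw [h, LieModule.traceForm_comm ℂ L L x, h, trace_lie_lie, trace_lie_lie, trace_WAWB_comm]
  ring

theorem IsPrincipalPrimitive.apply_eq_zero {W P : Module.End ℂ L} (h : IsPrincipalPrimitive W P)
    {z : L} (hz : ⁅W, ad ℂ L z⁆ = 0) : P z = 0 :=
  eq_of_killingForm fun y => by rw [h, hz]; simp [Ring.lie_def]

/-- The form defining P is invariant under ad z as soon as ad z commutes with W; nondegeneracy of
the Killing form transfers this to P. -/
theorem IsPrincipalPrimitive.lie {W P : Module.End ℂ L} (h : IsPrincipalPrimitive W P)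
    {z : L} (hz : ⁅W, ad ℂ L z⁆ = 0) (x : L) : P ⁅z, x⁆ = ⁅z, P x⁆ := by
  have hz' : W * ad ℂ L z = ad ℂ L z * W := by rwa [Ring.lie_def, sub_eq_zero] at hz
  refine eq_of_killingForm fun y => ?_
  have e : killingForm ℂ L ⁅z, P x⁆ y = - killingForm ℂ L (P x) ⁅z, y⁆ := by
    rw [← lie_skew, map_neg, LinearMap.neg_apply, LieModule.traceForm_apply_lie_apply]
  rw [e, h, h, ad_lie_eq, ad_lie_eq]
  have e1 : ⁅W, ⁅W, ad ℂ L z * ad ℂ L x - ad ℂ L x * ad ℂ L z⁆⁆ =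
      ad ℂ L z * ⁅W, ⁅W, ad ℂ L x⁆⁆ - ⁅W, ⁅W, ad ℂ L x⁆⁆ * ad ℂ L z := by
    have h2 : W * W * ad ℂ L z = ad ℂ L z * (W * W) := by
      rw [mul_assoc, hz', ← mul_assoc, hz', mul_assoc]
    simp only [Ring.lie_def, mul_sub, sub_mul, ← mul_assoc]
    simp only [mul_assoc]
    simp only [← mul_assoc, hz']
    simp only [mul_assoc]
    noncomm_ring
  rw [e1, sub_mul, mul_sub, map_sub, map_sub, mul_assoc, LinearMap.trace_mul_comm ℂ (ad ℂ L z)]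
  simp only [mul_assoc]
  ring

/-- Derivations of `L` which are orthogonal to `ad L` vanish. -/
theorem eq_zero_of_derivation {D : Module.End ℂ L} (hD : ∀ x y, D ⁅x, y⁆ = ⁅D x, y⁆ + ⁅x, D y⁆)
    (hp : IsPrincipal D) : D = 0 := by
  let D' : LieDerivation ℂ L L := ⟨D, fun a b => by
    rw [hD, ← lie_skew b (D a)]; abel⟩
  obtain ⟨x, hx⟩ := LieDerivation.IsKilling.exists_eq_ad D'
  have hDx : D = ad ℂ L x := by
    ext y
    have := congrArg (fun E : LieDerivation ℂ L L => E y) hx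
    have h1 : D' y = D y := rfl
    rw [ad_apply, ← h1, ← hx, LieDerivation.ad_apply_apply]
  have hx0 : x = 0 := eq_of_killingForm fun z => by
    rw [killingForm_eq_trace, ← hDx, hp z]; simp
  rw [hDx, hx0, map_zero]

/-- Operators with the same modified bracket differ by a derivation, which is inner here;
orthogonality to ad L removes this freedom. -/
theorem IsPrincipal.eq_of_modBr_eq {W W' : Module.End ℂ L} (hW : IsPrincipal W)
    (hW' : IsPrincipal W') (h : modBr W = modBr W') : W = W' := by
  rw [← sub_eq_zero]
  refine eq_zero_of_derivation (fun x y => ?_) fun x => ?_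
  · have := LinearMap.congr_fun₂ h x y
    simp only [modBr_apply] at this
    simp only [LinearMap.sub_apply, sub_lie, lie_sub]
    linear_combination (norm := module) - this
  · rw [sub_mul, map_sub, hW, hW', sub_zero]

/-- The torsion of a principal weak Nijenhuis operator is the coboundary of its principal
primitive. -/
theorem IsPrincipal.torsion_eq {W P : Module.End ℂ L} (hW : IsPrincipal W)
    (hN : IsLieBracket (modBr W)) (hP : IsPrincipalPrimitive W P) (x y : L) :
    ⁅W x, W y⁆ - W ⁅W x, y⁆ - W ⁅x, W y⁆ + W (W ⁅x, y⁆) = ⁅P x, y⁆ + ⁅x, P y⁆ - P ⁅x, y⁆ := by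
  -- The torsion as an operator in its second argument, so that traces can be taken.
  let τ : L → Module.End ℂ L := fun x =>
    W * (W * ad ℂ L x - ad ℂ L x * W) - (W * ad ℂ L (W x) - ad ℂ L (W x) * W)
  have hτ : ∀ x y, τ x y = ⁅W x, W y⁆ - W ⁅W x, y⁆ - W ⁅x, W y⁆ + W (W ⁅x, y⁆) := fun x y => by
    simp only [τ, LinearMap.sub_apply, Module.End.mul_apply, ad_apply, map_sub]
    abel
  have hskew : ∀ x y, τ x y = - τ y x := fun x y => by
    rw [hτ, hτ, ← lie_skew (W y), ← lie_skew (W y), ← lie_skew y, ← lie_skew y]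
    simp only [map_neg]
    abel
  have hlie : ∀ x y z : L, ⁅x, ⁅y, z⁆⁆ + ⁅y, ⁅z, x⁆⁆ + ⁅z, ⁅x, y⁆⁆ = 0 := lie_jacobi
  -- The torsion is a 2-cocycle: this is Jacobi for [,]_W, corrected by Jacobi for [,] with some
  -- arguments replaced by their images under W.
  have hcoc : ∀ x y z, ⁅x, τ y z⁆ + ⁅y, τ z x⁆ + ⁅z, τ x y⁆ +
      (τ x ⁅y, z⁆ + τ y ⁅z, x⁆ + τ z ⁅x, y⁆) = 0 := fun x y z => by
    have hj := hN.2 x y z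
    have j0 := congrArg W (congrArg W (hlie x y z))
    have j1 := congrArg W (hlie (W x) y z)
    have j2 := congrArg W (hlie x (W y) z)
    have j3 := congrArg W (hlie x y (W z))
    simp only [modBr_apply, map_add, map_zero, map_sub] at hj j0 j1 j2 j3
    simp only [hτ, lie_add, lie_sub]
    linear_combination (norm := module) - hj + hlie (W x) (W y) z + hlie x (W y) (W z) +
      hlie (W x) y (W z) - j1 - j2 - j3 + j0
  -- The cocycle identity with two arguments fixed, read as an identity of operators in the third.
  have had : ∀ y z, ad ℂ L (τ y z) =
      τ y * ad ℂ L z - ad ℂ L z * τ y + (ad ℂ L y * τ z - τ z * ad ℂ L y) - τ ⁅y, z⁆ := by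
    intro y z
    ext u
    have h1 := hcoc u y z
    rw [hskew u y, hskew u ⁅y, z⁆, ← lie_skew u y, ← lie_skew u (τ y z)] at h1
    simp only [LinearMap.sub_apply, LinearMap.add_apply, Module.End.mul_apply, ad_apply]
    simp only [lie_neg, map_neg] at h1
    linear_combination (norm := module) - h1
  -- Pairing τ x with ad y recovers P up to a term alternating in x and y. Principality, applied to
  -- ⁅W x, y⁆, removes the terms with ad (W x).
  have hb : ∀ x y, LinearMap.trace ℂ L (τ x * ad ℂ L y) = killingForm ℂ L (P x) y +
      (1 / 2 : ℂ) * LinearMap.trace ℂ L (W * W * ad ℂ L ⁅x, y⁆) := by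
    intro x y
    have h1 := hW ⁅W x, y⁆
    rw [hP, trace_lie_lie, ad_lie_eq]
    rw [ad_lie_eq, mul_sub, map_sub, ← mul_assoc, ← mul_assoc, sub_eq_zero] at h1
    have h2 : LinearMap.trace ℂ L (ad ℂ L (W x) * W * ad ℂ L y) =
        LinearMap.trace ℂ L (W * ad ℂ L y * ad ℂ L (W x)) := by
      rw [mul_assoc, LinearMap.trace_mul_comm]
    have h3 : τ x * ad ℂ L y = W * W * ad ℂ L x * ad ℂ L y - W * ad ℂ L x * W * ad ℂ L y -
        (W * ad ℂ L (W x) * ad ℂ L y - ad ℂ L (W x) * W * ad ℂ L y) := by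
      simp only [τ]; noncomm_ring
    rw [h3, map_sub, map_sub, map_sub, h2, h1, mul_sub (W * W), map_sub, ← mul_assoc, ← mul_assoc]
    ring
  have hcomm : ∀ (A B C : Module.End ℂ L), LinearMap.trace ℂ L ((A * B - B * A) * C) =
      LinearMap.trace ℂ L (A * (B * C - C * B)) := fun A B C => by
    rw [sub_mul, mul_sub, map_sub, map_sub, mul_assoc, mul_assoc, LinearMap.trace_mul_comm ℂ B,
      mul_assoc]
  rw [← hτ]
  refine eq_of_killingForm fun u => ?_
  have h1 : LinearMap.trace ℂ L (τ x * ad ℂ L ⁅y, u⁆) =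
      LinearMap.trace ℂ L ((τ x * ad ℂ L y - ad ℂ L y * τ x) * ad ℂ L u) := by
    rw [hcomm, ad_lie_eq]
  have h2 : LinearMap.trace ℂ L (τ y * ad ℂ L ⁅u, x⁆) =
      LinearMap.trace ℂ L ((ad ℂ L x * τ y - τ y * ad ℂ L x) * ad ℂ L u) := by
    rw [← neg_sub (τ y * ad ℂ L x), neg_mul, map_neg, hcomm, ad_lie_eq, ← map_neg, ← mul_neg,
      neg_sub]
  have h3 : killingForm ℂ L (τ x y) u = LinearMap.trace ℂ L (τ x * ad ℂ L ⁅y, u⁆) +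
      LinearMap.trace ℂ L (τ y * ad ℂ L ⁅u, x⁆) - LinearMap.trace ℂ L (τ ⁅x, y⁆ * ad ℂ L u) := by
    rw [killingForm_eq_trace, had, h1, h2, sub_mul, add_mul, map_sub, map_add]
  -- The alternating corrections from the three uses of `hb` cancel by Jacobi.
  have h4 : LinearMap.trace ℂ L (W * W * ad ℂ L ⁅x, ⁅y, u⁆⁆) +
      LinearMap.trace ℂ L (W * W * ad ℂ L ⁅y, ⁅u, x⁆⁆) -
        LinearMap.trace ℂ L (W * W * ad ℂ L ⁅⁅x, y⁆, u⁆) = 0 := by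
    rw [← map_add, ← map_sub, ← mul_add, ← mul_sub, ← map_add, ← map_sub,
      ← lie_skew ⁅x, y⁆, sub_neg_eq_add, hlie x y u, map_zero, mul_zero, map_zero]
  rw [h3, hb, hb, hb, map_sub, map_add, LinearMap.sub_apply, LinearMap.add_apply,
    LieModule.traceForm_apply_lie_apply, ← lie_skew x (P y), map_neg, LinearMap.neg_apply,
    LieModule.traceForm_apply_lie_apply, ← lie_skew x u, map_neg]
  linear_combination (1 / 2 : ℂ) * h4

/-- The centre of `[,]_W - t [,]` consists of the `t`-eigenvectors `x` of `W` for which `ad x` commutes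
with `W`. -/
theorem mem_centre_modBr {W : Module.End ℂ L} (hW : IsPrincipal W) {t : ℂ} {x : L} :
    x ∈ centre (modBr W) t ↔ W x = t • x ∧ ∀ y, W ⁅x, y⁆ = ⁅x, W y⁆ := by
  have key : ∀ y, pencilBr (modBr W) t x y = ⁅W x - t • x, y⁆ + (⁅x, W y⁆ - W ⁅x, y⁆) := by
    intro y
    rw [pencilBr_apply, modBr_apply, sub_lie, smul_lie]
    abel
  constructor
  · intro hx
    have h0 : ∀ y, ⁅W x - t • x, y⁆ + (⁅x, W y⁆ - W ⁅x, y⁆) = 0 := fun y => by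
      rw [← key, LinearMap.mem_ker.mp hx, LinearMap.zero_apply]
    have h1 : ad ℂ L (W x - t • x) = W * ad ℂ L x - ad ℂ L x * W := by
      ext y
      have := h0 y
      simp only [LinearMap.sub_apply, Module.End.mul_apply, ad_apply]
      linear_combination (norm := module) this
    -- The trace of [W, ad x] ad z equals that of W ad ⁅x, z⁆, which is zero for principal W. So the
    -- difference lies in the radical of the Killing form.
    have h2 : W x - t • x = 0 := eq_of_killingForm fun z => by
      have h3 := hW ⁅x, z⁆
      rw [killingForm_eq_trace, h1, sub_mul, map_sub, mul_assoc, mul_assoc,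
        LinearMap.trace_mul_comm ℂ (ad ℂ L x), mul_assoc, ← map_sub, ← mul_sub, ← ad_lie_eq, h3]
      simp
    refine ⟨sub_eq_zero.mp h2, fun y => ?_⟩
    have := h0 y
    rw [h2, zero_lie, zero_add, sub_eq_zero] at this
    exact this.symm
  · rintro ⟨h1, h2⟩
    refine LinearMap.mem_ker.mpr (LinearMap.ext fun y => ?_)
    rw [key, h1, h2]
    simp

theorem iSupIndep_centre {W : Module.End ℂ L} (hW : IsPrincipal W) :
    iSupIndep fun t : ℂ => centre (modBr W) t :=
  (Module.End.eigenspaces_iSupIndep W).mono fun _ _ hx =>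
    Module.End.mem_eigenspace_iff.mpr ((mem_centre_modBr hW).mp hx).1

theorem exists_subalgebra_central {W : Module.End ℂ L} (hW : IsPrincipal W) :
    ∃ K : LieSubalgebra ℂ L, K.toSubmodule = central (modBr W) := by
  refine ⟨{ central (modBr W) with lie_mem' := ?_ }, rfl⟩
  intro x y hx hy
  change x ∈ ⨆ t, centre (modBr W) t at hx
  change y ∈ ⨆ t, centre (modBr W) t at hy
  change ⁅x, y⁆ ∈ ⨆ t, centre (modBr W) t
  induction hx using Submodule.iSup_induction' with
  | zero => simp
  | add x x' _ _ h h' => rw [add_lie]; exact add_mem h h'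
  | mem t x hx =>
    induction hy using Submodule.iSup_induction' with
    | zero => simp
    | add y y' _ _ h h' => rw [lie_add]; exact add_mem h h'
    | mem s y hy =>
      -- Since ad x commutes with W, the bracket keeps the W-eigenvalue s of y; so it lands in the
      -- centre at s.
      refine Submodule.mem_iSup_of_mem s ((mem_centre_modBr hW).mpr ?_)
      rw [mem_centre_modBr hW] at hx hy
      refine ⟨by rw [hx.2, hy.1, lie_smul], fun z => ?_⟩
      rw [lie_lie, lie_lie, map_sub, hx.2, hy.2, hy.2, hx.2]

/-- Each ad x is skew for the Killing form, hence traceless, so the identity is orthogonal to ad L.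
-/
theorem IsPrincipal.smul_add {W : Module.End ℂ L} (hW : IsPrincipal W) (c d : ℂ) :
    IsPrincipal (c • W + d • (1 : Module.End ℂ L)) := fun x => by
  have h1 : LinearMap.trace ℂ L (ad ℂ L x) = 0 := by
    have h := trace_eq_of_adjoint (A := ad ℂ L x) (B := - ad ℂ L x) fun u v => by
      rw [LinearMap.neg_apply, map_neg, ad_apply, ad_apply, ← lie_skew, map_neg,
        LinearMap.neg_apply, LieModule.traceForm_apply_lie_apply]
    rw [map_neg] at h
    linear_combination (1 / 2 : ℂ) * h
  rw [add_mul, map_add, smul_mul_assoc, smul_mul_assoc, map_smul, map_smul, hW, one_mul, h1]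
  simp

end Operators

/-! ### Operators that are scalar on the summands of a direct decomposition -/

section DirectSums

variable {M : Type*} [AddCommGroup M] [Module ℂ M] {ι : Type*} [Finite ι]

theorem sum_mem_eq_zero {G : ι → Submodule ℂ M} [Fintype ι] (hi : iSupIndep G) {f : ι → M}
    (hf : ∀ i, f i ∈ G i) (h0 : ∑ i, f i = 0) (i : ι) : f i = 0 :=
  (iSupIndep_iff_finsetSum_eq_zero_imp_eq_zero G).mp hi Finset.univ f (fun i _ => hf i) h0 i
    (Finset.mem_univ i)

theorem exists_sum_mem {G : ι → Submodule ℂ M} [Fintype ι] {a : M} (ha : a ∈ ⨆ i, G i) :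
    ∃ f : ι → M, (∀ i, f i ∈ G i) ∧ ∑ i, f i = a := by
  obtain ⟨f, hf, h⟩ := (Submodule.mem_iSup_iff_exists_finsupp G a).mp ha
  refine ⟨f, hf, ?_⟩
  rw [← h, Finsupp.sum_fintype _ _ fun _ => rfl]

/-- A family of scalars on a direct decomposition defines an operator. -/
theorem exists_end_of_indep {G : ι → Submodule ℂ M} (hi : iSupIndep G) (ht : ⨆ i, G i = ⊤)
    (c : ι → ℂ) : ∃ T : Module.End ℂ M, ∀ i, ∀ a ∈ G i, T a = c i • a := by
  classical
  have hG := (DirectSum.isInternal_submodule_iff_iSupIndep_and_iSup_eq_top G).mpr ⟨hi, ht⟩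
  let e := LinearEquiv.ofBijective (DirectSum.coeLinearMap G) hG
  refine ⟨DirectSum.toModule ℂ ι M (fun i => c i • (G i).subtype) ∘ₗ e.symm.toLinearMap,
    fun i a ha => ?_⟩
  have h1 : e (DirectSum.lof ℂ ι (fun i => G i) i ⟨a, ha⟩) = a :=
    DirectSum.coeLinearMap_lof G i ⟨a, ha⟩
  have h2 : e.symm a = DirectSum.lof ℂ ι (fun i => G i) i ⟨a, ha⟩ := by
    rw [LinearEquiv.symm_apply_eq, h1]
  simp [h2]

theorem end_ext_of_iSup {N : Type*} [AddCommGroup N] [Module ℂ N] {G : ι → Submodule ℂ M}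
    (ht : ⨆ i, G i = ⊤) {T T' : M →ₗ[ℂ] N} (h : ∀ i, ∀ a ∈ G i, T a = T' a) : T = T' := by
  refine LinearMap.ext fun x => ?_
  have hx : x ∈ ⨆ i, G i := ht ▸ Submodule.mem_top
  have : ⨆ i, G i ≤ LinearMap.eqLocus T T' := iSup_le fun i a ha => h i a ha
  exact this hx

/-- Eigenvectors of an operator which is scalar on the components of a direct decomposition. -/
theorem component_eq_zero {G : ι → Submodule ℂ M} [Fintype ι] (hi : iSupIndep G)
    {T : Module.End ℂ M} {c : ι → ℂ} (hT : ∀ i, ∀ a ∈ G i, T a = c i • a) {f : ι → M}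
    (hf : ∀ i, f i ∈ G i) {μ : ℂ} (hμ : T (∑ i, f i) = μ • ∑ i, f i) {i : ι} (hne : c i ≠ μ) :
    f i = 0 := by
  have h0 : ∑ i, (c i - μ) • f i = 0 := by
    rw [map_sum, Finset.smul_sum, ← sub_eq_zero, ← Finset.sum_sub_distrib] at hμ
    rw [← hμ]
    exact Finset.sum_congr rfl fun i _ => by rw [hT i _ (hf i), sub_smul]
  exact (smul_eq_zero.mp (sum_mem_eq_zero hi (fun i => (G i).smul_mem _ (hf i)) h0 i)).resolve_left
    (sub_ne_zero.mpr hne)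

end DirectSums

/-! ### Root spaces, coroots and root strings -/

section Roots

variable {L : Type*} [LieRing L] [LieAlgebra ℂ L] [FiniteDimensional ℂ L]
variable (H : LieSubalgebra ℂ L) [H.IsCartanSubalgebra]

/-- The sum of all root spaces. -/
def rootPart : Submodule ℂ L := ⨆ α : Weight ℂ H L, ⨆ _ : α.IsNonZero, rootSub H α

variable {H}

theorem rootSub_le_rootPart {α : Weight ℂ H L} (hα : α.IsNonZero) : rootSub H α ≤ rootPart H :=
  le_iSup₂_of_le (f := fun (α : Weight ℂ H L) (_ : α.IsNonZero) => rootSub H α) α hα le_rfl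

theorem rootSub_zero : rootSub H (0 : H → ℂ) = H.toSubmodule := by
  rw [rootSub, rootSpace_zero_eq]; rfl

theorem lie_mem_rootSub {χ ψ : H → ℂ} {e f : L} (he : e ∈ rootSub H χ) (hf : f ∈ rootSub H ψ) :
    ⁅e, f⁆ ∈ rootSub H (χ + ψ) :=
  lie_mem_genWeightSpace_of_mem_genWeightSpace he hf

theorem rootSub_eq_bot {χ : H → ℂ} (h : ¬ ∃ α : Weight ℂ H L, (α : H → ℂ) = χ) :
    rootSub H χ = ⊥ := by
  by_contra hne
  refine h ⟨⟨χ, fun h0 => hne ?_⟩, rfl⟩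
  rw [rootSub, rootSpace, h0]; rfl

theorem iSupIndep_rootSub : iSupIndep fun α : Weight ℂ H L => rootSub H α := by
  have := LieModule.iSupIndep_genWeightSpace' ℂ H L
  rw [← LieSubmodule.iSupIndep_toSubmodule] at this
  exact this

theorem iSupIndep_rootSub' : iSupIndep fun χ : H → ℂ => rootSub H χ := by
  have := LieModule.iSupIndep_genWeightSpace ℂ H L
  rw [← LieSubmodule.iSupIndep_toSubmodule] at this
  exact this

theorem disjoint_cartan_rootPart : Disjoint H.toSubmodule (rootPart H) := by
  have := iSupIndep_rootSub' (H := H) 0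
  rw [← rootSub_zero]
  refine this.mono_right (iSup₂_le fun α hα => ?_)
  exact le_iSup₂_of_le (f := fun (χ : H → ℂ) (_ : χ ≠ 0) => rootSub H χ) α hα le_rfl

theorem iSup_rootSub : ⨆ α : Weight ℂ H L, rootSub H α = ⊤ := by
  have := LieModule.iSup_genWeightSpace_eq_top' ℂ H L
  rw [← LieSubmodule.toSubmodule_inj, LieSubmodule.iSup_toSubmodule] at this
  exact this

theorem rootSub_of_isZero {α : Weight ℂ H L} (hα : ¬ α.IsNonZero) :
    rootSub H α = H.toSubmodule := by
  have : (α : H → ℂ) = 0 := not_not.mp hα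
  rw [this, rootSub_zero]

theorem cartan_sup_rootPart : H.toSubmodule ⊔ rootPart H = ⊤ := by
  rw [eq_top_iff, ← iSup_rootSub (H := H)]
  refine iSup_le fun α => ?_
  by_cases hα : α.IsNonZero
  · exact le_sup_of_le_right (rootSub_le_rootPart hα)
  · rw [rootSub_of_isZero hα]; exact le_sup_left

theorem rootPart_induction {p : L → Prop} (hroot : ∀ α : Weight ℂ H L, α.IsNonZero →
    ∀ e ∈ rootSub H α, p e) (h0 : p 0) (hadd : ∀ x y, p x → p y → p (x + y)) {x : L}
    (hx : x ∈ rootPart H) : p x := by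
  refine Submodule.iSup_induction _ (motive := p) hx (fun α e he => ?_) h0 hadd
  by_cases hα : α.IsNonZero
  · exact hroot α hα e (by rwa [iSup_pos hα] at he)
  · have : e = 0 := by simpa [iSup_neg hα] using he
    exact this ▸ h0

theorem root_induction {p : L → Prop} (hH : ∀ h ∈ H, p h)
    (hroot : ∀ α : Weight ℂ H L, α.IsNonZero → ∀ e ∈ rootSub H α, p e)
    (hadd : ∀ x y, p x → p y → p (x + y)) (x : L) : p x := by
  have hx : x ∈ H.toSubmodule ⊔ rootPart H := cartan_sup_rootPart (H := H) ▸ Submodule.mem_top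
  obtain ⟨h, hh, r, hr, rfl⟩ := Submodule.mem_sup.mp hx
  exact hadd h r (hH h hh) (rootPart_induction hroot (hH 0 H.zero_mem) hadd hr)

theorem exists_mem_rootSub_ne_zero (α : Weight ℂ H L) : ∃ e ∈ rootSub H α, e ≠ 0 :=
  α.exists_ne_zero

variable [IsKilling ℂ L]

theorem mem_rootSub {χ : H → ℂ} {e : L} : e ∈ rootSub H χ ↔ ∀ h : H, ⁅(h : L), e⁆ = χ h • e := by
  refine ⟨fun he h => IsKilling.lie_eq_smul_of_mem_rootSpace he h, fun he => ?_⟩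
  exact LieModule.weightSpace_le_genWeightSpace L χ
    ((LieModule.mem_weightSpace χ e).mpr he)

theorem lie_cartan {h h' : L} (hh : h ∈ H) (hh' : h' ∈ H) : ⁅h, h'⁆ = 0 := by
  have hz : h' ∈ rootSub H (0 : H → ℂ) := by rw [rootSub_zero]; exact hh'
  simpa using mem_rootSub.mp hz ⟨h, hh⟩

theorem exists_smul_eq {α : Weight ℂ H L} (hα : α.IsNonZero) {e e' : L} (he : e ∈ rootSub H α)
    (h0 : e ≠ 0) (he' : e' ∈ rootSub H α) : ∃ c : ℂ, e' = c • e := by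
  obtain ⟨c, hc⟩ := (finrank_eq_one_iff_of_nonzero' (⟨e, he⟩ : rootSpace H α)
    (fun h => h0 (congrArg Subtype.val h))).mp (IsKilling.finrank_rootSpace_eq_one α hα) ⟨e', he'⟩
  exact ⟨c, (congrArg Subtype.val hc).symm⟩

theorem exists_scalar {α : Weight ℂ H L} (hα : α.IsNonZero) {W : Module.End ℂ L}
    (hW : ∀ e ∈ rootSub H α, W e ∈ rootSub H α) : ∃ l : ℂ, ∀ e ∈ rootSub H α, W e = l • e := by
  obtain ⟨e, he, h0⟩ := exists_mem_rootSub_ne_zero α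
  obtain ⟨l, hl⟩ := exists_smul_eq hα he h0 (hW e he)
  refine ⟨l, fun e' he' => ?_⟩
  obtain ⟨c, rfl⟩ := exists_smul_eq hα he h0 he'
  rw [map_smul, hl, smul_comm]

/-- The root vectors of `α` and `-α` produce the coroot. -/
theorem exists_coroot {α : Weight ℂ H L} (hα : α.IsNonZero) : ∃ e ∈ rootSub H α,
    ∃ f ∈ rootSub H (-α), e ≠ 0 ∧ f ≠ 0 ∧ ⁅e, f⁆ = (IsKilling.coroot α : L) := by
  obtain ⟨h, e, f, ht, he, hf⟩ := IsKilling.exists_isSl2Triple_of_weight_isNonZero hα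
  exact ⟨e, he, f, hf, ht.e_ne_zero, ht.f_ne_zero, by rw [ht.lie_e_f, ht.h_eq_coroot hα he hf]⟩

theorem exists_lie_eq_smul_coroot {α : Weight ℂ H L} (hα : α.IsNonZero) {e f : L}
    (he : e ∈ rootSub H α) (hf : f ∈ rootSub H (-α)) :
    ∃ c : ℂ, ⁅e, f⁆ = c • (IsKilling.coroot α : L) := by
  obtain ⟨e', he', f', hf', h1, h2, h3⟩ := exists_coroot hα
  obtain ⟨c, rfl⟩ := exists_smul_eq hα he' h1 he
  obtain ⟨d, rfl⟩ := exists_smul_eq (α := -α) hα.neg hf' h2 hf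
  exact ⟨c * d, by rw [smul_lie, lie_smul, h3, smul_smul]⟩

theorem coroot_ne_zero {α : Weight ℂ H L} (hα : α.IsNonZero) :
    (IsKilling.coroot α : L) ≠ 0 := by
  simpa using hα

theorem cartan_le_of_coroot_mem {N : Submodule ℂ L}
    (hN : ∀ α : Weight ℂ H L, α.IsNonZero → (IsKilling.coroot α : L) ∈ N) :
    H.toSubmodule ≤ N := by
  have h1 : (⊤ : Submodule ℂ H) ≤ N.comap H.toSubmodule.subtype := by
    have := IsKilling.biSup_corootSpace_eq_top (K := ℂ) (L := L) H
    rw [← LieSubmodule.toSubmodule_inj] at this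
    simp only [LieSubmodule.iSup_toSubmodule] at this
    rw [LieSubmodule.top_toSubmodule] at this
    rw [← this]
    refine iSup₂_le fun α hα => ?_
    rw [IsKilling.coe_corootSpace_eq_span_singleton, Submodule.span_le]
    rintro _ rfl
    exact hN α hα
  exact fun h hh => h1 (Submodule.mem_top (x := (⟨h, hh⟩ : H)))

theorem add_eq_of_lie_ne_zero {α β : Weight ℂ H L} {e f : L} (he : e ∈ rootSub H α)
    (hf : f ∈ rootSub H β) (h : ⁅e, f⁆ ≠ 0) : ∃ γ : Weight ℂ H L, (γ : H → ℂ) = α + β := by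
  by_contra hne
  have := lie_mem_rootSub he hf
  rw [rootSub_eq_bot hne] at this
  exact h (by simpa using this)

/-- Representation theory of 𝔰𝔩₂ on the α-string through β, of length N. If x spans the top of the
string, then the root space of β is spanned by f^(k+1) x with k + 1 = `chainTopCoeff`, and e sends
this vector to (k + 1)(N - k) f^k x, where k < N. -/
theorem lie_ne_zero_of_add_eq {α β γ : Weight ℂ H L} (hα : α.IsNonZero) (hβ : β.IsNonZero)
    (h : (α : H → ℂ) + β = γ) {e f : L} (he : e ∈ rootSub H α) (hf : f ∈ rootSub H β)
    (he0 : e ≠ 0) (hf0 : f ≠ 0) : ⁅e, f⁆ ≠ 0 := by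
  obtain ⟨h, e', f', ht, he', hf'⟩ := IsKilling.exists_isSl2Triple_of_weight_isNonZero hα
  obtain rfl := ht.h_eq_coroot hα he' hf'
  obtain ⟨x, hx, x_ne0⟩ := (chainTop α β).exists_ne_zero
  have prim : ht.HasPrimitiveVectorWith x (IsKilling.chainLength α β : ℂ) :=
    have := lie_mem_genWeightSpace_of_mem_genWeightSpace he' hx
    ⟨x_ne0, (IsKilling.chainLength_smul _ _ hx).symm,
      by rwa [genWeightSpace_add_chainTop _ _ hα] at this⟩
  have hk : (1 : ℤ) ≤ chainTopCoeff (α : H → ℂ) β := by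
    refine ((IsKilling.rootSpace_zsmul_add_ne_bot_iff α β hα 1).mp ?_).1
    rw [one_smul, h]
    exact γ.genWeightSpace_ne_bot
  obtain ⟨k, hk'⟩ : ∃ k, chainTopCoeff (α : H → ℂ) β = k + 1 :=
    ⟨chainTopCoeff (α : H → ℂ) β - 1, by omega⟩
  have hN : k + 1 ≤ IsKilling.chainLength α β := hk' ▸ IsKilling.chainTopCoeff_le_chainLength α β
  have hv : (toEnd ℂ L L f' ^ (k + 1)) x ∈ rootSub H β := by
    have := toEnd_pow_apply_mem hf' hx (k + 1)
    have e1 : (k + 1) • (-(α : H → ℂ)) + (chainTop α β : H → ℂ) = β := by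
      rw [coe_chainTop', hk', smul_neg, neg_add_cancel_left]
    rwa [e1] at this
  have hv0 := prim.pow_toEnd_f_ne_zero_of_eq_nat rfl hN
  have hv1 := prim.pow_toEnd_f_ne_zero_of_eq_nat rfl (Nat.le_of_succ_le hN)
  obtain ⟨c, rfl⟩ := exists_smul_eq hα he' ht.e_ne_zero he
  obtain ⟨d, rfl⟩ := exists_smul_eq hβ hv hv0 hf
  rw [smul_lie, lie_smul, prim.lie_e_pow_succ_toEnd_f]
  refine smul_ne_zero (by rintro rfl; simp at he0) (smul_ne_zero (by rintro rfl; simp at hf0)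
    (smul_ne_zero (mul_ne_zero (by exact_mod_cast Nat.succ_ne_zero k) (sub_ne_zero.mpr ?_)) hv1))
  exact_mod_cast (by omega : IsKilling.chainLength α β ≠ k)

/-- For non-orthogonal roots the sum or the difference is a weight. -/
theorem exists_add_or_sub {α β : Weight ℂ H L} (hα : α.IsNonZero)
    (h : β (IsKilling.coroot α) ≠ 0) : (∃ γ : Weight ℂ H L, (γ : H → ℂ) = α + β) ∨
      ∃ γ : Weight ℂ H L, (γ : H → ℂ) = -α + β := by
  rw [IsKilling.apply_coroot_eq_cast] at h
  have h' : (chainBotCoeff (α : H → ℂ) β : ℤ) ≠ chainTopCoeff (α : H → ℂ) β := fun h0 =>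
    h (by rw [h0]; simp)
  rcases (by omega : (1 : ℤ) ≤ chainTopCoeff (α : H → ℂ) β ∨
    (1 : ℤ) ≤ chainBotCoeff (α : H → ℂ) β) with h1 | h1
  · left
    have := (IsKilling.rootSpace_zsmul_add_ne_bot_iff α β hα 1).mpr ⟨h1, by omega⟩
    rw [one_smul] at this
    exact ⟨⟨_, this⟩, rfl⟩
  · right
    have := (IsKilling.rootSpace_zsmul_add_ne_bot_iff α β hα (-1)).mpr ⟨by omega, by omega⟩
    rw [neg_one_smul] at this
    exact ⟨⟨_, this⟩, rfl⟩

theorem killingForm_rootSub {χ ψ : H → ℂ} {e f : L} (he : e ∈ rootSub H χ)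
    (hf : f ∈ rootSub H ψ) (h : χ + ψ ≠ 0) : killingForm ℂ L e f = 0 :=
  killingForm_apply_eq_zero_of_mem_rootSpace_of_add_ne_zero ℂ L H he hf h

theorem killingForm_cartan_rootPart {h r : L} (hh : h ∈ H) (hr : r ∈ rootPart H) :
    killingForm ℂ L h r = 0 := by
  refine rootPart_induction (p := fun r => killingForm ℂ L h r = 0) (fun α hα e he => ?_)
    (map_zero _) (fun x y hx hy => by rw [map_add, hx, hy, add_zero]) hr
  have hz : h ∈ rootSub H (0 : H → ℂ) := by rw [rootSub_zero]; exact hh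
  exact killingForm_rootSub hz he (by rw [zero_add]; exact hα)

theorem cartanPerp_eq : cartanPerp H = rootPart H := by
  ext x
  constructor
  · intro hx
    have hx' : x ∈ H.toSubmodule ⊔ rootPart H := cartan_sup_rootPart (H := H) ▸ Submodule.mem_top
    obtain ⟨h, hh, r, hr, rfl⟩ := Submodule.mem_sup.mp hx'
    suffices h = 0 by rw [this, zero_add]; exact hr
    refine eq_of_killingForm fun z => ?_
    rw [map_zero, LinearMap.zero_apply]
    have hz : z ∈ H.toSubmodule ⊔ rootPart H := cartan_sup_rootPart (H := H) ▸ Submodule.mem_top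
    obtain ⟨h', hh', r', hr', rfl⟩ := Submodule.mem_sup.mp hz
    have h1 := hx h' hh'
    change killingForm ℂ L h' (h + r) = 0 at h1
    rw [map_add, killingForm_cartan_rootPart hh' hr, add_zero] at h1
    rw [map_add, killingForm_cartan_rootPart hh hr', add_zero, LieModule.traceForm_comm, h1]
  · intro hx h hh
    exact killingForm_cartan_rootPart hh hx

end Roots

/-! ### Root-graded operators and the relations between their eigenvalues -/

section Graded

variable {L : Type*} [LieRing L] [LieAlgebra ℂ L] [FiniteDimensional ℂ L]
variable {H : LieSubalgebra ℂ L} [H.IsCartanSubalgebra]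

variable (H) in
/-- `W` preserves `H` and acts on the root space of `α` as the scalar `l α`. -/
structure IsRootGraded (W : Module.End ℂ L) (l : Weight ℂ H L → ℂ) : Prop where
  cartan : ∀ h ∈ H, W h ∈ H
  root : ∀ α : Weight ℂ H L, α.IsNonZero → ∀ e ∈ rootSub H α, W e = l α • e

variable [IsKilling ℂ L]

theorem PreservesRootGrading.exists_isRootGraded {W : Module.End ℂ L}
    (h : PreservesRootGrading H W) : ∃ l, IsRootGraded H W l := by
  classical
  have : ∀ α : Weight ℂ H L, ∃ l : ℂ, α.IsNonZero → ∀ e ∈ rootSub H α, W e = l • e := fun α => by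
    by_cases hα : α.IsNonZero
    · obtain ⟨l, hl⟩ := exists_scalar hα (h.2.1 α hα)
      exact ⟨l, fun _ => hl⟩
    · exact ⟨0, fun h => absurd h hα⟩
  choose l hl using this
  exact ⟨l, h.1, hl⟩

namespace IsRootGraded

variable {W : Module.End ℂ L} {l : Weight ℂ H L → ℂ}

theorem rootPart (h : IsRootGraded H W l) {x : L} (hx : x ∈ rootPart H) : W x ∈ BiLie.rootPart H :=
  rootPart_induction (p := fun x => W x ∈ BiLie.rootPart H)
    (fun α hα e he => by
      rw [h.root α hα e he]
      exact Submodule.smul_mem _ _ (rootSub_le_rootPart hα he))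
    (by simp) (fun x y hx hy => by rw [map_add]; exact add_mem hx hy) hx

theorem lie_cartan (h : IsRootGraded H W l) {z : L} (hz : z ∈ H) (x : L) :
    W ⁅z, x⁆ = ⁅z, W x⁆ := by
  refine root_induction (H := H) (p := fun x => W ⁅z, x⁆ = ⁅z, W x⁆) (fun y hy => ?_)
    (fun α hα e he => ?_)
    (fun x y hx hy => by rw [lie_add, map_add, map_add, lie_add, hx, hy]) x
  · rw [BiLie.lie_cartan hz hy, BiLie.lie_cartan hz (h.cartan y hy), map_zero]
  · have := mem_rootSub.mp he ⟨z, hz⟩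
    simp only at this
    rw [h.root α hα e he, lie_smul, this, map_smul, h.root α hα e he, smul_comm]

theorem commutator_eq_zero (h : IsRootGraded H W l) {z : L} (hz : z ∈ H) :
    ⁅W, ad ℂ L z⁆ = 0 := by
  rw [Ring.lie_def, sub_eq_zero]
  ext x
  exact h.lie_cartan hz x

theorem killingForm_eq (h : IsRootGraded H W l)
    (hl : ∀ α : Weight ℂ H L, α.IsNonZero → l (-α) = l α) {x : L} (hx : x ∈ BiLie.rootPart H)
    (y : L) : killingForm ℂ L (W x) y = killingForm ℂ L x (W y) := by
  refine root_induction (H := H) (p := fun y => killingForm ℂ L (W x) y = killingForm ℂ L x (W y))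
    (fun z hz => ?_) (fun β hβ f hf => ?_)
    (fun y y' hy hy' => by rw [map_add, map_add, map_add, hy, hy']) y
  · rw [LieModule.traceForm_comm, killingForm_cartan_rootPart hz (h.rootPart hx),
      LieModule.traceForm_comm, killingForm_cartan_rootPart (h.cartan z hz) hx]
  · refine rootPart_induction
      (p := fun x => killingForm ℂ L (W x) f = killingForm ℂ L x (W f)) (fun α hα e he => ?_)
      (by simp) (fun x x' hx hx' => by
        rw [map_add, map_add, LinearMap.add_apply, hx, hx', map_add, LinearMap.add_apply]) hx
    rw [h.root α hα e he, h.root β hβ f hf, map_smul, map_smul, LinearMap.smul_apply]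
    by_cases h0 : (α : H → ℂ) + β = 0
    · have : β = -α := by
        ext z
        have := congrFun h0 z
        simp only [Pi.add_apply, Pi.zero_apply] at this
        rw [Weight.coe_neg, Pi.neg_apply]
        linear_combination this
      rw [this, hl α hα]
    · rw [killingForm_rootSub he hf h0, smul_zero, smul_zero]

/-- Operators which preserve the root grading and have equal eigenvalues on opposite root spaces
are principal. -/
theorem isPrincipal (h : IsRootGraded H W l)
    (hl : ∀ α : Weight ℂ H L, α.IsNonZero → l (-α) = l α) : IsPrincipal W := by
  intro x
  refine root_induction (H := H) (p := fun x => LinearMap.trace ℂ L (W * ad ℂ L x) = 0)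
    (fun z hz => ?_) (fun α hα e he => ?_)
    (fun x y hx hy => by rw [map_add, mul_add, map_add, hx, hy, add_zero]) x
  · have hr : ∀ x : L, ⁅z, x⁆ ∈ BiLie.rootPart H := fun x =>
      root_induction (H := H) (p := fun x => ⁅z, x⁆ ∈ BiLie.rootPart H)
        (fun y hy => by rw [BiLie.lie_cartan hz hy]; exact zero_mem _)
        (fun α hα e he => by
          have := mem_rootSub.mp he ⟨z, hz⟩
          simp only at this
          rw [this]
          exact Submodule.smul_mem _ _ (rootSub_le_rootPart hα he))
        (fun x y hx hy => by rw [lie_add]; exact add_mem hx hy) x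
    -- The image of ad z lies in the root part, where W is symmetric, so W ad z is adjoint to -(ad
    -- z) W. Its trace therefore equals its own negative.
    have h1 := trace_eq_of_adjoint (A := W * ad ℂ L z) (B := - (ad ℂ L z * W)) fun x y => by
      rw [Module.End.mul_apply, ad_apply, h.killingForm_eq hl (hr x), LinearMap.neg_apply,
        Module.End.mul_apply, ad_apply, map_neg, ← lie_skew, map_neg, LinearMap.neg_apply,
        LieModule.traceForm_apply_lie_apply]
    rw [map_neg, LinearMap.trace_mul_comm ℂ (ad ℂ L z)] at h1
    linear_combination (1 / 2 : ℂ) * h1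
  · obtain ⟨z, hz⟩ : ∃ z : H, α z ≠ 0 := by
      by_contra hne
      exact hα (funext fun z => not_not.mp fun h0 => hne ⟨z, h0⟩)
    -- A root vector is a multiple of its bracket with z in H; as ad z commutes with W, the trace of
    -- W [ad z, ad e] is zero.
    have h1 : e = (α z)⁻¹ • ⁅(z : L), e⁆ := by
      rw [mem_rootSub.mp he z, smul_smul, inv_mul_cancel₀ hz, one_smul]
    have h2 : W * ad ℂ L z = ad ℂ L z * W := by
      have := h.commutator_eq_zero z.2
      rwa [Ring.lie_def, sub_eq_zero] at this
    rw [h1, map_smul, mul_smul_comm, map_smul, ad_lie_eq, mul_sub, map_sub, ← mul_assoc, h2,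
      mul_assoc, LinearMap.trace_mul_comm ℂ (ad ℂ L z), mul_assoc, sub_self, smul_zero]

/-- The principal primitive of a graded operator is graded. -/
theorem exists_primitive (h : IsRootGraded H W l) {P : Module.End ℂ L}
    (hP : IsPrincipalPrimitive W P) : (∀ z ∈ H, P z = 0) ∧ ∃ p, IsRootGraded H P p ∧
      ∀ α : Weight ℂ H L, α.IsNonZero → p (-α) = p α := by
  classical
  have hz : ∀ z ∈ H, P z = 0 := fun z hz => hP.apply_eq_zero (h.commutator_eq_zero hz)
  have hpg : PreservesRootGrading H P := by
    refine ⟨fun z hz' => by rw [hz z hz']; exact H.zero_mem, fun α hα e he => ?_, ?_⟩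
    · rw [mem_rootSub] at he ⊢
      intro z
      rw [← hP.lie (h.commutator_eq_zero z.2), he, map_smul]
    · refine fun z hz' => Submodule.mem_iSup_of_mem 0 ⟨hz', ?_⟩
      rw [SetLike.mem_coe, Module.End.mem_eigenspace_iff, hz z hz', zero_smul]
  obtain ⟨p, hp⟩ := hpg.exists_isRootGraded
  refine ⟨hz, p, hp, fun α hα => ?_⟩
  obtain ⟨e, he, he0⟩ := exists_mem_rootSub_ne_zero α
  -- The Killing form pairs opposite root spaces nontrivially, so symmetry of P equates its two
  -- scalars.
  have h1 : ∃ f ∈ rootSub H (-α), killingForm ℂ L e f ≠ 0 := by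
    by_contra hne
    push Not at hne
    refine he0 (eq_of_killingForm fun y => ?_)
    rw [map_zero, LinearMap.zero_apply]
    refine root_induction (H := H) (p := fun y => killingForm ℂ L e y = 0) (fun z hz => ?_)
      (fun β hβ f hf => ?_) (fun x y hx hy => by rw [map_add, hx, hy, add_zero]) y
    · rw [LieModule.traceForm_comm, killingForm_cartan_rootPart hz (rootSub_le_rootPart hα he)]
    · by_cases h0 : (α : H → ℂ) + β = 0
      · exact hne f (by rwa [neg_eq_of_add_eq_zero_right h0])
      · exact killingForm_rootSub he hf h0
  obtain ⟨f, hf, hef⟩ := h1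
  have h2 := hP.symm e f
  rw [hp.root α hα e he, hp.root (-α) hα.neg f hf, map_smul, map_smul, LinearMap.smul_apply,
    smul_eq_mul, smul_eq_mul] at h2
  exact (mul_right_cancel₀ hef h2).symm

variable {P : Module.End ℂ L} {p : Weight ℂ H L → ℂ}

/-- The torsion identity on root vectors with bracket the coroot; P vanishes on H. In terms of the
times t₁, t₂ of α it says that (W - t₁)(W - t₂) annihilates the coroot. -/
theorem coroot_relation (h : IsRootGraded H W l) (hW : IsPrincipal W)
    (hN : IsLieBracket (modBr W)) (hP : IsPrincipalPrimitive W P) (hp : IsRootGraded H P p)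
    {α : Weight ℂ H L} (hα : α.IsNonZero) :
    W (W (IsKilling.coroot α : L)) - (l α + l (-α)) • W (IsKilling.coroot α : L) +
      (l α * l (-α)) • (IsKilling.coroot α : L) = (2 * p α) • (IsKilling.coroot α : L) := by
  obtain ⟨hz, p', hp', hsym⟩ := h.exists_primitive hP
  obtain ⟨e, he, f, hf, he0, hf0, hef⟩ := exists_coroot hα
  have hpp : ∀ β : Weight ℂ H L, β.IsNonZero → p β = p' β := fun β hβ => by
    obtain ⟨b, hb, hb0⟩ := exists_mem_rootSub_ne_zero β
    exact smul_left_injective ℂ hb0 ((hp.root β hβ b hb).symm.trans (hp'.root β hβ b hb))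
  have h1 := hW.torsion_eq hN hP e f
  rw [h.root α hα e he, h.root (-α) hα.neg f hf, hp.root α hα e he, hp.root (-α) hα.neg f hf,
    hpp (-α) hα.neg, hsym α hα, ← hpp α hα] at h1
  simp only [smul_lie, lie_smul, map_smul, hef] at h1
  rw [hz _ (IsKilling.coroot α).2] at h1
  linear_combination (norm := module) h1

/-- Every term of the torsion identity on root vectors of α and β is a multiple of their bracket,
which is nonzero because α + β is a root. -/
theorem triangle_relation (h : IsRootGraded H W l) (hW : IsPrincipal W)
    (hN : IsLieBracket (modBr W)) (hP : IsPrincipalPrimitive W P) (hp : IsRootGraded H P p)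
    {α β γ : Weight ℂ H L} (hα : α.IsNonZero) (hβ : β.IsNonZero) (hγ : γ.IsNonZero)
    (hs : (α : H → ℂ) + β = γ) : (l α - l γ) * (l β - l γ) = p α + p β - p γ := by
  obtain ⟨e, he, he0⟩ := exists_mem_rootSub_ne_zero α
  obtain ⟨f, hf, hf0⟩ := exists_mem_rootSub_ne_zero β
  have hne := lie_ne_zero_of_add_eq hα hβ hs he hf he0 hf0
  have hm : ⁅e, f⁆ ∈ rootSub H γ := hs ▸ lie_mem_rootSub he hf
  have h1 := hW.torsion_eq hN hP e f
  rw [h.root α hα e he, h.root β hβ f hf, hp.root α hα e he, hp.root β hβ f hf] at h1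
  simp only [smul_lie, lie_smul, map_smul, h.root γ hγ _ hm, hp.root γ hγ _ hm, smul_smul] at h1
  refine smul_left_injective ℂ hne ?_
  simp only
  linear_combination (norm := module) h1

/-- The value of the principal primitive on a root whose coroot is a sum of eigenvectors. -/
theorem primitive_eq (h : IsRootGraded H W l) (hW : IsPrincipal W)
    (hN : IsLieBracket (modBr W)) (hP : IsPrincipalPrimitive W P) (hp : IsRootGraded H P p)
    {α : Weight ℂ H L} (hα : α.IsNonZero) {x y : ℂ} (hl : l α = (x + y) / 2)
    (hl' : l (-α) = (x + y) / 2) {u v : L} (hu : W u = x • u) (hv : W v = y • v)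
    (huv : (IsKilling.coroot α : L) = u + v) : p α = (x - y) ^ 2 / 8 := by
  have h1 := h.coroot_relation hW hN hP hp hα
  have h2 : (2 * p α - (x - y) ^ 2 / 4) • (IsKilling.coroot α : L) = 0 := by
    rw [sub_smul, ← h1, huv, hl, hl']
    simp only [map_add, hu, hv, map_smul]
    module
  have h3 := (smul_eq_zero.mp h2).resolve_right (coroot_ne_zero hα)
  linear_combination (1 / 2 : ℂ) * h3

theorem isTimesPair_iff (h : IsRootGraded H W l) (hP : IsPrincipalPrimitive W P)
    (hp : IsRootGraded H P p) {α : Weight ℂ H L} (hα : α.IsNonZero) {t₁ t₂ : ℂ} :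
    IsTimesPair H W α t₁ t₂ ↔
      t₁ + t₂ = l α + l (-α) ∧ t₁ * t₂ = l α * l (-α) - 2 * p α := by
  constructor
  · rintro ⟨P', hP', l₁, l₂, p₁, h1, h2, h3, h4⟩
    obtain rfl := hP.unique hP'
    obtain ⟨e, he, he0⟩ := exists_mem_rootSub_ne_zero α
    obtain ⟨f, hf, hf0⟩ := exists_mem_rootSub_ne_zero (-α)
    have e1 : l₁ = l α := smul_left_injective ℂ he0 ((h1 e he).symm.trans (h.root α hα e he))
    have e2 : l₂ = l (-α) :=
      smul_left_injective ℂ hf0 ((h2 f hf).symm.trans (h.root (-α) hα.neg f hf))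
    have e3 : p₁ = p α := smul_left_injective ℂ he0 ((h3 e he).symm.trans (hp.root α hα e he))
    subst e1 e2 e3
    -- Two monic quadratics agreeing at 0 and at 1 have the same coefficients.
    have h5 := h4 0
    have h6 := h4 1
    constructor
    · linear_combination h6 - h5
    · linear_combination - h5
  · rintro ⟨h1, h2⟩
    exact ⟨P, hP, l α, l (-α), p α, h.root α hα, h.root (-α) hα.neg, hp.root α hα,
      fun t => by linear_combination t * h1 - h2⟩

end IsRootGraded

end Graded

/-! ### Structure of toral quasigradings -/

namespace IsToralQuasigrading

variable {L : Type*} [LieRing L] [LieAlgebra ℂ L] [FiniteDimensional ℂ L]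
variable {H : LieSubalgebra ℂ L} [H.IsCartanSubalgebra]
variable {ι : Type*} [Finite ι] {G : Sym2 ι → Submodule ℂ L}

/-- Otherwise torality puts every component, hence all of L, into the sum of H and the other root
spaces, which meets the root space of α trivially. -/
theorem exists_rootSub_le (hG : IsToralQuasigrading H G) {α : Weight ℂ H L} (hα : α.IsNonZero) :
    ∃ x y, rootSub H α ≤ G s(x, y) := by
  suffices ∃ p, rootSub H α ≤ G p by
    obtain ⟨p, hp⟩ := this
    induction p using Sym2.ind with
    | _ x y => exact ⟨x, y, hp⟩
  by_contra hne
  push Not at hne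
  have h1 : ∀ p, G p ≤ ⨆ χ : H → ℂ, ⨆ _ : χ ≠ α, rootSub H χ := fun p => by
    obtain ⟨V, hV, S, hS, hp⟩ := hG.toral p
    rw [hp]
    refine sup_le (hV.trans ?_) (iSup₂_le fun β hβ => ?_)
    · rw [← rootSub_zero]
      exact le_iSup₂_of_le (f := fun (χ : H → ℂ) (_ : χ ≠ α) => rootSub H χ) 0 (Ne.symm hα) le_rfl
    · refine le_iSup₂_of_le (f := fun (χ : H → ℂ) (_ : χ ≠ α) => rootSub H χ) β (fun h => ?_) le_rfl
      refine hne p (hp ▸ le_sup_of_le_right ?_)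
      rw [← h]
      exact le_iSup₂ (f := fun (α : Weight ℂ H L) (_ : α ∈ S) => rootSub H α) β hβ
  obtain ⟨e, he, he0⟩ := exists_mem_rootSub_ne_zero α
  refine he0 (Submodule.disjoint_def.mp (iSupIndep_rootSub' (H := H) α) e he ?_)
  exact iSup_le h1 (hG.iSup_eq_top ▸ Submodule.mem_top)

theorem eq_of_rootSub_le (hG : IsToralQuasigrading H G) {α : Weight ℂ H L} {p q : Sym2 ι}
    (hp : rootSub H α ≤ G p) (hq : rootSub H α ≤ G q) : p = q := by
  by_contra hne
  obtain ⟨e, he, he0⟩ := exists_mem_rootSub_ne_zero α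
  exact he0 (Submodule.disjoint_def.mp (hG.indep.pairwiseDisjoint hne) e (hp he) (hq he))

theorem indep_diag (hG : IsToralQuasigrading H G) : iSupIndep fun x : ι => G s(x, x) :=
  hG.indep.comp (f := fun x : ι => s(x, x)) fun _ _ h => Sym2.diag_injective h

theorem eq_zero_of_mem_cartan (hG : IsToralQuasigrading H G) {x y : ι} (hxy : x ≠ y) {a : L}
    (ha : a ∈ G s(x, y)) (hH : a ∈ H) : a = 0 := by
  refine Submodule.disjoint_def.mp (hG.indep s(x, y)) a ha ?_
  refine (iSup_le fun z => ?_ : ⨆ z : ι, G s(z, z) ≤ _) (hG.cartan_le hH)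
  refine le_iSup₂_of_le (f := fun (q : Sym2 ι) (_ : q ≠ s(x, y)) => G q) s(z, z) ?_ le_rfl
  rw [Ne, Sym2.eq_iff]
  rintro (⟨rfl, h⟩ | ⟨rfl, h⟩)
  · exact hxy h
  · exact hxy h.symm

/-- Each component is the sum of its intersection with `H` and of its root spaces. -/
theorem component_eq (hG : IsToralQuasigrading H G) (p : Sym2 ι) :
    G p = (G p ⊓ H.toSubmodule) ⊔
      ⨆ α ∈ {α : Weight ℂ H L | α.IsNonZero ∧ rootSub H α ≤ G p}, rootSub H α := by
  refine le_antisymm ?_ (sup_le inf_le_left (iSup₂_le fun α hα => hα.2))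
  obtain ⟨V, hV, S, hS, hp⟩ := hG.toral p
  conv_lhs => rw [hp]
  refine sup_le_sup (le_inf (hp ▸ le_sup_left) hV) (iSup₂_le fun α hα => ?_)
  refine le_iSup₂_of_le (f := fun (α : Weight ℂ H L)
    (_ : α ∈ {α : Weight ℂ H L | α.IsNonZero ∧ rootSub H α ≤ G p}) => rootSub H α) α ?_ le_rfl
  exact ⟨hS α hα, hp ▸ le_sup_of_le_right
    (le_iSup₂ (f := fun (α : Weight ℂ H L) (_ : α ∈ S) => rootSub H α) α hα)⟩

theorem component_induction (hG : IsToralQuasigrading H G) {p : Sym2 ι} {C : L → Prop}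
    (hH : ∀ h ∈ G p, h ∈ H → C h)
    (hroot : ∀ α : Weight ℂ H L, α.IsNonZero → rootSub H α ≤ G p → ∀ e ∈ rootSub H α, C e)
    (hadd : ∀ x y, C x → C y → C (x + y)) {a : L} (ha : a ∈ G p) : C a := by
  rw [hG.component_eq p] at ha
  obtain ⟨h, hh, r, hr, rfl⟩ := Submodule.mem_sup.mp ha
  refine hadd h r (hH h hh.1 hh.2) ?_
  have h0 : C 0 := hH 0 (zero_mem _) H.zero_mem
  refine Submodule.iSup_induction _ (motive := C) hr (fun α e he => ?_) h0 hadd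
  by_cases hα : α.IsNonZero ∧ rootSub H α ≤ G p
  · exact hroot α hα.1 hα.2 e (by rwa [iSup_pos (by exact hα)] at he)
  · rw [iSup_neg (by exact hα), Submodule.mem_bot] at he
    exact he ▸ h0

/-- An element of H is a sum of elements of the diagonal components; each splits into a toral part
and root vectors, and the root vectors must cancel. -/
theorem iSup_inf_cartan (hG : IsToralQuasigrading H G) :
    ⨆ x : ι, G s(x, x) ⊓ H.toSubmodule = H.toSubmodule := by
  refine le_antisymm (iSup_le fun x => inf_le_right) fun h hh => ?_
  have h1 : h ∈ (⨆ x : ι, G s(x, x) ⊓ H.toSubmodule) ⊔ rootPart H := by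
    have h2 : h ∈ ⨆ x : ι, G s(x, x) := hG.cartan_le hh
    refine (iSup_le fun x a ha => ?_ : ⨆ x : ι, G s(x, x) ≤ _) h2
    refine hG.component_induction (C := fun a => a ∈ _) (fun z hz hz' => ?_)
      (fun α hα _ e he => Submodule.mem_sup_right (rootSub_le_rootPart hα he))
      (fun x y hx hy => add_mem hx hy) ha
    exact Submodule.mem_sup_left (Submodule.mem_iSup_of_mem x ⟨hz, hz'⟩)
  obtain ⟨z, hz, r, hr, rfl⟩ := Submodule.mem_sup.mp h1
  have hzH : z ∈ H.toSubmodule := (iSup_le fun x => inf_le_right :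
    ⨆ x : ι, G s(x, x) ⊓ H.toSubmodule ≤ H.toSubmodule) hz
  have : r = 0 := Submodule.disjoint_def.mp disjoint_cartan_rootPart r
    (by simpa using H.toSubmodule.sub_mem hh hzH) hr
  rwa [this, add_zero]

/-- Induction over the homogeneous generators of a toral quasigrading. -/
theorem induction (hG : IsToralQuasigrading H G) {C : L → Prop}
    (hH : ∀ x, ∀ h ∈ G s(x, x), h ∈ H → C h)
    (hroot : ∀ (α : Weight ℂ H L) (x y : ι), α.IsNonZero → rootSub H α ≤ G s(x, y) →
      ∀ e ∈ rootSub H α, C e)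
    (h0 : C 0) (hadd : ∀ x y, C x → C y → C (x + y)) (a : L) : C a := by
  refine root_induction (H := H) (fun h hh => ?_) (fun α hα e he => ?_) hadd a
  · have h1 : h ∈ ⨆ x : ι, G s(x, x) ⊓ H.toSubmodule := hG.iSup_inf_cartan.symm ▸ hh
    exact Submodule.iSup_induction _ (motive := C) h1 (fun x z hz => hH x z hz.1 hz.2) h0 hadd
  · obtain ⟨x, y, hxy⟩ := hG.exists_rootSub_le hα
    exact hroot α x y hα hxy e he

/-- Two unordered pairs are disjoint, or share an element with different partners, or coincide; each
case has its own bracket axiom. -/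
theorem lie_rootSub_cases (hG : IsToralQuasigrading H G) {α β : Weight ℂ H L} {p q : Sym2 ι}
    (hα : α.IsNonZero) (hβ : β.IsNonZero) (hp : rootSub H α ≤ G p) (hq : rootSub H β ≤ G q)
    {a b : L} (ha : a ∈ rootSub H α) (hb : b ∈ rootSub H β) :
    ⁅a, b⁆ = 0 ∨ (∃ x y u, x ≠ u ∧ p = s(x, y) ∧ q = s(y, u) ∧ ⁅a, b⁆ ∈ G s(x, u)) ∨
      ∃ x y, p = s(x, y) ∧ q = s(x, y) ∧ ⁅a, b⁆ ∈ G s(x, x) ⊔ G s(y, y) := by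
  by_cases hd : ∀ x, ¬ (x ∈ p ∧ x ∈ q)
  · exact Or.inl (hG.lie_disjoint p q hd α β hα hβ hp hq a ha b hb)
  · right
    push Not at hd
    obtain ⟨y, hyp, hyq⟩ := hd
    obtain ⟨x, rfl⟩ := Sym2.mem_iff_exists.mp hyp
    obtain ⟨u, rfl⟩ := Sym2.mem_iff_exists.mp hyq
    rw [Sym2.eq_swap] at hp
    by_cases hxu : x = u
    · subst hxu
      right
      rw [Sym2.eq_swap] at hq
      exact ⟨x, y, Sym2.eq_swap, Sym2.eq_swap, hG.lie_mem_diag x y a (hp ha) b (hq hb)⟩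
    · left
      exact ⟨x, y, u, hxu, Sym2.eq_swap, rfl, hG.lie_mem x y u hxu a (hp ha) b (hq hb)⟩

variable [IsKilling ℂ L]

theorem cartan_lie_mem (hG : IsToralQuasigrading H G) {p : Sym2 ι} {h b : L} (hh : h ∈ H)
    (hb : b ∈ G p) : ⁅h, b⁆ ∈ G p := by
  refine hG.component_induction (C := fun b => ⁅h, b⁆ ∈ G p) (fun z _ hz => ?_)
    (fun α hα hp e he => ?_) (fun x y hx hy => by rw [lie_add]; exact add_mem hx hy) hb
  · rw [lie_cartan hh hz]; exact zero_mem _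
  · rw [mem_rootSub.mp he ⟨h, hh⟩]
    exact (G p).smul_mem _ (hp he)

/-- The coroot of a root of the component of the pair `{x, y}`. -/
theorem coroot_mem (hG : IsToralQuasigrading H G) {α : Weight ℂ H L} {x y : ι}
    (hα : α.IsNonZero) (hp : rootSub H α ≤ G s(x, y)) :
    (IsKilling.coroot α : L) ∈ G s(x, x) ⊔ G s(y, y) := by
  obtain ⟨e, he, f, hf, -, -, hef⟩ := exists_coroot hα
  rw [← hef]
  exact hG.lie_mem_diag x y e (hp he) f (hG.symm _ α hα hp hf)

/-- Toral quasigradings have no triangles of roots in a component off the diagonal. -/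
theorem no_triangle (hG : IsToralQuasigrading H G) {α β γ : Weight ℂ H L} {x y : ι} (hxy : x ≠ y)
    (hα : α.IsNonZero) (hβ : β.IsNonZero) (hγ : γ.IsNonZero) (hs : (α : H → ℂ) + β + γ = 0)
    (h1 : rootSub H α ≤ G s(x, y)) (h2 : rootSub H β ≤ G s(x, y))
    (h3 : rootSub H γ ≤ G s(x, y)) : False := by
  obtain ⟨e, he, he0⟩ := exists_mem_rootSub_ne_zero α
  obtain ⟨f, hf, hf0⟩ := exists_mem_rootSub_ne_zero β
  have hs' : (α : H → ℂ) + β = (-γ : Weight ℂ H L) := by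
    rw [Weight.coe_neg]; exact eq_neg_of_add_eq_zero_left hs
  have hne := lie_ne_zero_of_add_eq hα hβ hs' he hf he0 hf0
  have hm : ⁅e, f⁆ ∈ rootSub H (-γ : Weight ℂ H L) := hs' ▸ lie_mem_rootSub he hf
  -- The bracket is a nonzero vector of the root space of -γ, inside the off-diagonal component by
  -- symmetry; but the diagonal axiom puts it into two other components.
  refine hne (Submodule.disjoint_def.mp (hG.indep s(x, y)) _ (hG.symm _ γ hγ h3 hm) ?_)
  have hne' : ∀ z, s(z, z) ≠ s(x, y) := fun z => by
    rw [Ne, Sym2.eq_iff]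
    rintro (⟨rfl, h⟩ | ⟨rfl, h⟩)
    · exact hxy h
    · exact hxy h.symm
  refine (sup_le ?_ ?_ : G s(x, x) ⊔ G s(y, y) ≤ _) (hG.lie_mem_diag x y e (h1 he) f (h2 hf)) <;>
  exact le_iSup₂_of_le (f := fun (q : Sym2 ι) (_ : q ≠ s(x, y)) => G q) _ (hne' _) le_rfl

end IsToralQuasigrading

/-- `W` acts on the component of the pair `{x, y}` as the scalar `(v x + v y) / 2`. -/
def ActsBy {L : Type*} [LieRing L] [LieAlgebra ℂ L] {ι : Type*} (G : Sym2 ι → Submodule ℂ L)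
    (v : ι → ℂ) (W : Module.End ℂ L) : Prop :=
  ∀ x y : ι, ∀ a ∈ G s(x, y), W a = ((v x + v y) / 2) • a

/-! ### The operator of a quasigrading: Lie pencil and times -/

namespace IsToralQuasigrading

variable {L : Type*} [LieRing L] [LieAlgebra ℂ L] [FiniteDimensional ℂ L]
variable {H : LieSubalgebra ℂ L} [H.IsCartanSubalgebra]
variable {ι : Type*} [Finite ι] {G : Sym2 ι → Submodule ℂ L} {v : ι → ℂ} {W : Module.End ℂ L}

theorem exists_end (hG : IsToralQuasigrading H G) (c : ι → ι → ℂ) (hc : ∀ x y, c x y = c y x) :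
    ∃ T : Module.End ℂ L, ∀ x y, ∀ a ∈ G s(x, y), T a = c x y • a := by
  obtain ⟨T, hT⟩ := exists_end_of_indep hG.indep hG.iSup_eq_top (Sym2.lift ⟨c, hc⟩)
  exact ⟨T, fun x y a ha => hT s(x, y) a ha⟩

theorem end_ext (hG : IsToralQuasigrading H G) {N : Type*} [AddCommGroup N] [Module ℂ N]
    {T T' : L →ₗ[ℂ] N} (h : ∀ x y, ∀ a ∈ G s(x, y), T a = T' a) : T = T' :=
  end_ext_of_iSup hG.iSup_eq_top fun p a ha => by
    induction p using Sym2.ind with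
    | _ x y => exact h x y a ha

theorem exists_actsBy (hG : IsToralQuasigrading H G) (v : ι → ℂ) :
    ∃! W : Module.End ℂ L, ActsBy G v W := by
  obtain ⟨W, hW⟩ := hG.exists_end (fun x y => (v x + v y) / 2) fun x y => by rw [add_comm]
  exact ⟨W, hW, fun W' hW' => hG.end_ext fun x y a ha => (hW' x y a ha).trans (hW x y a ha).symm⟩

theorem actsBy_diag (hW : ActsBy G v W) {x : ι} {a : L} (ha : a ∈ G s(x, x)) :
    W a = v x • a := by
  rw [hW x x a ha, add_self_div_two]

theorem mem_cartan_of_actsBy (hG : IsToralQuasigrading H G) (hW : ActsBy G v W) {h : L}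
    (hh : h ∈ H) : W h ∈ H := by
  have h1 : h ∈ ⨆ x : ι, G s(x, x) ⊓ H.toSubmodule := hG.iSup_inf_cartan.symm ▸ hh
  refine Submodule.iSup_induction _ (motive := fun h => W h ∈ H) h1 (fun x z hz => ?_)
    (by simp) (fun x y hx hy => by rw [map_add]; exact add_mem hx hy)
  rw [actsBy_diag hW hz.1]
  exact H.toSubmodule.smul_mem _ hz.2

theorem exists_isRootGraded (hG : IsToralQuasigrading H G) (hW : ActsBy G v W) :
    ∃ l, IsRootGraded H W l ∧
      (∀ (α : Weight ℂ H L) (x y : ι), α.IsNonZero → rootSub H α ≤ G s(x, y) →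
        l α = (v x + v y) / 2) := by
  classical
  have h1 : ∀ α : Weight ℂ H L, ∃ x y, α.IsNonZero → rootSub H α ≤ G s(x, y) := fun α => by
    by_cases hα : α.IsNonZero
    · obtain ⟨x, y, h⟩ := hG.exists_rootSub_le hα
      exact ⟨x, y, fun _ => h⟩
    · obtain ⟨x⟩ : Nonempty ι := by
        by_contra hne
        rw [not_nonempty_iff] at hne
        obtain ⟨e, he, he0⟩ := exists_mem_rootSub_ne_zero α
        have h2 : (⨆ p, G p) = ⊥ := by simp
        refine he0 ((Submodule.mem_bot ℂ).mp ?_)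
        rw [← h2, hG.iSup_eq_top]
        exact Submodule.mem_top
      exact ⟨x, x, fun h => absurd h hα⟩
  choose X Y hXY using h1
  refine ⟨fun α => (v (X α) + v (Y α)) / 2, ⟨fun h => hG.mem_cartan_of_actsBy hW,
    fun α hα e he => hW _ _ e (hXY α hα he)⟩, fun α x y hα hxy => ?_⟩
  have := hG.eq_of_rootSub_le (hXY α hα) hxy
  rw [Sym2.eq_iff] at this
  rcases this with ⟨h1, h2⟩ | ⟨h1, h2⟩
  · simp only [h1, h2]
  · simp only [h1, h2, add_comm]

variable [IsKilling ℂ L]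

theorem scalar_neg (hG : IsToralQuasigrading H G) {l : Weight ℂ H L → ℂ}
    (hl : ∀ (α : Weight ℂ H L) (x y : ι), α.IsNonZero → rootSub H α ≤ G s(x, y) →
        l α = (v x + v y) / 2) (α : Weight ℂ H L) (hα : α.IsNonZero) : l (-α) = l α := by
  obtain ⟨x, y, h⟩ := hG.exists_rootSub_le hα
  rw [hl α x y hα h, hl (-α) x y hα.neg (hG.symm _ α hα h)]

theorem isPrincipal (hG : IsToralQuasigrading H G) (hW : ActsBy G v W) : IsPrincipal W := by
  obtain ⟨l, hl, hl'⟩ := hG.exists_isRootGraded hW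
  exact hl.isPrincipal (hG.scalar_neg hl')

/-- The bracket `[,]_W - t [,]` is the pull-back of `[,]` by the operator which acts on the
component of `{x, y}` as `s x * s y`, where `(s x)² = v x - t`. -/
theorem map_pencilBr (hG : IsToralQuasigrading H G) (hW : ActsBy G v W) {t : ℂ} {s : ι → ℂ}
    (hs : ∀ x, s x * s x = v x - t) {φ : Module.End ℂ L}
    (hφ : ∀ x y, ∀ a ∈ G s(x, y), φ a = (s x * s y) • a) (a b : L) :
    φ (pencilBr (modBr W) t a b) = ⁅φ a, φ b⁆ := by
  have hexp : ∀ a b, pencilBr (modBr W) t a b = ⁅W a, b⁆ + ⁅a, W b⁆ - W ⁅a, b⁆ - t • ⁅a, b⁆ :=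
    fun a b => by rw [pencilBr_apply, modBr_apply]
  have hskew : ∀ a b, φ (pencilBr (modBr W) t a b) = ⁅φ a, φ b⁆ →
      φ (pencilBr (modBr W) t b a) = ⁅φ b, φ a⁆ := fun a b h => by
    have h1 : pencilBr (modBr W) t b a = - pencilBr (modBr W) t a b := by
      rw [hexp, hexp, ← lie_skew (W b) a, ← lie_skew b (W a), ← lie_skew b a, map_neg]
      module
    rw [h1, map_neg, h, lie_skew]
  have hφd : ∀ x, ∀ a ∈ G s(x, x), φ a = (v x - t) • a := fun x a ha => by
    rw [hφ x x a ha, hs]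
  -- Toral elements need a separate argument, since their brackets with disjoint components need not
  -- vanish. Here W has the same eigenvalue on b and ⁅h, b⁆, so the pencil bracket is (v x - t) ⁅h,
  -- b⁆.
  have hHcomp : ∀ x, ∀ h ∈ G s(x, x), h ∈ H → ∀ y z, ∀ b ∈ G s(y, z),
      φ (pencilBr (modBr W) t h b) = ⁅φ h, φ b⁆ := fun x h hx hH y z b hb => by
    have h1 := hG.cartan_lie_mem hH hb
    rw [hexp, actsBy_diag hW hx, hW y z b hb, hW y z _ h1, hφd x h hx, hφ y z b hb]
    simp only [smul_lie, lie_smul, map_add, map_sub, map_smul, hφ y z _ h1]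
    module
  refine hG.induction (C := fun a => φ (pencilBr (modBr W) t a b) = ⁅φ a, φ b⁆)
    (fun x h hx hH => ?_) (fun α x y hα hxy e he => ?_) (by simp)
    (fun x y hx hy => by
      rw [map_add, LinearMap.add_apply, map_add, map_add, add_lie, hx, hy]) a
  · refine hG.induction (C := fun b => φ (pencilBr (modBr W) t h b) = ⁅φ h, φ b⁆)
      (fun y z hy _ => hHcomp x h hx hH y y z hy)
      (fun β y z hβ hyz f hf => hHcomp x h hx hH y z f (hyz hf)) (by simp)
      (fun x y hx hy => by rw [map_add, map_add, map_add, lie_add, hx, hy]) b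
  · refine hG.induction (C := fun b => φ (pencilBr (modBr W) t e b) = ⁅φ e, φ b⁆)
      (fun z h hz hH => hskew _ _ (hHcomp z h hz hH x y e (hxy he)))
      (fun β z u hβ hzu f hf => ?_) (by simp)
      (fun x y hx hy => by rw [map_add, map_add, map_add, lie_add, hx, hy]) b
    have hcase := hG.lie_rootSub_cases hα hβ hxy hzu he hf
    have he' := hxy he
    have hf' := hzu hf
    rw [hexp, hW _ _ _ he', hW _ _ _ hf', hφ _ _ _ he', hφ _ _ _ hf']
    rcases hcase with h0 | ⟨x', y', u', hne, h1, h2, hm⟩ | ⟨x', y', h1, h2, hm⟩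
    · simp only [smul_lie, lie_smul, h0, smul_zero, map_zero, add_zero, sub_zero]
    · have e1 : v x + v y = v x' + v y' ∧ s x * s y = s x' * s y' := by
        rw [Sym2.eq_iff] at h1
        rcases h1 with ⟨rfl, rfl⟩ | ⟨rfl, rfl⟩
        · exact ⟨rfl, rfl⟩
        · exact ⟨add_comm _ _, mul_comm _ _⟩
      have e2 : v z + v u = v y' + v u' ∧ s z * s u = s y' * s u' := by
        rw [Sym2.eq_iff] at h2
        rcases h2 with ⟨rfl, rfl⟩ | ⟨rfl, rfl⟩
        · exact ⟨rfl, rfl⟩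
        · exact ⟨add_comm _ _, mul_comm _ _⟩
      rw [e1.1, e1.2, e2.1, e2.2]
      simp only [smul_lie, lie_smul, hW _ _ _ hm, map_smul, hφ _ _ _ hm,
        smul_smul, ← add_smul, ← sub_smul]
      congr 1
      -- The half sums leave v y' - t = (s y')² as the scalar of the pencil, and (s y')² · s x' s u'
      -- = (s x' s y')(s y' s u').
      linear_combination - s x' * s u' * hs y'
    · have e1 : v x + v y = v x' + v y' ∧ s x * s y = s x' * s y' := by
        rw [Sym2.eq_iff] at h1
        rcases h1 with ⟨rfl, rfl⟩ | ⟨rfl, rfl⟩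
        · exact ⟨rfl, rfl⟩
        · exact ⟨add_comm _ _, mul_comm _ _⟩
      have e2 : v z + v u = v x' + v y' ∧ s z * s u = s x' * s y' := by
        rw [Sym2.eq_iff] at h2
        rcases h2 with ⟨rfl, rfl⟩ | ⟨rfl, rfl⟩
        · exact ⟨rfl, rfl⟩
        · exact ⟨add_comm _ _, mul_comm _ _⟩
      obtain ⟨c, hc, d, hd, hcd⟩ := Submodule.mem_sup.mp hm
      rw [e1.1, e1.2, e2.1, e2.2]
      simp only [smul_lie, lie_smul, ← hcd, map_add, map_sub, map_smul, actsBy_diag hW hc,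
        actsBy_diag hW hd, hφd _ _ hc, hφd _ _ hd, smul_smul]
      -- The part of the bracket in the component of {x', x'} gets v y' - t from the pencil and v x'
      -- - t from φ; the other part gets the same factors in the opposite roles.
      rw [show s x' * s y' * (s x' * s y') = (v x' - t) * (v y' - t) by
        rw [← hs, ← hs]; ring]
      module

/-- Away from the values of `v` the brackets of the pencil are isomorphic to `[,]`. -/
theorem exists_equiv (hG : IsToralQuasigrading H G) (hW : ActsBy G v W) {t : ℂ}
    (ht : ∀ x, v x ≠ t) : ∃ φ : L ≃ₗ[ℂ] L, (∃ s : ι → ℂ, (∀ x, s x * s x = v x - t) ∧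
      ∀ x y, ∀ a ∈ G s(x, y), φ a = (s x * s y) • a) ∧
      ∀ a b, φ (pencilBr (modBr W) t a b) = ⁅φ a, φ b⁆ := by
  have h1 : ∀ x, ∃ s : ℂ, s * s = v x - t := fun x => by
    obtain ⟨s, hs⟩ := IsAlgClosed.exists_eq_mul_self (v x - t)
    exact ⟨s, hs.symm⟩
  choose s hs using h1
  have hs0 : ∀ x, s x ≠ 0 := fun x h0 => by
    have := hs x
    rw [h0, mul_zero, eq_comm, sub_eq_zero] at this
    exact ht x this
  obtain ⟨φ, hφ⟩ := hG.exists_end (fun x y => s x * s y) fun x y => mul_comm _ _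
  obtain ⟨ψ, hψ⟩ := hG.exists_end (fun x y => (s x * s y)⁻¹) fun x y => by rw [mul_comm]
  have h2 : φ ∘ₗ ψ = LinearMap.id := hG.end_ext fun x y a ha => by
    rw [LinearMap.comp_apply, hψ x y a ha, map_smul, hφ x y a ha, smul_smul,
      inv_mul_cancel₀ (mul_ne_zero (hs0 x) (hs0 y)), one_smul, LinearMap.id_apply]
  have h3 : ψ ∘ₗ φ = LinearMap.id := hG.end_ext fun x y a ha => by
    rw [LinearMap.comp_apply, hφ x y a ha, map_smul, hψ x y a ha, smul_smul,
      mul_inv_cancel₀ (mul_ne_zero (hs0 x) (hs0 y)), one_smul, LinearMap.id_apply]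
  exact ⟨LinearEquiv.ofLinearMap φ ψ h2 h3, ⟨s, hs, hφ⟩, hG.map_pencilBr hW hs hφ⟩

theorem isBiLie (hG : IsToralQuasigrading H G) (hW : ActsBy G v W) : IsBiLie (modBr W) := by
  -- One t off the finitely many values suffices: the bracket at t is a pull-back of [,] and so
  -- satisfies Jacobi.
  obtain ⟨t, ht⟩ := (Set.finite_range v).exists_notMem
  obtain ⟨φ, -, hφ⟩ := hG.exists_equiv hW (t := t) fun x h => ht ⟨x, h⟩
  refine isBiLie_modBr (t := t) ⟨fun x => φ.injective ?_, fun x y z => φ.injective ?_⟩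
  · rw [hφ, lie_self, map_zero]
  · rw [map_add, map_add, hφ, hφ, hφ, hφ, hφ, hφ, lie_jacobi, map_zero]

theorem trace_pencilBr {t : ℂ} {φ : L ≃ₗ[ℂ] L} (hφ : ∀ a b, φ (pencilBr (modBr W) t a b) = ⁅φ a, φ b⁆) (a b : L) :
    LinearMap.trace ℂ L (pencilBr (modBr W) t a ∘ₗ pencilBr (modBr W) t b) =
      killingForm ℂ L (φ a) (φ b) := by
  have h1 : ∀ a, φ.conj (pencilBr (modBr W) t a) = ad ℂ L (φ a) := fun a => by
    ext x
    rw [LinearEquiv.conj_apply_apply, hφ, φ.apply_symm_apply, ad_apply]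
  rw [← LinearMap.trace_conj' _ φ, LinearEquiv.conj_comp, h1, h1]
  rfl

/-- Guarantees that each index is seen by a root, hence is a time. With several indices, an
off-diagonal component is nonzero and contains no toral element; with a single one, a nonzero L has
a root because coroots span H. -/
theorem exists_rootSub_le_of_nontrivial [Nontrivial L] (hG : IsToralQuasigrading H G) (x : ι) :
    ∃ α : Weight ℂ H L, α.IsNonZero ∧ ∃ y, rootSub H α ≤ G s(x, y) := by
  by_cases hne : ∃ y, y ≠ x
  · obtain ⟨y, hy⟩ := hne
    by_contra hno
    push Not at hno
    refine hG.ne_bot x y hy.symm ((Submodule.eq_bot_iff _).mpr fun a ha => ?_)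
    refine hG.component_induction (C := fun a => a = 0)
      (fun h hh hH => hG.eq_zero_of_mem_cartan hy.symm hh hH)
      (fun α hα hp => absurd hp (hno α hα y)) (fun x y hx hy => by rw [hx, hy, add_zero]) ha
  · push Not at hne
    by_contra hno
    push Not at hno
    have hroot : ∀ α : Weight ℂ H L, ¬ α.IsNonZero := fun α hα => by
      obtain ⟨y, z, h⟩ := hG.exists_rootSub_le hα
      rw [hne y] at h
      exact hno α hα z h
    have h1 : H.toSubmodule = ⊥ := le_bot_iff.mp
      (cartan_le_of_coroot_mem fun α hα => absurd hα (hroot α))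
    obtain ⟨a, ha⟩ := exists_ne (0 : L)
    refine ha (root_induction (H := H) (p := fun a => a = 0) (fun h hh => ?_)
      (fun α hα => absurd hα (hroot α)) (fun x y hx hy => by rw [hx, hy, add_zero]) a)
    have : h ∈ H.toSubmodule := hh
    rwa [h1, Submodule.mem_bot] at this

theorem times_eq [Nontrivial L] (hG : IsToralQuasigrading H G) (hW : ActsBy G v W) :
    times (modBr W) = Set.range v := by
  ext t
  constructor
  · rintro ⟨x, hx0, hx⟩
    by_contra ht
    obtain ⟨φ, -, hφ⟩ := hG.exists_equiv hW (t := t) fun x h => ht ⟨x, h⟩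
    refine hx0 (φ.injective ?_)
    rw [map_zero]
    refine eq_of_killingForm fun z => ?_
    obtain ⟨y, rfl⟩ := φ.surjective z
    rw [← trace_pencilBr hφ, hx, map_zero, LinearMap.zero_apply]
  · rintro ⟨x, rfl⟩
    obtain ⟨α, hα, y, hxy⟩ := hG.exists_rootSub_le_of_nontrivial x
    obtain ⟨e, he, he0⟩ := exists_mem_rootSub_ne_zero α
    refine ⟨e, he0, fun b => ?_⟩
    -- No isomorphism with [,] is available at v x itself. For s off the values of v the pull-back
    -- gives the explicit function g, which vanishes at v x; both sides are continuous, so they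
    -- agree there too.
    let f : ℂ → ℂ := fun s =>
      LinearMap.trace ℂ L (pencilBr (modBr W) s e ∘ₗ pencilBr (modBr W) s b)
    let g : ℂ → ℂ := fun s => (v x - s) * (v y - s) * killingForm ℂ L e b
    have hf : Continuous f := by
      have : f = fun s => LinearMap.trace ℂ L (modBr W e ∘ₗ modBr W b) -
          s * LinearMap.trace ℂ L (lieBr e ∘ₗ modBr W b) -
          s * LinearMap.trace ℂ L (modBr W e ∘ₗ lieBr b) +
          s * s * LinearMap.trace ℂ L (lieBr e ∘ₗ lieBr b) := by
        funext s
        simp only [f, pencilBr, LinearMap.sub_apply, LinearMap.smul_apply, LinearMap.sub_comp,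
          LinearMap.comp_sub, LinearMap.smul_comp, LinearMap.comp_smul, map_sub, map_smul,
          smul_eq_mul]
        ring
      rw [this]
      fun_prop
    have hg : Continuous g := by fun_prop
    have hfg : f = g := by
      refine Continuous.ext_on (s := (Set.range v)ᶜ)
        ((Set.finite_range v).countable.dense_compl ℂ) hf hg fun s hs => ?_
      · obtain ⟨φ, ⟨r, hr, hφ'⟩, hφ⟩ := hG.exists_equiv hW (t := s) fun x h => hs ⟨x, h⟩
        change LinearMap.trace ℂ L _ = _
        rw [trace_pencilBr hφ, hφ' x y e (hxy he)]
        refine hG.induction (C := fun b =>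
          killingForm ℂ L ((r x * r y) • e) (φ b) = (v x - s) * (v y - s) * killingForm ℂ L e b)
          (fun z h hz hh => ?_) (fun β z u hβ hzu b hb => ?_) (by simp)
          (fun a b ha hb => by rw [map_add, map_add, map_add, ha, hb]; ring) b
        · have h0 : killingForm ℂ L e h = 0 := by
            rw [LieModule.traceForm_comm,
              killingForm_cartan_rootPart hh (rootSub_le_rootPart hα he)]
          rw [hφ' z z h hz, map_smul, map_smul, LinearMap.smul_apply, h0]
          simp
        · rw [hφ' z u b (hzu hb), map_smul, map_smul, LinearMap.smul_apply]
          by_cases h0 : (α : H → ℂ) + β = 0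
          · have hβα : rootSub H β ≤ G s(x, y) := by
              rw [← neg_eq_of_add_eq_zero_right h0]
              exact hG.symm _ α hα hxy
            have h1 : r z * r u = r x * r y := by
              have := hG.eq_of_rootSub_le hzu hβα
              rw [Sym2.eq_iff] at this
              rcases this with ⟨rfl, rfl⟩ | ⟨rfl, rfl⟩
              · rfl
              · exact mul_comm _ _
            rw [h1, ← hr, ← hr, smul_eq_mul, smul_eq_mul]
            ring
          · rw [killingForm_rootSub he hb h0]
            simp
    have := congrFun hfg (v x)
    simpa [f, g] using this

end IsToralQuasigrading

theorem pair_eq_of_sum_eq_of_prod_eq {a b c d : ℂ} (hs : a + b = c + d) (hp : a * b = c * d) :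
    (a = c ∧ b = d) ∨ (a = d ∧ b = c) := by
  have h : (a - c) * (a - d) = 0 := by linear_combination a * hs - hp
  rcases mul_eq_zero.mp h with h | h
  · left
    exact ⟨sub_eq_zero.mp h, by linear_combination hs - h⟩
  · right
    exact ⟨sub_eq_zero.mp h, by linear_combination hs - h⟩

/-! ### Pairs of times, the basic subalgebra and the centres for a quasigrading -/

namespace IsToralQuasigrading

variable {L : Type*} [LieRing L] [LieAlgebra ℂ L] [FiniteDimensional ℂ L] [IsKilling ℂ L]
variable {H : LieSubalgebra ℂ L} [H.IsCartanSubalgebra]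
variable {ι : Type*} [Finite ι] {G : Sym2 ι → Submodule ℂ L} {v : ι → ℂ} {W P : Module.End ℂ L}

theorem exists_primitive (hG : IsToralQuasigrading H G) (hW : ActsBy G v W)
    (hP : IsPrincipalPrimitive W P) : (∀ z ∈ H, P z = 0) ∧ ∃ p, IsRootGraded H P p ∧
      ∀ (α : Weight ℂ H L) (x y : ι), α.IsNonZero → rootSub H α ≤ G s(x, y) →
        p α = (v x - v y) ^ 2 / 8 := by
  obtain ⟨l, hl, hl'⟩ := hG.exists_isRootGraded hW
  obtain ⟨hz, p, hp, -⟩ := hl.exists_primitive hP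
  refine ⟨hz, p, hp, fun α x y hα hxy => ?_⟩
  obtain ⟨u, hu, w, hw, huw⟩ := Submodule.mem_sup.mp (hG.coroot_mem hα hxy)
  exact hl.primitive_eq (hG.isPrincipal hW) (hG.isBiLie hW).isLieBracket hP hp hα
    (hl' α x y hα hxy) (hl' (-α) x y hα.neg (hG.symm _ α hα hxy)) (actsBy_diag hW hu)
    (actsBy_diag hW hw) huw.symm

theorem primitive_apply (hG : IsToralQuasigrading H G) (hW : ActsBy G v W)
    (hP : IsPrincipalPrimitive W P) {x y : ι} {a : L} (ha : a ∈ G s(x, y)) :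
    P a = ((v x - v y) ^ 2 / 8) • a := by
  obtain ⟨hz, p, hp, hp'⟩ := hG.exists_primitive hW hP
  refine hG.component_induction (C := fun a => P a = ((v x - v y) ^ 2 / 8) • a)
    (fun h hh hH => ?_) (fun α hα hxy e he => ?_)
    (fun a b ha hb => by rw [map_add, ha, hb, smul_add]) ha
  · rw [hz h hH]
    by_cases hxy : x = y
    · simp [hxy]
    · rw [hG.eq_zero_of_mem_cartan hxy hh hH, smul_zero]
  · rw [hp.root α hα e he, hp' α x y hα hxy]

theorem isTimesPair_iff (hG : IsToralQuasigrading H G) (hW : ActsBy G v W) {α : Weight ℂ H L}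
    (hα : α.IsNonZero) {x y : ι} (hxy : rootSub H α ≤ G s(x, y)) {t₁ t₂ : ℂ} :
    IsTimesPair H W α t₁ t₂ ↔ (t₁ = v x ∧ t₂ = v y) ∨ (t₁ = v y ∧ t₂ = v x) := by
  obtain ⟨P, hP⟩ := exists_isPrincipalPrimitive W
  obtain ⟨l, hl, hl'⟩ := hG.exists_isRootGraded hW
  obtain ⟨-, p, hp, hp'⟩ := hG.exists_primitive hW hP
  rw [hl.isTimesPair_iff hP hp hα, hG.scalar_neg hl' α hα, hl' α x y hα hxy, hp' α x y hα hxy]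
  constructor
  · rintro ⟨h1, h2⟩
    exact pair_eq_of_sum_eq_of_prod_eq (by linear_combination h1) (by linear_combination h2)
  · rintro (⟨rfl, rfl⟩ | ⟨rfl, rfl⟩) <;> constructor <;> ring

theorem isPrincipalWNO (hG : IsToralQuasigrading H G) (hW : ActsBy G v W) :
    IsPrincipalWNO (modBr W) W :=
  ⟨(hG.isBiLie hW).isLieBracket, rfl, hG.isPrincipal hW⟩

theorem lie_of_mem_cartan (hG : IsToralQuasigrading H G) (hW : ActsBy G v W) {h : L} (hh : h ∈ H)
    (x : L) : W ⁅h, x⁆ = ⁅h, W x⁆ := by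
  obtain ⟨l, hl, -⟩ := hG.exists_isRootGraded hW
  exact hl.lie_cartan hh x

theorem mem_centre_of_mem_cartan (hG : IsToralQuasigrading H G) (hW : ActsBy G v W) {x : ι}
    {h : L} (hx : h ∈ G s(x, x)) (hh : h ∈ H) : h ∈ centre (modBr W) (v x) :=
  (mem_centre_modBr (hG.isPrincipal hW)).mpr
    ⟨actsBy_diag hW hx, hG.lie_of_mem_cartan hW hh⟩

theorem cartan_le_central (hG : IsToralQuasigrading H G) (hW : ActsBy G v W) :
    H.toSubmodule ≤ central (modBr W) := by
  rw [← hG.iSup_inf_cartan]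
  exact iSup_le fun x h hh =>
    Submodule.mem_iSup_of_mem (v x) (hG.mem_centre_of_mem_cartan hW hh.1 hh.2)

theorem preservesRootGrading (hG : IsToralQuasigrading H G) (hW : ActsBy G v W) :
    PreservesRootGrading H W := by
  obtain ⟨l, hl, -⟩ := hG.exists_isRootGraded hW
  refine ⟨hl.cartan, fun α hα e he => ?_, ?_⟩
  · rw [hl.root α hα e he]
    exact Submodule.smul_mem _ _ he
  · conv_lhs => rw [← hG.iSup_inf_cartan]
    exact iSup_le fun x h hh => Submodule.mem_iSup_of_mem (v x)
      ⟨hh.2, Module.End.mem_eigenspace_iff.mpr (actsBy_diag hW hh.1)⟩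

theorem isClassI (hG : IsToralQuasigrading H G) (hv : Function.Injective v) (hW : ActsBy G v W) :
    IsClassI H (modBr W) := by
  refine ⟨hG.isBiLie hW, ⟨H, inferInstance, hG.cartan_le_central hW⟩, W, hG.isPrincipalWNO hW,
    hG.preservesRootGrading hW, ?_⟩
  rintro ⟨α, β, γ, hα, hβ, hγ, hs, t₁, t₂, hne, h1, h2, h3⟩
  obtain ⟨x, y, hxy⟩ := hG.exists_rootSub_le hα
  -- By injectivity of v the times determine the component, so a forbidden triangle would lie in a
  -- single off-diagonal component.
  have key : ∀ β : Weight ℂ H L, β.IsNonZero → IsTimesPair H W β t₁ t₂ →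
      rootSub H β ≤ G s(x, y) := fun β hβ h => by
    obtain ⟨z, u, hzu⟩ := hG.exists_rootSub_le hβ
    suffices s(z, u) = s(x, y) by rwa [this] at hzu
    rw [Sym2.eq_iff]
    rcases (hG.isTimesPair_iff hW hα hxy).mp h1 with ⟨a1, a2⟩ | ⟨a1, a2⟩ <;>
    rcases (hG.isTimesPair_iff hW hβ hzu).mp h with ⟨b1, b2⟩ | ⟨b1, b2⟩
    · exact Or.inl ⟨hv (b1.symm.trans a1), hv (b2.symm.trans a2)⟩
    · exact Or.inr ⟨hv (b2.symm.trans a2), hv (b1.symm.trans a1)⟩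
    · exact Or.inr ⟨hv (b1.symm.trans a1), hv (b2.symm.trans a2)⟩
    · exact Or.inl ⟨hv (b2.symm.trans a2), hv (b1.symm.trans a1)⟩
  have hxy' : x ≠ y := by
    rintro rfl
    rcases (hG.isTimesPair_iff hW hα hxy).mp h1 with ⟨a1, a2⟩ | ⟨a1, a2⟩ <;>
    exact hne (a1.trans a2.symm)
  exact hG.no_triangle hxy' hα hβ hγ hs hxy (key β hβ h2) (key γ hγ h3)

theorem mem_diag_of_mem_cartan (hG : IsToralQuasigrading H G) (hv : Function.Injective v)
    (hW : ActsBy G v W) {x : ι} {h : L} (hh : h ∈ H) (hx : W h = v x • h) : h ∈ G s(x, x) := by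
  classical
  have := Fintype.ofFinite ι
  obtain ⟨f, hf, hsum⟩ := exists_sum_mem (hG.cartan_le hh)
  rw [← hsum] at hx ⊢
  have h0 : ∀ y, y ≠ x → f y = 0 := fun y hy =>
    component_eq_zero hG.indep_diag (c := v) (fun z a ha => actsBy_diag hW ha) hf hx
      fun h => hy (hv h)
  rw [Finset.sum_eq_single x (fun y _ hy => h0 y hy) (by simp)]
  exact hf x

theorem basicPart_eq (hG : IsToralQuasigrading H G) (hv : Function.Injective v)
    (hW : ActsBy G v W) (x : ι) : G s(x, x) = basicPart H W (v x) := by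
  apply le_antisymm
  · rw [hG.component_eq s(x, x)]
    refine sup_le_sup (fun h hh => ⟨hh.2, ?_⟩) (iSup₂_le fun α hα => ?_)
    · exact Module.End.mem_eigenspace_iff.mpr (actsBy_diag hW hh.1)
    · refine le_iSup₂_of_le (f := fun (α : Weight ℂ H L)
        (_ : α ∈ {α : Weight ℂ H L | α.IsNonZero ∧ IsTimesPair H W α (v x) (v x)}) => rootSub H α)
        α ⟨hα.1, ?_⟩ le_rfl
      exact (hG.isTimesPair_iff hW hα.1 hα.2).mpr (Or.inl ⟨rfl, rfl⟩)
  · refine sup_le (fun h hh => ?_) (iSup₂_le fun α hα => ?_)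
    · exact hG.mem_diag_of_mem_cartan hv hW hh.1 (Module.End.mem_eigenspace_iff.mp hh.2)
    · obtain ⟨y, z, hyz⟩ := hG.exists_rootSub_le hα.1
      rcases (hG.isTimesPair_iff hW hα.1 hyz).mp hα.2 with ⟨a1, a2⟩ | ⟨a1, a2⟩
      · rwa [← hv a1, ← hv a2] at hyz
      · rwa [← hv a1, ← hv a2] at hyz

theorem lie_mem_diag_self (hG : IsToralQuasigrading H G) {x : ι} {a b : L} (ha : a ∈ G s(x, x))
    (hb : b ∈ G s(x, x)) : ⁅a, b⁆ ∈ G s(x, x) := by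
  simpa using hG.lie_mem_diag x x a ha b hb

theorem exists_subalgebra_diag (hG : IsToralQuasigrading H G) (x : ι) :
    ∃ K : LieSubalgebra ℂ L, K.toSubmodule = G s(x, x) :=
  ⟨{ G s(x, x) with lie_mem' := fun ha hb => hG.lie_mem_diag_self ha hb }, rfl⟩

/-- Toral elements normalize every component, and root spaces in different diagonal components
commute. -/
theorem exists_subalgebra_iSup_diag (hG : IsToralQuasigrading H G) :
    ∃ K : LieSubalgebra ℂ L, K.toSubmodule = ⨆ x : ι, G s(x, x) := by
  have hle : ∀ x, G s(x, x) ≤ ⨆ x : ι, G s(x, x) := le_iSup (fun x => G s(x, x))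
  have key : ∀ x y, ∀ a ∈ G s(x, x), ∀ b ∈ G s(y, y), ⁅a, b⁆ ∈ ⨆ x : ι, G s(x, x) := by
    intro x y a ha b hb
    by_cases hxy : x = y
    · subst hxy
      exact hle x (hG.lie_mem_diag_self ha hb)
    refine hG.component_induction (C := fun a => ⁅a, b⁆ ∈ ⨆ x : ι, G s(x, x))
      (fun h _ hH => hle y (hG.cartan_lie_mem hH hb)) (fun α hα hp e he => ?_)
      (fun x y hx hy => by rw [add_lie]; exact add_mem hx hy) ha
    refine hG.component_induction (C := fun b => ⁅e, b⁆ ∈ ⨆ x : ι, G s(x, x))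
      (fun h _ hH => ?_) (fun β hβ hq f hf => ?_)
      (fun x y hx hy => by rw [lie_add]; exact add_mem hx hy) hb
    · rw [← lie_skew]
      exact neg_mem (hle x (hG.cartan_lie_mem hH (hp he)))
    · rw [hG.lie_disjoint _ _ (fun z hz => ?_) α β hα hβ hp hq e he f hf]
      · exact zero_mem _
      · rw [Sym2.mem_iff, Sym2.mem_iff, or_self, or_self] at hz
        exact hxy (hz.1.symm.trans hz.2)
  refine ⟨{ ⨆ x : ι, G s(x, x) with lie_mem' := ?_ }, rfl⟩
  intro a b ha hb
  change a ∈ ⨆ x : ι, G s(x, x) at ha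
  change b ∈ ⨆ x : ι, G s(x, x) at hb
  change ⁅a, b⁆ ∈ ⨆ x : ι, G s(x, x)
  refine Submodule.iSup_induction _ (motive := fun a => ⁅a, b⁆ ∈ ⨆ x : ι, G s(x, x)) ha
    (fun x a ha => ?_) (by simp) (fun x y hx hy => by rw [add_lie]; exact add_mem hx hy)
  exact Submodule.iSup_induction _ (motive := fun b => ⁅a, b⁆ ∈ ⨆ x : ι, G s(x, x)) hb
    (fun y b hb => key x y a ha b hb) (by simp)
    (fun x y hx hy => by rw [lie_add]; exact add_mem hx hy)

theorem centre_eq_bot (hG : IsToralQuasigrading H G) (hW : ActsBy G v W) {t : ℂ}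
    (ht : ∀ x, v x ≠ t) : centre (modBr W) t = ⊥ := by
  obtain ⟨φ, -, hφ⟩ := hG.exists_equiv hW ht
  refine (Submodule.eq_bot_iff _).mpr fun a ha => φ.injective ?_
  rw [map_zero]
  refine eq_of_killingForm fun z => ?_
  have had : ad ℂ L (φ a) = 0 := by
    ext b
    obtain ⟨c, rfl⟩ := φ.surjective b
    rw [ad_apply, ← hφ, LinearMap.mem_ker.mp ha, LinearMap.zero_apply, map_zero]
    rfl
  rw [killingForm_eq_trace, had]
  simp

theorem central_eq (hG : IsToralQuasigrading H G) (hW : ActsBy G v W) :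
    central (modBr W) = ⨆ x : ι, centre (modBr W) (v x) := by
  refine le_antisymm (iSup_le fun t => ?_)
    (iSup_le fun x => le_iSup (fun t => centre (modBr W) t) (v x))
  by_cases ht : ∃ x, v x = t
  · obtain ⟨x, rfl⟩ := ht
    exact le_iSup (fun x => centre (modBr W) (v x)) x
  · rw [hG.centre_eq_bot hW fun x h => ht ⟨x, h⟩]
    exact bot_le

theorem basic_eq (hG : IsToralQuasigrading H G) (hv : Function.Injective v)
    (hW : ActsBy G v W) : basic H (modBr W) W = ⨆ x : ι, G s(x, x) := by
  apply le_antisymm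
  · refine iSup₂_le fun t ht => ?_
    by_cases hx : ∃ x, v x = t
    · obtain ⟨x, rfl⟩ := hx
      rw [← hG.basicPart_eq hv hW]
      exact le_iSup (fun x => G s(x, x)) x
    · exact absurd (hG.centre_eq_bot hW fun x h => hx ⟨x, h⟩) ht
  · refine iSup_le fun x => ?_
    -- The basic subalgebra omits t with zero centre. Nothing is lost: then the diagonal component
    -- has no toral part, hence no roots, whose coroots it would contain, and so it is zero.
    by_cases hx : centre (modBr W) (v x) = ⊥
    · have hH : ∀ h ∈ G s(x, x), h ∈ H → h = 0 := fun h hh hH => by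
        have := hG.mem_centre_of_mem_cartan hW hh hH
        rwa [hx, Submodule.mem_bot] at this
      refine fun a ha => (?_ : a = 0) ▸ zero_mem _
      refine hG.component_induction (C := fun a => a = 0) hH (fun α hα hp e he => ?_)
        (fun x y hx hy => by rw [hx, hy, add_zero]) ha
      refine absurd (hH _ ?_ (IsKilling.coroot α).2) (coroot_ne_zero hα)
      simpa using hG.coroot_mem hα hp
    · rw [hG.basicPart_eq hv hW]
      exact le_iSup₂_of_le (f := fun t (_ : t ∈ {t : ℂ | centre (modBr W) t ≠ ⊥}) =>
        basicPart H W t) (v x) hx le_rfl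

theorem cartanPerp_apply_mem (hG : IsToralQuasigrading H G) (hW : ActsBy G v W) {x : L}
    (hx : x ∈ cartanPerp H) : W x ∈ cartanPerp H := by
  obtain ⟨l, hl, -⟩ := hG.exists_isRootGraded hW
  rw [cartanPerp_eq] at hx ⊢
  exact hl.rootPart hx

theorem killingForm_cartanPerp (hG : IsToralQuasigrading H G) (hW : ActsBy G v W) {x : L}
    (hx : x ∈ cartanPerp H) (y : L) : killingForm ℂ L (W x) y = killingForm ℂ L x (W y) := by
  obtain ⟨l, hl, hl'⟩ := hG.exists_isRootGraded hW
  rw [cartanPerp_eq] at hx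
  exact hl.killingForm_eq (hG.scalar_neg hl') hx y

variable (H) in
/-- The roots of the component of `{x, x}` which vanish on the toral parts of the other components
on the diagonal. -/
def centralRoots (G : Sym2 ι → Submodule ℂ L) (x : ι) : Set (Weight ℂ H L) :=
  {α : Weight ℂ H L | α.IsNonZero ∧ rootSub H α ≤ G s(x, x) ∧
    ∀ h : H, (h : L) ∈ ⨆ s ∈ {s : ι | s ≠ x}, G s(s, s) ⊓ H.toSubmodule → α h = 0}

/-- W commutes with ad e because bracketing with e either gives zero or preserves the component: a
root pair containing x is kept, a disjoint one is killed, and α vanishes on the toral parts of the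
other diagonal components. -/
theorem mem_centre_of_centralRoots (hG : IsToralQuasigrading H G) (hW : ActsBy G v W) {x : ι}
    {α : Weight ℂ H L} (hα : α ∈ centralRoots H G x) {e : L} (he : e ∈ rootSub H α) :
    e ∈ centre (modBr W) (v x) := by
  refine (mem_centre_modBr (hG.isPrincipal hW)).mpr ⟨actsBy_diag hW (hα.2.1 he), fun b => ?_⟩
  have hex := hα.2.1 he
  refine hG.induction (C := fun b => W ⁅e, b⁆ = ⁅e, W b⁆) (fun z h hz hh => ?_)
    (fun β z u hβ hzu b hb => ?_) (by simp)
    (fun a b ha hb => by rw [lie_add, map_add, map_add, lie_add, ha, hb]) b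
  · rw [actsBy_diag hW hz, lie_smul]
    by_cases hzx : z = x
    · subst hzx
      rw [actsBy_diag hW (hG.lie_mem_diag_self hex hz)]
    · have h0 : α ⟨h, hh⟩ = 0 := hα.2.2 ⟨h, hh⟩
        (Submodule.mem_iSup_of_mem z (by
          rw [iSup_pos (by exact hzx)]
          exact ⟨hz, hh⟩))
      have h1 : ⁅e, h⁆ = 0 := by
        have := mem_rootSub.mp he ⟨h, hh⟩
        rw [h0, zero_smul] at this
        rw [← lie_skew, this, neg_zero]
      rw [h1, map_zero, smul_zero]
  · have hbz := hzu hb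
    rw [hW z u b hbz, lie_smul]
    rcases hG.lie_rootSub_cases hα.1 hβ hα.2.1 hzu he hb with
      h0 | ⟨x', y', u', hne, h1, h2, hm⟩ | ⟨x', y', h1, h2, hm⟩
    · rw [h0, map_zero, smul_zero]
    · rw [Sym2.eq_iff] at h1
      obtain ⟨rfl, rfl⟩ : x = x' ∧ x = y' := by
        rcases h1 with ⟨h, h'⟩ | ⟨h, h'⟩ <;> exact ⟨by assumption, by assumption⟩
      rw [hW _ _ _ hm]
      rw [Sym2.eq_iff] at h2
      rcases h2 with ⟨rfl, rfl⟩ | ⟨rfl, rfl⟩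
      · rfl
      · rw [add_comm]
    · rw [Sym2.eq_iff] at h1
      obtain ⟨rfl, rfl⟩ : x = x' ∧ x = y' := by
        rcases h1 with ⟨h, h'⟩ | ⟨h, h'⟩ <;> exact ⟨by assumption, by assumption⟩
      obtain ⟨rfl, rfl⟩ : z = x ∧ u = x := by
        rw [Sym2.eq_iff] at h2
        rcases h2 with h | h <;> exact h
      rw [sup_idem] at hm
      rw [hW _ _ _ hm]

theorem centre_eq (hG : IsToralQuasigrading H G) (hv : Function.Injective v)
    (hW : ActsBy G v W) (x : ι) : centre (modBr W) (v x) =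
      (G s(x, x) ⊓ H.toSubmodule) ⊔ ⨆ α ∈ centralRoots H G x, rootSub H α := by
  refine le_antisymm ?_ (sup_le (fun h hh => hG.mem_centre_of_mem_cartan hW hh.1 hh.2)
    (iSup₂_le fun α hα e he => hG.mem_centre_of_centralRoots hW hα he))
  have hpr := hG.isPrincipal hW
  -- The centre is stable under ad H, hence is the sum of its intersections with the weight spaces.
  let N : LieSubmodule ℂ H L :=
    { centre (modBr W) (v x) with
      lie_mem := fun {h m} hm => by
        have hm' := (mem_centre_modBr hpr).mp hm
        refine (mem_centre_modBr hpr).mpr ⟨?_, fun y => ?_⟩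
        · change W ⁅(h : L), m⁆ = _ • ⁅(h : L), m⁆
          rw [hG.lie_of_mem_cartan hW h.2, hm'.1, lie_smul]
        · change W ⁅⁅(h : L), m⁆, y⁆ = ⁅⁅(h : L), m⁆, W y⁆
          rw [lie_lie, lie_lie, map_sub, hG.lie_of_mem_cartan hW h.2, hm'.2, hm'.2,
            hG.lie_of_mem_cartan hW h.2] }
  have hN : centre (modBr W) (v x) =
      ⨆ χ : Weight ℂ H L, centre (modBr W) (v x) ⊓ rootSub H χ := by
    have := LieModule.eq_iSup_inf_genWeightSpace (N := N)
    rw [← LieSubmodule.toSubmodule_inj] at this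
    simp only [LieSubmodule.iSup_toSubmodule, LieSubmodule.inf_toSubmodule] at this
    exact this
  rw [hN]
  refine iSup_le fun α => ?_
  by_cases hα : α.IsNonZero
  · rintro e ⟨hec, her⟩
    by_cases he0 : e = 0
    · rw [he0]; exact zero_mem _
    suffices α ∈ centralRoots H G x from Submodule.mem_sup_right
      ((le_iSup₂ (f := fun (α : Weight ℂ H L) (_ : α ∈ centralRoots H G x) => rootSub H α) α this)
        her)
    obtain ⟨hWe, hcomm⟩ := (mem_centre_modBr hpr).mp hec
    have hvan : ∀ z, z ≠ x → ∀ h : H, (h : L) ∈ G s(z, z) → α h = 0 := fun z hzx h hz => by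
      have h1 := hcomm h
      have h2 : ⁅e, (h : L)⁆ = -(α h • e) := by
        rw [← lie_skew, mem_rootSub.mp her h]
      rw [actsBy_diag hW hz, lie_smul, h2, map_neg, map_smul, hWe] at h1
      have h3 : ((v z - v x) * α h) • e = 0 := by linear_combination (norm := module) h1
      exact (mul_eq_zero.mp ((smul_eq_zero.mp h3).resolve_right he0)).resolve_left
        (sub_ne_zero.mpr fun h => hzx (hv h))
    obtain ⟨y, z, hyz⟩ := hG.exists_rootSub_le hα
    have hyz' : (v y + v z) / 2 = v x :=
      smul_left_injective ℂ he0 ((hW y z e (hyz her)).symm.trans hWe)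
    -- With the coroot written as a bracket, centrality of e moves W onto the vector of the opposite
    -- root, whose eigenvalue is also v x.
    have hco : (IsKilling.coroot α : L) ∈ G s(x, x) := by
      obtain ⟨e', he', f, hf, he0', -, hef⟩ := exists_coroot hα
      obtain ⟨c, rfl⟩ := exists_smul_eq hα her he0 he'
      refine hG.mem_diag_of_mem_cartan hv hW (IsKilling.coroot α).2 ?_
      rw [← hef, smul_lie, map_smul, hcomm, hW y z f (hG.symm _ α hα hyz hf), hyz', lie_smul,
        smul_comm]
    -- The nonzero coroot also lies in the sum of the diagonal components of y and z. Once one index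
    -- is x, the midpoint relation `hyz'` makes the other equal to it.
    have hyzx : y = x ∨ z = x := by
      by_contra hne
      push Not at hne
      refine coroot_ne_zero hα (Submodule.disjoint_def.mp (hG.indep_diag x) _ hco
        ((sup_le ?_ ?_ : G s(y, y) ⊔ G s(z, z) ≤ _) (hG.coroot_mem hα hyz)))
      · exact le_iSup₂_of_le (f := fun (j : ι) (_ : j ≠ x) => G s(j, j)) y hne.1 le_rfl
      · exact le_iSup₂_of_le (f := fun (j : ι) (_ : j ≠ x) => G s(j, j)) z hne.2 le_rfl
    obtain ⟨rfl, rfl⟩ : y = x ∧ z = x := by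
      rcases hyzx with rfl | rfl
      · exact ⟨rfl, hv (by linear_combination 2 * hyz')⟩
      · exact ⟨hv (by linear_combination 2 * hyz'), rfl⟩
    refine ⟨hα, hyz, fun h hh => ?_⟩
    have hle : (⨆ s ∈ {s : ι | s ≠ z}, G s(s, s) ⊓ H.toSubmodule) ≤
        (LinearMap.ker (Weight.toLinear ℂ H L α)).map H.toSubmodule.subtype := by
      refine iSup₂_le fun s hs a ha => ?_
      exact ⟨⟨a, ha.2⟩, hvan s hs ⟨a, ha.2⟩ ha.1, rfl⟩
    obtain ⟨h', h0, hh'⟩ := hle hh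
    obtain rfl : h' = h := Subtype.ext hh'
    exact h0
  · rw [rootSub_of_isZero hα]
    rintro h ⟨hhc, hhH⟩
    refine Submodule.mem_sup_left ⟨?_, hhH⟩
    exact hG.mem_diag_of_mem_cartan hv hW hhH ((mem_centre_modBr hpr).mp hhc).1

end IsToralQuasigrading

/-! ### Transport of principal operators and primitives by automorphisms -/

section Transport

variable {L : Type*} [LieRing L] [LieAlgebra ℂ L] [FiniteDimensional ℂ L] [IsKilling ℂ L]

theorem conj_ad (φ : L ≃ₗ⁅ℂ⁆ L) (x : L) :
    φ.toLinearEquiv.conj (ad ℂ L x) = ad ℂ L (φ x) := by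
  ext y
  obtain ⟨z, rfl⟩ := φ.toLinearEquiv.surjective y
  rw [LinearEquiv.conj_apply_apply, LinearEquiv.symm_apply_apply, ad_apply, ad_apply]
  exact LieEquiv.map_lie φ x z

theorem conj_mul' (φ : L ≃ₗ⁅ℂ⁆ L) (A B : Module.End ℂ L) :
    φ.toLinearEquiv.conj (A * B) = φ.toLinearEquiv.conj A * φ.toLinearEquiv.conj B :=
  LinearEquiv.conj_comp _ _ _

theorem IsPrincipal.conj {W : Module.End ℂ L} (hW : IsPrincipal W) (φ : L ≃ₗ⁅ℂ⁆ L) :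
    IsPrincipal (φ.toLinearEquiv.conj W) := fun x => by
  obtain ⟨x, rfl⟩ := φ.toLinearEquiv.surjective x
  have : ad ℂ L (φ.toLinearEquiv x) = φ.toLinearEquiv.conj (ad ℂ L x) := (conj_ad φ x).symm
  rw [this, ← conj_mul', LinearMap.trace_conj', hW]

theorem IsPrincipalPrimitive.conj {W P : Module.End ℂ L} (hP : IsPrincipalPrimitive W P)
    (φ : L ≃ₗ⁅ℂ⁆ L) :
    IsPrincipalPrimitive (φ.toLinearEquiv.conj W) (φ.toLinearEquiv.conj P) := fun x y => by
  obtain ⟨x, rfl⟩ := φ.toLinearEquiv.surjective x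
  obtain ⟨y, rfl⟩ := φ.toLinearEquiv.surjective y
  have hx : ad ℂ L (φ.toLinearEquiv x) = φ.toLinearEquiv.conj (ad ℂ L x) := (conj_ad φ x).symm
  have hy : ad ℂ L (φ.toLinearEquiv y) = φ.toLinearEquiv.conj (ad ℂ L y) := (conj_ad φ y).symm
  have h1 : ∀ A B : Module.End ℂ L, ⁅φ.toLinearEquiv.conj A, φ.toLinearEquiv.conj B⁆ =
      φ.toLinearEquiv.conj ⁅A, B⁆ := fun A B => by
    rw [Ring.lie_def, Ring.lie_def, map_sub, conj_mul', conj_mul']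
  rw [hx, hy, h1, h1, ← conj_mul', LinearMap.trace_conj', ← hP, LinearEquiv.conj_apply_apply,
    LinearEquiv.symm_apply_apply]
  exact killingForm_of_equiv_apply φ (P x) y

theorem IsPrincipalPrimitive.smul_add {W P : Module.End ℂ L} (hP : IsPrincipalPrimitive W P)
    (c d : ℂ) : IsPrincipalPrimitive (c • W + d • (1 : Module.End ℂ L)) (c ^ 2 • P) :=
  fun x y => by
  have h1 : ∀ A : Module.End ℂ L, ⁅c • W + d • (1 : Module.End ℂ L), A⁆ = c • ⁅W, A⁆ := fun A => by
    simp only [Ring.lie_def, add_mul, mul_add, smul_mul_assoc, mul_smul_comm, one_mul, mul_one,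
      smul_sub]
    abel
  have h2 : ∀ A : Module.End ℂ L, ⁅W, c • A⁆ = c • ⁅W, A⁆ := fun A => by
    simp only [Ring.lie_def, smul_mul_assoc, mul_smul_comm, smul_sub]
  rw [h1, h1, h2, LinearMap.smul_apply, map_smul, LinearMap.smul_apply, hP, smul_mul_assoc,
    smul_mul_assoc, map_smul, map_smul]
  simp only [smul_eq_mul]
  ring

theorem modBr_conj (φ : L ≃ₗ⁅ℂ⁆ L) (W : Module.End ℂ L) (x y : L) :
    modBr (φ.toLinearEquiv.conj W) (φ x) (φ y) = φ (modBr W x y) := by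
  have h1 : ∀ z, φ.toLinearEquiv.conj W (φ z) = φ (W z) := fun z => by
    change φ.toLinearEquiv.conj W (φ.toLinearEquiv z) = _
    rw [LinearEquiv.conj_apply_apply, LinearEquiv.symm_apply_apply]
    rfl
  rw [modBr_apply, modBr_apply, map_sub, map_add, LieEquiv.map_lie, LieEquiv.map_lie,
    ← LieEquiv.map_lie φ x y, h1, h1, h1]

theorem modBr_smul_add (c d : ℂ) (W : Module.End ℂ L) (x y : L) :
    modBr (c • W + d • (1 : Module.End ℂ L)) x y = c • modBr W x y + d • ⁅x, y⁆ := by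
  simp only [modBr_apply, LinearMap.add_apply, LinearMap.smul_apply, Module.End.one_apply, add_lie,
    lie_add, smul_lie, lie_smul]
  module

/-- An isomorphism of the pencils transports the principal operators. -/
theorem conj_eq_of_isomorphic {W W' : Module.End ℂ L} (hW : IsPrincipal W) (hW' : IsPrincipal W')
    {φ : L ≃ₗ⁅ℂ⁆ L} {c d : ℂ}
    (h : ∀ x y, φ (modBr W x y) = c • modBr W' (φ x) (φ y) + d • ⁅φ x, φ y⁆) :
    φ.toLinearEquiv.conj W = c • W' + d • (1 : Module.End ℂ L) := by
  refine (hW.conj φ).eq_of_modBr_eq (hW'.smul_add c d) ?_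
  ext u w
  obtain ⟨x, rfl⟩ := φ.toLinearEquiv.surjective u
  obtain ⟨y, rfl⟩ := φ.toLinearEquiv.surjective w
  rw [modBr_smul_add]
  exact (modBr_conj φ W x y).trans (h x y)

end Transport

/-- This is why the joint eigenvalues of W and P separate unordered pairs: they determine the sum
and the product. -/
theorem pair_eq_of_half_sum_eq {a b c d : ℂ} (hs : (a + b) / 2 = (c + d) / 2)
    (hp : (a - b) ^ 2 / 8 = (c - d) ^ 2 / 8) : (a = c ∧ b = d) ∨ (a = d ∧ b = c) :=
  pair_eq_of_sum_eq_of_prod_eq (by linear_combination 2 * hs)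
    (by linear_combination (a + b + c + d) / 2 * hs - 2 * hp)

/-! ### Isomorphisms of pencils and equivalences of quasigradings -/

namespace IsToralQuasigrading

variable {L : Type*} [LieRing L] [LieAlgebra ℂ L] [FiniteDimensional ℂ L] [IsKilling ℂ L]
variable {H : LieSubalgebra ℂ L} [H.IsCartanSubalgebra]
variable {ι : Type*} [Finite ι] {G : Sym2 ι → Submodule ℂ L} {v : ι → ℂ} {W P : Module.End ℂ L}

/-- The components are the joint eigenspaces of the principal operator and its primitive. -/
theorem exists_component (hG : IsToralQuasigrading H G)
    (hW : ActsBy G v W) (hP : IsPrincipalPrimitive W P) {x y : ℂ} {a : L}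
    (h1 : W a = ((x + y) / 2) • a) (h2 : P a = ((x - y) ^ 2 / 8) • a) :
    ∃ f : Sym2 ι → L, (∀ p, f p ∈ G p) ∧ ∑ᶠ p, f p = a ∧
      ∀ i j, f s(i, j) ≠ 0 → (v i = x ∧ v j = y) ∨ (v i = y ∧ v j = x) := by
  classical
  have := Fintype.ofFinite ι
  obtain ⟨f, hf, hsum⟩ := exists_sum_mem
    (hG.iSup_eq_top ▸ Submodule.mem_top : a ∈ ⨆ p, G p)
  refine ⟨f, hf, by rw [finsum_eq_sum_of_fintype, hsum], fun i j hij => ?_⟩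
  rw [← hsum] at h1 h2
  refine pair_eq_of_half_sum_eq ?_ ?_
  · by_contra hne
    refine hij (component_eq_zero hG.indep (T := W)
      (c := Sym2.lift ⟨fun i j => (v i + v j) / 2, fun i j => by simp only [add_comm]⟩)
      (fun p a ha => ?_) hf h1 (by exact hne))
    induction p using Sym2.ind with
    | _ i j => exact hW i j a ha
  · by_contra hne
    refine hij (component_eq_zero hG.indep (T := P)
      (c := Sym2.lift ⟨fun i j => (v i - v j) ^ 2 / 8, fun i j => by beta_reduce; ring⟩)
      (fun p a ha => ?_) hf h2 (by exact hne))
    induction p using Sym2.ind with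
    | _ i j => exact hG.primitive_apply hW hP ha

theorem mem_component (hG : IsToralQuasigrading H G) (hv : Function.Injective v)
    (hW : ActsBy G v W) (hP : IsPrincipalPrimitive W P) {x y : ι} {a : L}
    (h1 : W a = ((v x + v y) / 2) • a) (h2 : P a = ((v x - v y) ^ 2 / 8) • a) :
    a ∈ G s(x, y) := by
  obtain ⟨f, hf, hsum, hne⟩ := hG.exists_component hW hP h1 h2
  rw [← hsum, finsum_eq_single f s(x, y) fun p hp => ?_]
  · exact hf _
  · induction p using Sym2.ind with
    | _ i j =>
      by_contra h0
      refine hp (Sym2.eq_iff.mpr ?_)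
      rcases hne i j h0 with ⟨h, h'⟩ | ⟨h, h'⟩
      · exact Or.inl ⟨hv h, hv h'⟩
      · exact Or.inr ⟨hv h, hv h'⟩

theorem exists_eq_of_ne_zero (hG : IsToralQuasigrading H G)
    (hW : ActsBy G v W) (hP : IsPrincipalPrimitive W P) {x y : ℂ} {a : L} (ha : a ≠ 0)
    (h1 : W a = ((x + y) / 2) • a) (h2 : P a = ((x - y) ^ 2 / 8) • a) : ∃ i, v i = x := by
  obtain ⟨f, hf, hsum, hne⟩ := hG.exists_component hW hP h1 h2
  by_contra hno
  push Not at hno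
  refine ha ?_
  rw [← hsum]
  refine finsum_eq_zero_of_forall_eq_zero fun p => ?_
  induction p using Sym2.ind with
  | _ i j =>
    by_contra h0
    rcases hne i j h0 with ⟨h, -⟩ | ⟨-, h⟩
    · exact hno i h
    · exact hno j h

variable {H' : LieSubalgebra ℂ L} [H'.IsCartanSubalgebra]
variable {κ : Type*} [Finite κ] {G' : Sym2 κ → Submodule ℂ L} {w : κ → ℂ} {W' : Module.End ℂ L}

/-- Conjugation by φ turns W into c W' + d and P into c² P', so on times it acts as t ↦ (t - d)/c.
-/
theorem transport_apply (hG : IsToralQuasigrading H G) (hW : ActsBy G v W)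
    (hW' : IsPrincipal W') {P' : Module.End ℂ L} (hP' : IsPrincipalPrimitive W' P')
    {φ : L ≃ₗ⁅ℂ⁆ L} {c d : ℂ} (hc : c ≠ 0)
    (h : ∀ x y, φ (modBr W x y) = c • modBr W' (φ x) (φ y) + d • ⁅φ x, φ y⁆) {x y : ι} {a : L}
    (ha : a ∈ G s(x, y)) :
    W' (φ a) = (((v x - d) / c + (v y - d) / c) / 2) • φ a ∧
      P' (φ a) = (((v x - d) / c - (v y - d) / c) ^ 2 / 8) • φ a := by
  obtain ⟨P, hP⟩ := exists_isPrincipalPrimitive W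
  have e1 := conj_eq_of_isomorphic (hG.isPrincipal hW) hW' h
  have e2 : φ.toLinearEquiv.conj P = c ^ 2 • P' := by
    have := hP.conj φ
    rw [e1] at this
    exact this.unique (hP'.smul_add c d)
  have hconj : ∀ A : Module.End ℂ L, φ.toLinearEquiv.conj A (φ a) = φ (A a) := fun A => by
    change φ.toLinearEquiv.conj A (φ.toLinearEquiv a) = _
    rw [LinearEquiv.conj_apply_apply, LinearEquiv.symm_apply_apply]
    rfl
  have h1 := hconj W
  have h2 := hconj P
  rw [e1, hW x y a ha, map_smul, LinearMap.add_apply, LinearMap.smul_apply, LinearMap.smul_apply,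
    Module.End.one_apply] at h1
  rw [e2, hG.primitive_apply hW hP ha, map_smul, LinearMap.smul_apply] at h2
  constructor
  · have h3 : W' (φ a) = c⁻¹ • (c • W' (φ a)) := by rw [smul_smul, inv_mul_cancel₀ hc, one_smul]
    rw [h3, eq_sub_of_add_eq h1, ← sub_smul, smul_smul]
    congr 1
    field_simp
    ring
  · have h3 : P' (φ a) = (c ^ 2)⁻¹ • (c ^ 2 • P' (φ a)) := by
      rw [smul_smul, inv_mul_cancel₀ (pow_ne_zero 2 hc), one_smul]
    rw [h3, h2, smul_smul]
    congr 1
    field_simp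
    ring

theorem exists_index [Nontrivial L] (hG : IsToralQuasigrading H G) (hW : ActsBy G v W)
    (hG' : IsToralQuasigrading H' G') (hW' : ActsBy G' w W') {φ : L ≃ₗ⁅ℂ⁆ L} {c d : ℂ}
    (hc : c ≠ 0) (h : ∀ x y, φ (modBr W x y) = c • modBr W' (φ x) (φ y) + d • ⁅φ x, φ y⁆)
    (x : ι) : ∃ i, w i = (v x - d) / c := by
  obtain ⟨P', hP'⟩ := exists_isPrincipalPrimitive W'
  obtain ⟨α, hα, y, hxy⟩ := hG.exists_rootSub_le_of_nontrivial x
  obtain ⟨e, he, he0⟩ := exists_mem_rootSub_ne_zero α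
  obtain ⟨h1, h2⟩ := hG.transport_apply hW (hG'.isPrincipal hW') hP' hc h (hxy he)
  exact hG'.exists_eq_of_ne_zero hW' hP' (by simpa using he0) h1 h2

/-- Isomorphic pencils have equivalent quasigradings. -/
theorem exists_equivalence [Nontrivial L] (hG : IsToralQuasigrading H G)
    (hv : Function.Injective v) (hW : ActsBy G v W) (hG' : IsToralQuasigrading H' G')
    (hw : Function.Injective w) (hW' : ActsBy G' w W') {φ : L ≃ₗ⁅ℂ⁆ L} {c d : ℂ} (hc : c ≠ 0)
    (h : ∀ x y, φ (modBr W x y) = c • modBr W' (φ x) (φ y) + d • ⁅φ x, φ y⁆) :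
    ∃ χ : ι ≃ κ, (∀ x, w (χ x) = (v x - d) / c) ∧ EquivalentVia G G' χ := by
  have h' : ∀ x y, φ.symm (modBr W' x y) =
      c⁻¹ • modBr W (φ.symm x) (φ.symm y) + (-(d / c)) • ⁅φ.symm x, φ.symm y⁆ := fun x y => by
    have := congrArg φ.symm (h (φ.symm x) (φ.symm y))
    simp only [map_add, map_smul, LieEquiv.symm_apply_apply, LieEquiv.apply_symm_apply,
      LieEquiv.map_lie] at this
    rw [this]
    simp only [smul_add, smul_smul, inv_mul_cancel₀ hc, one_smul]
    rw [div_eq_inv_mul]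
    module
  -- The affine map and its inverse each send base values to base values, so the induced maps of
  -- indices are mutually inverse.
  choose f hf using hG.exists_index hW hG' hW' hc h
  choose g hg using hG'.exists_index hW' hG hW (inv_ne_zero hc) h'
  have hgf : ∀ x, g (f x) = x := fun x => hv (by rw [hg, hf]; field_simp; ring)
  have hfg : ∀ x, f (g x) = x := fun x => hw (by rw [hf, hg]; field_simp; ring)
  obtain ⟨P, hP⟩ := exists_isPrincipalPrimitive W
  obtain ⟨P', hP'⟩ := exists_isPrincipalPrimitive W'
  refine ⟨⟨f, g, hgf, hfg⟩, hf, φ, fun x y => le_antisymm ?_ fun b hb => ?_⟩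
  · rintro _ ⟨a, ha, rfl⟩
    obtain ⟨h1, h2⟩ := hG.transport_apply hW (hG'.isPrincipal hW') hP' hc h ha
    rw [← hf, ← hf] at h1 h2
    exact hG'.mem_component hw hW' hP' h1 h2
  · obtain ⟨h1, h2⟩ := hG'.transport_apply hW' (hG.isPrincipal hW) hP (inv_ne_zero hc) h' hb
    rw [← hg, ← hg] at h1 h2
    have h3 := hG.mem_component hv hW hP h1 h2
    simp only [Equiv.coe_fn_mk, hgf] at h3
    exact ⟨φ.symm b, h3, φ.apply_symm_apply b⟩

/-- Equivalences of quasigradings given by affine maps of the bases are isomorphisms of the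
pencils. -/
theorem map_modBr_of_equivalentVia (hG : IsToralQuasigrading H G) (hW : ActsBy G v W)
    (hW' : ActsBy G' w W') {χ : ι ≃ κ} {φ : L ≃ₗ⁅ℂ⁆ L}
    (hφ : ∀ x y, (G s(x, y)).map (φ : L →ₗ[ℂ] L) = G' s(χ x, χ y)) {c d : ℂ} (hc : c ≠ 0)
    (hχ : ∀ x, w (χ x) = c * v x + d) (x y : L) :
    φ (modBr W x y) = c⁻¹ • modBr W' (φ x) (φ y) + (-(c⁻¹ * d)) • ⁅φ x, φ y⁆ := by
  have h1 : ∀ a, W' (φ a) = c • φ (W a) + d • φ a := by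
    have : W' ∘ₗ (φ : L →ₗ[ℂ] L) = c • ((φ : L →ₗ[ℂ] L) ∘ₗ W) + d • (φ : L →ₗ[ℂ] L) := by
      refine hG.end_ext fun x y a ha => ?_
      have hm : φ a ∈ G' s(χ x, χ y) := hφ x y ▸ ⟨a, ha, rfl⟩
      have h2 := hW' _ _ _ hm
      simp only [LinearMap.comp_apply, LinearMap.add_apply, LinearMap.smul_apply, hW x y a ha,
        map_smul]
      change W' (φ a) = c • _ • φ a + d • φ a
      rw [h2, hχ, hχ]
      module
    exact fun a => LinearMap.congr_fun this a
  have h2 := h1 ⁅x, y⁆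
  rw [LieEquiv.map_lie] at h2
  rw [modBr_apply, modBr_apply, h1, h1, h2, map_sub, map_add, LieEquiv.map_lie, LieEquiv.map_lie]
  simp only [add_lie, lie_add, smul_lie, lie_smul, smul_add, smul_sub, smul_smul,
    inv_mul_cancel₀ hc, one_smul]
  module

theorem isomorphic_iff [Nontrivial L] (hG : IsToralQuasigrading H G)
    (hv : Function.Injective v) (hW : ActsBy G v W) (hG' : IsToralQuasigrading H' G')
    (hw : Function.Injective w) (hW' : ActsBy G' w W') :
    Isomorphic (modBr W) (modBr W') ↔
      ∃ χ : ι ≃ κ, EquivalentVia G G' χ ∧ ∃ c d : ℂ, ∀ x, w (χ x) = c * v x + d := by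
  constructor
  · rintro ⟨φ, c, d, hc, h⟩
    obtain ⟨χ, h1, h2⟩ := hG.exists_equivalence hv hW hG' hw hW' hc h
    exact ⟨χ, h2, c⁻¹, -(c⁻¹ * d), fun x => by rw [h1, div_eq_inv_mul]; ring⟩
  · rintro ⟨χ, ⟨φ, hφ⟩, c, d, h⟩
    obtain ⟨c', d', hc', h'⟩ : ∃ c d : ℂ, c ≠ 0 ∧ ∀ x, w (χ x) = c * v x + d := by
      -- Slope 0 is possible only for a base with at most one element, where slope 1 with a suitable
      -- shift does as well.
      by_cases hc : c = 0
      · by_cases hι : Nonempty ι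
        · obtain ⟨x₀⟩ := hι
          refine ⟨1, w (χ x₀) - v x₀, one_ne_zero, fun x => ?_⟩
          have : x = x₀ := χ.injective (hw (by rw [h, h, hc, zero_mul, zero_mul]))
          rw [this]
          ring
        · exact ⟨1, 0, one_ne_zero, fun x => absurd ⟨x⟩ hι⟩
      · exact ⟨c, d, hc, h⟩
    exact ⟨φ, c'⁻¹, _, inv_ne_zero hc', hG.map_modBr_of_equivalentVia hW hW' hφ hc' h'⟩

theorem stronglyIsomorphic_iff [Nontrivial L] (hG : IsToralQuasigrading H G)
    (hv : Function.Injective v) (hW : ActsBy G v W) (hG' : IsToralQuasigrading H' G')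
    (hw : Function.Injective w) (hW' : ActsBy G' w W') :
    StronglyIsomorphic (modBr W) (modBr W') ↔
      ∃ χ : ι ≃ κ, EquivalentVia G G' χ ∧ ∀ x, w (χ x) = v x := by
  constructor
  · rintro ⟨φ, h⟩
    obtain ⟨χ, h1, h2⟩ := hG.exists_equivalence hv hW hG' hw hW' (c := 1) (d := 0) one_ne_zero
      fun x y => by rw [h, one_smul, zero_smul, add_zero]
    exact ⟨χ, h2, fun x => by rw [h1, sub_zero, div_one]⟩
  · rintro ⟨χ, ⟨φ, hφ⟩, h⟩
    refine ⟨φ, fun x y => ?_⟩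
    rw [hG.map_modBr_of_equivalentVia hW hW' hφ (c := 1) (d := 0) one_ne_zero
      fun x => by rw [h, one_mul, add_zero]]
    simp

end IsToralQuasigrading

/-- The six relations between the eigenvalues on the root spaces of a triangle of roots force the
times of the three roots to coincide, unless the odd parts of the eigenvalues add up to zero. -/
theorem times_of_triangle {a b c a' b' c' p q r : ℂ}
    (h1 : (a - c') * (b - c') = p + q - r) (h2 : (b - a') * (c - a') = q + r - p)
    (h3 : (c - b') * (a - b') = r + p - q) (h4 : (a' - c) * (b' - c) = p + q - r)
    (h5 : (b' - a) * (c' - a) = q + r - p) (h6 : (c' - b) * (a' - b) = r + p - q)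
    (hk : a + b + c - (a' + b' + c') ≠ 0) : ∃ t₁ t₂ : ℂ, t₁ ≠ t₂ ∧
      (t₁ + t₂ = a + a' ∧ t₁ * t₂ = a * a' - 2 * p) ∧
      (t₁ + t₂ = b + b' ∧ t₁ * t₂ = b * b' - 2 * q) ∧
      (t₁ + t₂ = c + c' ∧ t₁ * t₂ = c * c' - 2 * r) := by
  -- Subtracting the relation of the opposite triangle cancels p, q, r; differences of the results
  -- have the nonzero odd sum as a factor.
  have hab : a + a' = b + b' := by
    refine sub_eq_zero.mp ((mul_eq_zero.mp (?_ : (a + b + c - (a' + b' + c')) *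
      (a + a' - (b + b')) = 0)).resolve_left hk)
    linear_combination h3 - h6 - (h2 - h5)
  have hac : a + a' = c + c' := by
    refine sub_eq_zero.mp ((mul_eq_zero.mp (?_ : (a + b + c - (a' + b' + c')) *
      (a + a' - (c + c')) = 0)).resolve_left hk)
    linear_combination h1 - h4 - (h2 - h5)
  obtain ⟨s, hs⟩ : ∃ s, s = (a + a') / 2 := ⟨_, rfl⟩
  obtain rfl : a' = 2 * s - a := by linear_combination -2 * hs
  obtain rfl : b' = 2 * s - b := by linear_combination - hab
  obtain rfl : c' = 2 * s - c := by linear_combination - hac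
  -- With κ = a + b + c - 3s, half the odd sum, adding two relations gives (a - s)² + 2p = κ², and
  -- likewise for b and c. So all three quadratics have the roots s ± κ.
  refine ⟨s + (a + b + c - 3 * s), s - (a + b + c - 3 * s), fun h => hk ?_, ⟨by ring, ?_⟩,
    ⟨by ring, ?_⟩, ⟨by ring, ?_⟩⟩
  · linear_combination h
  · linear_combination - h1 - h3
  · linear_combination - h1 - h2
  · linear_combination - h2 - h3

/-! ### Class I operators: evenness of the eigenvalues and the system of times -/

section

variable {L : Type*} [LieRing L] [LieAlgebra ℂ L] [FiniteDimensional ℂ L] [IsKilling ℂ L]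
variable {H : LieSubalgebra ℂ L} [H.IsCartanSubalgebra]
variable {W P : Module.End ℂ L} {l p : Weight ℂ H L → ℂ}

namespace IsRootGraded

theorem triangle_relations (h : IsRootGraded H W l) (hW : IsPrincipal W)
    (hN : IsLieBracket (modBr W)) (hP : IsPrincipalPrimitive W P) (hp : IsRootGraded H P p)
    (hpn : ∀ α : Weight ℂ H L, α.IsNonZero → p (-α) = p α)
    {α β γ : Weight ℂ H L} (hα : α.IsNonZero) (hβ : β.IsNonZero) (hγ : γ.IsNonZero)
    (hs : (α : H → ℂ) + β + γ = 0) :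
    (l α - l (-γ)) * (l β - l (-γ)) = p α + p β - p γ ∧
      (l (-α) - l γ) * (l (-β) - l γ) = p α + p β - p γ := by
  constructor
  · have := h.triangle_relation hW hN hP hp hα hβ hγ.neg
      (by rw [Weight.coe_neg]; exact eq_neg_of_add_eq_zero_left hs)
    rw [this, hpn γ hγ]
  · have := h.triangle_relation hW hN hP hp hα.neg hβ.neg hγ
      (by rw [Weight.coe_neg, Weight.coe_neg, ← neg_add]; exact neg_eq_of_add_eq_zero_right hs)
    rw [this, hpn α hα, hpn β hβ]

/-- The one place where Class I is used: unequal sums would give the triangle a common pair of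
distinct times. -/
theorem sum_eq_sum_neg (h : IsRootGraded H W l) (hW : IsPrincipal W)
    (hN : IsLieBracket (modBr W)) (hP : IsPrincipalPrimitive W P) (hp : IsRootGraded H P p)
    (hpn : ∀ α : Weight ℂ H L, α.IsNonZero → p (-α) = p α)
    (hI : ¬ ∃ α β γ : LieModule.Weight ℂ H L, α.IsNonZero ∧ β.IsNonZero ∧ γ.IsNonZero ∧
      (α : H → ℂ) + β + γ = 0 ∧ ∃ t₁ t₂ : ℂ, t₁ ≠ t₂ ∧
        IsTimesPair H W α t₁ t₂ ∧ IsTimesPair H W β t₁ t₂ ∧ IsTimesPair H W γ t₁ t₂)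
    {α β γ : Weight ℂ H L} (hα : α.IsNonZero) (hβ : β.IsNonZero) (hγ : γ.IsNonZero)
    (hs : (α : H → ℂ) + β + γ = 0) : l α + l β + l γ = l (-α) + l (-β) + l (-γ) := by
  by_contra hk
  have hs2 : (β : H → ℂ) + γ + α = 0 := by rw [← hs]; abel
  have hs3 : (γ : H → ℂ) + α + β = 0 := by rw [← hs]; abel
  obtain ⟨h1, h4⟩ := h.triangle_relations hW hN hP hp hpn hα hβ hγ hs
  obtain ⟨h2, h5⟩ := h.triangle_relations hW hN hP hp hpn hβ hγ hα hs2
  obtain ⟨h3, h6⟩ := h.triangle_relations hW hN hP hp hpn hγ hα hβ hs3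
  obtain ⟨t₁, t₂, hne, k1, k2, k3⟩ := times_of_triangle h1 h2 h3 h4 h5 h6 (sub_ne_zero.mpr hk)
  exact hI ⟨α, β, γ, hα, hβ, hγ, hs, t₁, t₂, hne, (h.isTimesPair_iff hP hp hα).mpr k1,
    (h.isTimesPair_iff hP hp hβ).mpr k2, (h.isTimesPair_iff hP hp hγ).mpr k3⟩

/-- If the odd part of the eigenvalues is additive on triangles, then it vanishes. -/
theorem scalar_neg_eq (h : IsRootGraded H W l) (hW : IsPrincipal W)
    (hadd : ∀ α β γ : Weight ℂ H L, α.IsNonZero → β.IsNonZero → γ.IsNonZero →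
      (α : H → ℂ) + β + γ = 0 → l α + l β + l γ = l (-α) + l (-β) + l (-γ))
    (α : Weight ℂ H L) (hα : α.IsNonZero) : l (-α) = l α := by
  classical
  -- The odd part of the eigenvalues, extended by 0 to H. It defines an operator D to be shown zero.
  let k : Weight ℂ H L → ℂ := fun α => if α.IsNonZero then (l α - l (-α)) / 2 else 0
  have hk : ∀ α : Weight ℂ H L, α.IsNonZero → k α = (l α - l (-α)) / 2 := fun α hα => if_pos hα
  obtain ⟨D, hD⟩ := exists_end_of_indep (iSupIndep_rootSub (H := H)) iSup_rootSub k
  have hDH : ∀ z ∈ H, D z = 0 := fun z hz => by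
    by_cases hz0 : z = 0
    · rw [hz0, map_zero]
    have hz' : z ∈ rootSub H (0 : H → ℂ) := by rw [rootSub_zero]; exact hz
    obtain ⟨χ, hχ⟩ : ∃ χ : Weight ℂ H L, (χ : H → ℂ) = 0 := by
      by_contra hne
      rw [rootSub_eq_bot hne, Submodule.mem_bot] at hz'
      exact hz0 hz'
    rw [← hχ] at hz'
    rw [hD χ z hz', show k χ = 0 from if_neg (fun h => h hχ), zero_smul]
  have hDg : IsRootGraded H D k :=
    ⟨fun z hz => by rw [hDH z hz]; exact H.zero_mem, fun α _ => hD α⟩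
  have hDp : IsPrincipal D := by
    -- W - D has even eigenvalues, hence is principal; so is W, and therefore D.
    have h1 : IsRootGraded H (W - D) (fun α => l α - k α) :=
      ⟨fun z hz => sub_mem (h.cartan z hz) (hDg.cartan z hz), fun α hα e he => by
        rw [LinearMap.sub_apply, h.root α hα e he, hDg.root α hα e he, sub_smul]⟩
    have h2 := h1.isPrincipal fun α hα => by
      rw [hk α hα, hk (-α) hα.neg, neg_neg]
      ring
    intro x
    have h3 := h2 x
    rw [sub_mul, map_sub, hW, zero_sub, neg_eq_zero] at h3
    exact h3
  -- On two root spaces the Leibniz rule is additivity of k when the sum is a root, and oddness of k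
  -- when the roots are opposite.
  have hder : ∀ x y, D ⁅x, y⁆ = ⁅D x, y⁆ + ⁅x, D y⁆ := by
    intro x y
    refine root_induction (H := H) (p := fun x => D ⁅x, y⁆ = ⁅D x, y⁆ + ⁅x, D y⁆)
      (fun z hz => ?_) (fun α hα e he => ?_) (fun a b ha hb => ?_) x
    · rw [hDg.lie_cartan hz, hDH z hz, zero_lie, zero_add]
    · refine root_induction (H := H) (p := fun y => D ⁅e, y⁆ = ⁅D e, y⁆ + ⁅e, D y⁆)
        (fun z hz => ?_) (fun β hβ f hf => ?_) (fun a b ha hb => ?_) y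
      · rw [hDH z hz, lie_zero, add_zero, ← lie_skew, map_neg, hDg.lie_cartan hz, lie_skew]
      · rw [hD α e he, hD β f hf, smul_lie, lie_smul, ← add_smul]
        by_cases h0 : ⁅e, f⁆ = 0
        · rw [h0, map_zero, smul_zero]
        obtain ⟨γ, hγ⟩ := add_eq_of_lie_ne_zero he hf h0
        have hm : ⁅e, f⁆ ∈ rootSub H γ := hγ ▸ lie_mem_rootSub he hf
        by_cases hγ0 : γ.IsNonZero
        · rw [hD γ _ hm]
          congr 1
          have := hadd α β (-γ) hα hβ hγ0.neg (by rw [Weight.coe_neg, hγ]; abel)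
          rw [neg_neg] at this
          rw [hk α hα, hk β hβ, hk γ hγ0]
          linear_combination (-1 / 2 : ℂ) * this
        · have hγ0' : (γ : H → ℂ) = 0 := not_not.mp hγ0
          have hβα : β = -α := by
            ext z
            have := congrFun (hγ.symm.trans hγ0') z
            simp only [Pi.add_apply, Pi.zero_apply] at this
            rw [Weight.coe_neg, Pi.neg_apply]
            linear_combination this
          rw [hγ0', rootSub_zero] at hm
          rw [hDH _ hm, hk α hα, hk β hβ, hβα, neg_neg]
          rw [show (l α - l (-α)) / 2 + (l (-α) - l α) / 2 = 0 by ring, zero_smul]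
      · rw [lie_add, map_add, map_add, lie_add, lie_add, ha, hb]
        abel
    · rw [add_lie, map_add, map_add, add_lie, add_lie, ha, hb]
      abel
  have hD0 := eq_zero_of_derivation hder hDp
  obtain ⟨e, he, he0⟩ := exists_mem_rootSub_ne_zero α
  have h1 := hD α e he
  rw [hD0, LinearMap.zero_apply, eq_comm, smul_eq_zero, hk α hα] at h1
  linear_combination -2 * h1.resolve_right he0

end IsRootGraded

/-- Generalized eigenvectors of an operator which is diagonalizable on `H` are eigenvectors. -/
theorem apply_eq_of_sq (hd : H.toSubmodule ≤ ⨆ t : ℂ, H.toSubmodule ⊓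
    Module.End.eigenspace W t) {h : L} (hh : h ∈ H) {x : ℂ}
    (h0 : W (W h) - (2 * x) • W h + (x * x) • h = 0) : W h = x • h := by
  have h1 : h ∈ ⨆ t : ℂ, Module.End.eigenspace W t :=
    (iSup_mono fun t => inf_le_right : ⨆ t : ℂ, H.toSubmodule ⊓
    Module.End.eigenspace W t ≤ _) (hd hh)
  -- The part r of h in the other eigenspaces is killed by (W - x)², so it lies in the generalized
  -- eigenspace of x, which is independent of them.
  rw [iSup_split_single _ x] at h1
  obtain ⟨u, hu, r, hr, rfl⟩ := Submodule.mem_sup.mp h1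
  have hu' := Module.End.mem_eigenspace_iff.mp hu
  have hr0 : r = 0 := by
    refine Submodule.disjoint_def.mp (Module.End.independent_maxGenEigenspace W x) r ?_ ?_
    · refine (Module.End.mem_maxGenEigenspace W x r).mpr ⟨2, ?_⟩
      rw [pow_two, Module.End.mul_apply]
      simp only [LinearMap.sub_apply, LinearMap.smul_apply, Module.End.one_apply, map_sub, map_smul]
      simp only [map_add, hu', map_smul] at h0
      linear_combination (norm := module) h0
    · exact (iSup₂_mono fun t _ => Module.End.genEigenspace_le_maximal _ _ _) hr
  rw [hr0, add_zero, hu']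

variable (H) in
/-- The pairs of times `T α` of the roots, for an operator `W` with equal eigenvalues on opposite
root spaces; `P` is its principal primitive. -/
structure IsTimesSystem (W P : Module.End ℂ L) (T : Weight ℂ H L → Sym2 ℂ) : Prop where
  cartan : ∀ h ∈ H, W h ∈ H
  primitive : ∀ h ∈ H, P h = 0
  root : ∀ α : Weight ℂ H L, α.IsNonZero → ∀ x y, T α = s(x, y) → ∀ e ∈ rootSub H α,
    W e = ((x + y) / 2) • e ∧ P e = ((x - y) ^ 2 / 8) • e
  neg : ∀ α : Weight ℂ H L, α.IsNonZero → T (-α) = T α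
  triangle : ∀ α β γ : Weight ℂ H L, α.IsNonZero → β.IsNonZero → γ.IsNonZero →
    (α : H → ℂ) + β = γ → ∃ x y z, T α = s(x, y) ∧ T β = s(y, z) ∧ T γ = s(x, z)
  coroot : ∀ α : Weight ℂ H L, α.IsNonZero → ∀ x y, T α = s(x, y) → ∃ u ∈ H, ∃ w ∈ H,
    W u = x • u ∧ W w = y • w ∧ (IsKilling.coroot α : L) = u + w

theorem exists_isTimesSystem (h : IsRootGraded H W l) (hW : IsPrincipal W)
    (hN : IsLieBracket (modBr W)) (hP : IsPrincipalPrimitive W P)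
    (hd : H.toSubmodule ≤ ⨆ t : ℂ, H.toSubmodule ⊓ Module.End.eigenspace W t)
    (hl : ∀ α : Weight ℂ H L, α.IsNonZero → l (-α) = l α) : ∃ T, IsTimesSystem H W P T := by
  obtain ⟨hz, p, hp, hpn⟩ := h.exists_primitive hP
  choose sq hsq using fun z : ℂ => IsAlgClosed.exists_eq_mul_self z
  -- The solutions of (t - l α)² = 2 p α; the unordered pair does not depend on the branch of the
  -- square root.
  let T : Weight ℂ H L → Sym2 ℂ := fun α => s(l α + sq (2 * p α), l α - sq (2 * p α))
  have hT : ∀ α x y, T α = s(x, y) ↔ (x + y) / 2 = l α ∧ (x - y) ^ 2 / 8 = p α := by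
    intro α x y
    have e := hsq (2 * p α)
    constructor
    · intro h
      rcases Sym2.eq_iff.mp h with ⟨rfl, rfl⟩ | ⟨rfl, rfl⟩
      · exact ⟨by ring, by linear_combination (-1 / 2 : ℂ) * e⟩
      · exact ⟨by ring, by linear_combination (-1 / 2 : ℂ) * e⟩
    · rintro ⟨h1, h2⟩
      rw [eq_comm]
      refine Sym2.eq_iff.mpr (pair_eq_of_half_sum_eq (by rw [h1]; ring) ?_)
      rw [h2]
      linear_combination (1 / 2 : ℂ) * e
  refine ⟨T, h.cartan, hz, fun α hα x y hxy e he => ?_, fun α hα => ?_,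
    fun α β γ hα hβ hγ hs => ?_, fun α hα x y hxy => ?_⟩
  · obtain ⟨h1, h2⟩ := (hT α x y).mp hxy
    rw [h1, h2]
    exact ⟨h.root α hα e he, hp.root α hα e he⟩
  · simp only [T, hl α hα, hpn α hα]
  · have r1 := (h.triangle_relations hW hN hP hp hpn hα hβ hγ.neg
      (by rw [Weight.coe_neg, hs, add_neg_cancel])).1
    have r2 := (h.triangle_relations hW hN hP hp hpn hβ hγ.neg hα
      (by rw [Weight.coe_neg, ← hs]; abel)).1
    have r3 := (h.triangle_relations hW hN hP hp hpn hγ.neg hα hβ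
      (by rw [Weight.coe_neg, ← hs]; abel)).1
    rw [neg_neg, hpn γ hγ] at r1
    rw [hl γ hγ, hl α hα, hpn γ hγ] at r2
    rw [hl γ hγ, hl β hβ, hpn γ hγ] at r3
    -- These x, y, z solve (x + y)/2 = l α, (y + z)/2 = l β, (x + z)/2 = l γ. The differences fit
    -- because adding two relations gives 2 p α = (l β - l γ)², and similarly for the others.
    refine ⟨l α - l β + l γ, l α + l β - l γ, l β + l γ - l α, (hT _ _ _).mpr ⟨by ring, ?_⟩,
      (hT _ _ _).mpr ⟨by ring, ?_⟩, (hT _ _ _).mpr ⟨by ring, ?_⟩⟩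
    · linear_combination (1 / 2 : ℂ) * (r1 + r3)
    · linear_combination (1 / 2 : ℂ) * (r1 + r2)
    · linear_combination (1 / 2 : ℂ) * (r2 + r3)
  · obtain ⟨h1, h2⟩ := (hT α x y).mp hxy
    have h3 := h.coroot_relation hW hN hP hp hα
    rw [hl α hα, ← h1, ← h2] at h3
    set c : L := (IsKilling.coroot α : L)
    have hc : c ∈ H := (IsKilling.coroot α).2
    have h4 : W (W c) = (x + y) • W c - (x * y) • c := by
      linear_combination (norm := module) h3
    by_cases hne : x = y
    -- A double time only gives (W - x)² c = 0; diagonalizability on H makes c an eigenvector.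
    · subst hne
      refine ⟨c, hc, 0, H.zero_mem, apply_eq_of_sq hd hc ?_, by simp, by simp⟩
      rw [h4]
      module
    · have hne' : x - y ≠ 0 := sub_ne_zero.mpr hne
      have hm : ∀ t : ℂ, W c - t • c ∈ H := fun t =>
        H.toSubmodule.sub_mem (h.cartan c hc) (H.toSubmodule.smul_mem t hc)
      -- Lagrange projections onto the two eigenspaces, as (W - x)(W - y) c = 0.
      refine ⟨(x - y)⁻¹ • (W c - y • c), H.toSubmodule.smul_mem _ (hm y),
        -(x - y)⁻¹ • (W c - x • c), H.toSubmodule.smul_mem _ (hm x), ?_, ?_, ?_⟩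
      · rw [map_smul, map_sub, map_smul, h4]
        module
      · rw [map_smul, map_sub, map_smul, h4]
        module
      · have : c = ((x - y)⁻¹ * (x - y)) • c := by rw [inv_mul_cancel₀ hne', one_smul]
        conv_lhs => rw [this]
        module

end

/-! ### The quasigrading by pairs of times -/

section

variable {L : Type*} [LieRing L] [LieAlgebra ℂ L] [FiniteDimensional ℂ L]
variable {H : LieSubalgebra ℂ L} [H.IsCartanSubalgebra]

variable (H) in
/-- The component of the pair of times `q`. -/
def timesComponent (W : Module.End ℂ L) (T : Weight ℂ H L → Sym2 ℂ) (q : Sym2 ℂ) :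
    Submodule ℂ L :=
  (⨆ x ∈ {x : ℂ | q = s(x, x)}, H.toSubmodule ⊓ Module.End.eigenspace W x) ⊔
    ⨆ α ∈ {α : Weight ℂ H L | α.IsNonZero ∧ T α = q}, rootSub H α

variable {W P : Module.End ℂ L} {T : Weight ℂ H L → Sym2 ℂ}

theorem mem_timesComponent_of_mem_cartan {x : ℂ} {h : L} (hh : h ∈ H) (hx : W h = x • h) :
    h ∈ timesComponent H W T s(x, x) := by
  refine Submodule.mem_sup_left (Submodule.mem_iSup_of_mem x (Submodule.mem_iSup_of_mem rfl
    ⟨hh, Module.End.mem_eigenspace_iff.mpr hx⟩))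

theorem rootSub_le_timesComponent {α : Weight ℂ H L} (hα : α.IsNonZero) {q : Sym2 ℂ}
    (h : T α = q) : rootSub H α ≤ timesComponent H W T q :=
  le_sup_of_le_right (le_iSup₂_of_le (f := fun (α : Weight ℂ H L)
    (_ : α ∈ {α : Weight ℂ H L | α.IsNonZero ∧ T α = q}) => rootSub H α) α ⟨hα, h⟩ le_rfl)

theorem timesComponent_le {q : Sym2 ℂ} {N : Submodule ℂ L}
    (hH : ∀ x, q = s(x, x) → ∀ h ∈ H, W h = x • h → h ∈ N)
    (hroot : ∀ α : Weight ℂ H L, α.IsNonZero → T α = q → ∀ e ∈ rootSub H α, e ∈ N) :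
    timesComponent H W T q ≤ N :=
  sup_le (iSup₂_le fun x hx h hh => hH x hx h hh.1 (Module.End.mem_eigenspace_iff.mp hh.2))
    (iSup₂_le fun α hα e he => hroot α hα.1 hα.2 e he)

variable [IsKilling ℂ L]

namespace IsTimesSystem

theorem apply_of_mem_timesComponent (hT : IsTimesSystem H W P T) {x y : ℂ} {a : L}
    (ha : a ∈ timesComponent H W T s(x, y)) :
    W a = ((x + y) / 2) • a ∧ P a = ((x - y) ^ 2 / 8) • a := by
  suffices timesComponent H W T s(x, y) ≤ Module.End.eigenspace W ((x + y) / 2) ⊓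
      Module.End.eigenspace P ((x - y) ^ 2 / 8) by
    obtain ⟨h1, h2⟩ := this ha
    exact ⟨Module.End.mem_eigenspace_iff.mp h1, Module.End.mem_eigenspace_iff.mp h2⟩
  refine timesComponent_le (fun z hz h hh hw => ?_) (fun α hα hq e he => ?_)
  · obtain ⟨rfl, rfl⟩ : x = z ∧ y = z := by simpa using hz
    refine ⟨Module.End.mem_eigenspace_iff.mpr ?_, Module.End.mem_eigenspace_iff.mpr ?_⟩
    · rw [hw, add_self_div_two]
    · rw [hT.primitive h hh]
      simp
  · obtain ⟨h1, h2⟩ := hT.root α hα x y hq e he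
    exact ⟨Module.End.mem_eigenspace_iff.mpr h1, Module.End.mem_eigenspace_iff.mpr h2⟩

theorem commute (hT : IsTimesSystem H W P T) : Commute W P := by
  refine LinearMap.ext fun x => ?_
  refine root_induction (H := H) (p := fun x => (W * P) x = (P * W) x) (fun h hh => ?_)
    (fun α hα e he => ?_) (fun a b ha hb => by rw [map_add, map_add, ha, hb]) x
  · rw [Module.End.mul_apply, Module.End.mul_apply, hT.primitive h hh,
      hT.primitive _ (hT.cartan h hh), map_zero]
  · obtain ⟨x, y, hxy⟩ : ∃ x y, T α = s(x, y) := by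
      induction T α with | _ x y => exact ⟨x, y, rfl⟩
    obtain ⟨h1, h2⟩ := hT.root α hα x y hxy e he
    rw [Module.End.mul_apply, Module.End.mul_apply, h1, h2, map_smul, map_smul, h1, h2, smul_comm]

/-- The components lie in joint eigenspaces of the commuting operators W and P, and different pairs
have different joint eigenvalues. -/
theorem iSupIndep_timesComponent (hT : IsTimesSystem H W P T) :
    iSupIndep (timesComponent H W T) := by
  have hpair : ∀ q : Sym2 ℂ, ∃ x y, q = s(x, y) := fun q => by
    induction q with | _ x y => exact ⟨x, y, rfl⟩
  choose f g hfg using hpair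
  let F : Bool → Module.End ℂ L := fun b => cond b W P
  have hF : ∀ i j, Commute (F i) (F j) := by
    rintro (_ | _) (_ | _)
    exacts [Commute.refl _, hT.commute.symm, hT.commute, Commute.refl _]
  have h1 := Module.End.independent_iInf_maxGenEigenspace_of_forall_mapsTo F
    (fun i j φ => Module.End.mapsTo_maxGenEigenspace_of_comm (hF j i) φ)
  let c : Sym2 ℂ → Bool → ℂ := fun q b => cond b ((f q + g q) / 2) ((f q - g q) ^ 2 / 8)
  have hc : Function.Injective c := fun q q' h => by
    have e1 : (f q + g q) / 2 = (f q' + g q') / 2 := congrFun h true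
    have e2 : (f q - g q) ^ 2 / 8 = (f q' - g q') ^ 2 / 8 := congrFun h false
    rw [hfg q, hfg q', Sym2.eq_iff]
    exact pair_eq_of_half_sum_eq (by linear_combination e1) (by linear_combination e2)
  refine (h1.comp hc).mono fun q a ha => ?_
  rw [hfg q] at ha
  obtain ⟨e1, e2⟩ := hT.apply_of_mem_timesComponent ha
  refine (Submodule.mem_iInf _).mpr ?_
  rintro (_ | _)
  · exact Module.End.genEigenspace_le_maximal _ _ _ (Module.End.mem_eigenspace_iff.mpr e2)
  · exact Module.End.genEigenspace_le_maximal _ _ _ (Module.End.mem_eigenspace_iff.mpr e1)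

theorem rootSub_le_timesComponent_iff (hT : IsTimesSystem H W P T) {α : Weight ℂ H L}
    (hα : α.IsNonZero) {q : Sym2 ℂ} : rootSub H α ≤ timesComponent H W T q ↔ T α = q := by
  refine ⟨fun h => ?_, rootSub_le_timesComponent hα⟩
  by_contra hne
  obtain ⟨e, he, he0⟩ := exists_mem_rootSub_ne_zero α
  exact he0 (Submodule.disjoint_def.mp (hT.iSupIndep_timesComponent.pairwiseDisjoint hne) e
    (rootSub_le_timesComponent hα rfl he) (h he))

theorem lie_cartan_mem_timesComponent {q : Sym2 ℂ} {h a : L} (hh : h ∈ H)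
    (ha : a ∈ timesComponent H W T q) : ⁅h, a⁆ ∈ timesComponent H W T q := by
  suffices timesComponent H W T q ≤ (timesComponent H W T q).comap (ad ℂ L h : L →ₗ[ℂ] L) from
    this ha
  refine timesComponent_le (fun z hz h' hh' hw => ?_) (fun α hα hq e he => ?_)
  · rw [Submodule.mem_comap, ad_apply, lie_cartan hh hh']
    exact zero_mem _
  · rw [Submodule.mem_comap, ad_apply, mem_rootSub.mp he ⟨h, hh⟩]
    exact Submodule.smul_mem _ _ (rootSub_le_timesComponent hα hq he)

theorem pair_eq_of_add_isZero (hT : IsTimesSystem H W P T) {α β γ : Weight ℂ H L}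
    (hα : α.IsNonZero) (hs : (γ : H → ℂ) = α + β) (hγ : γ.IsZero) : β = -α ∧ T β = T α := by
  have hβ : β = -α := by
    ext z
    have := congrFun (hs.symm.trans hγ) z
    simp only [Pi.add_apply, Pi.zero_apply] at this
    rw [Weight.coe_neg, Pi.neg_apply]
    linear_combination this
  exact ⟨hβ, hβ ▸ hT.neg α hα⟩

theorem lie_mem_timesComponent (hT : IsTimesSystem H W P T) {x y u : ℂ} (hxu : x ≠ u) {a b : L}
    (ha : a ∈ timesComponent H W T s(x, y)) (hb : b ∈ timesComponent H W T s(y, u)) :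
    ⁅a, b⁆ ∈ timesComponent H W T s(x, u) := by
  suffices timesComponent H W T s(x, y) ≤
      (timesComponent H W T s(x, u)).comap (ad ℂ L b : L →ₗ[ℂ] L) by
    have := this ha
    rw [Submodule.mem_comap, ad_apply] at this
    rw [← lie_skew]
    exact neg_mem this
  refine timesComponent_le (fun z hz h hh hw => ?_) (fun α hα hq e he => ?_)
  · obtain ⟨rfl, rfl⟩ : x = z ∧ y = z := by simpa using hz
    rw [Submodule.mem_comap, ad_apply, ← lie_skew]
    exact neg_mem (lie_cartan_mem_timesComponent hh hb)
  · suffices timesComponent H W T s(y, u) ≤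
        (timesComponent H W T s(x, u)).comap (ad ℂ L e : L →ₗ[ℂ] L) by
      have := this hb
      rw [Submodule.mem_comap, ad_apply] at this ⊢
      rw [← lie_skew]
      exact neg_mem this
    refine timesComponent_le (fun z hz h hh hw => ?_) (fun β hβ hq' f hf => ?_)
    · obtain ⟨rfl, rfl⟩ : y = z ∧ u = z := by simpa using hz
      rw [Submodule.mem_comap, ad_apply, ← lie_skew]
      exact neg_mem (lie_cartan_mem_timesComponent hh (rootSub_le_timesComponent hα hq he))
    · rw [Submodule.mem_comap, ad_apply]
      by_cases h0 : ⁅e, f⁆ = 0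
      · rw [h0]
        exact zero_mem _
      obtain ⟨γ, hγ⟩ := add_eq_of_lie_ne_zero he hf h0
      by_cases hγ0 : γ.IsNonZero
      · refine rootSub_le_timesComponent hγ0 ?_ (hγ ▸ lie_mem_rootSub he hf)
        -- Composing {x', y'} with {y', z'} can differ from composing {x, y} with {y, u} only if x =
        -- u.
        obtain ⟨x', y', z', h1, h2, h3⟩ := hT.triangle α β γ hα hβ hγ0 hγ.symm
        rw [h3]
        rw [h1, Sym2.eq_iff] at hq
        rw [h2, Sym2.eq_iff] at hq'
        rw [Sym2.eq_iff]
        grind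
      · have := (hT.pair_eq_of_add_isZero hα hγ (not_not.mp hγ0)).2
        rw [hq, hq', Sym2.eq_iff] at this
        grind

theorem lie_mem_timesComponent_diag (hT : IsTimesSystem H W P T) {x y : ℂ} {a b : L}
    (ha : a ∈ timesComponent H W T s(x, y)) (hb : b ∈ timesComponent H W T s(x, y)) :
    ⁅a, b⁆ ∈ timesComponent H W T s(x, x) ⊔ timesComponent H W T s(y, y) := by
  suffices timesComponent H W T s(x, y) ≤
      (timesComponent H W T s(x, x) ⊔ timesComponent H W T s(y, y)).comap
        (ad ℂ L b : L →ₗ[ℂ] L) by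
    have := this ha
    rw [Submodule.mem_comap, ad_apply] at this
    rw [← lie_skew]
    exact neg_mem this
  refine timesComponent_le (fun z hz h hh hw => ?_) (fun α hα hq e he => ?_)
  · obtain ⟨rfl, rfl⟩ : x = z ∧ y = z := by simpa using hz
    rw [Submodule.mem_comap, ad_apply, ← lie_skew]
    exact neg_mem (Submodule.mem_sup_left (lie_cartan_mem_timesComponent hh hb))
  · suffices timesComponent H W T s(x, y) ≤
        (timesComponent H W T s(x, x) ⊔ timesComponent H W T s(y, y)).comap
          (ad ℂ L e : L →ₗ[ℂ] L) by
      have := this hb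
      rw [Submodule.mem_comap, ad_apply] at this ⊢
      rw [← lie_skew]
      exact neg_mem this
    refine timesComponent_le (fun z hz h hh hw => ?_) (fun β hβ hq' f hf => ?_)
    · obtain ⟨rfl, rfl⟩ : x = z ∧ y = z := by simpa using hz
      rw [Submodule.mem_comap, ad_apply, ← lie_skew]
      exact neg_mem (Submodule.mem_sup_left
        (lie_cartan_mem_timesComponent hh (rootSub_le_timesComponent hα hq he)))
    · rw [Submodule.mem_comap, ad_apply]
      by_cases h0 : ⁅e, f⁆ = 0
      · rw [h0]
        exact zero_mem _
      obtain ⟨γ, hγ⟩ := add_eq_of_lie_ne_zero he hf h0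
      by_cases hγ0 : γ.IsNonZero
      · obtain ⟨x', y', z', h1, h2, h3⟩ := hT.triangle α β γ hα hβ hγ0 hγ.symm
        rw [h1, Sym2.eq_iff] at hq
        rw [h2, Sym2.eq_iff] at hq'
        have hm : ⁅e, f⁆ ∈ rootSub H γ := hγ ▸ lie_mem_rootSub he hf
        -- Equality of {x', y'} and {y', z'} forces x' = z', so the pair of γ is diagonal.
        rcases (by rw [h3, Sym2.eq_iff, Sym2.eq_iff]; grind : T γ = s(x, x) ∨ T γ = s(y, y))
          with h | h
        · exact Submodule.mem_sup_left (rootSub_le_timesComponent hγ0 h hm)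
        · exact Submodule.mem_sup_right (rootSub_le_timesComponent hγ0 h hm)
      · rw [(hT.pair_eq_of_add_isZero hα hγ (not_not.mp hγ0)).1] at hf
        obtain ⟨c, hc⟩ := exists_lie_eq_smul_coroot hα he hf
        obtain ⟨u, hu, w, hw, hu', hw', huw⟩ := hT.coroot α hα x y hq
        rw [hc, huw]
        exact Submodule.smul_mem _ _ (Submodule.add_mem_sup
          (mem_timesComponent_of_mem_cartan hu hu') (mem_timesComponent_of_mem_cartan hw hw'))

theorem lie_eq_zero_of_disjoint (hT : IsTimesSystem H W P T) {α β : Weight ℂ H L}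
    (hα : α.IsNonZero) (hβ : β.IsNonZero) (hd : ∀ x, ¬ (x ∈ T α ∧ x ∈ T β)) {a b : L}
    (ha : a ∈ rootSub H α) (hb : b ∈ rootSub H β) : ⁅a, b⁆ = 0 := by
  by_contra h0
  obtain ⟨γ, hγ⟩ := add_eq_of_lie_ne_zero ha hb h0
  by_cases hγ0 : γ.IsNonZero
  · obtain ⟨x, y, z, h1, h2, -⟩ := hT.triangle α β γ hα hβ hγ0 hγ.symm
    exact hd y ⟨by rw [h1]; simp, by rw [h2]; simp⟩
  · have := (hT.pair_eq_of_add_isZero hα hγ (not_not.mp hγ0)).2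
    obtain ⟨x, hx⟩ : ∃ x, x ∈ T α := by
      induction T α with | _ x y => exact ⟨x, by simp⟩
    exact hd x ⟨hx, this ▸ hx⟩

/-- A root `β` which is not orthogonal to a root `α` with the time `x`, while `x` is not a time of
`β`, is a combination of two roots with the time `x`. -/
theorem exists_of_not_orthogonal (hT : IsTimesSystem H W P T) {α β : Weight ℂ H L}
    (hα : α.IsNonZero) (hβ : β.IsNonZero) (h : α (IsKilling.coroot β) ≠ 0) {x : ℂ} (hx : x ∈ T α)
    (hxβ : x ∉ T β) : ∃ γ : Weight ℂ H L, γ.IsNonZero ∧ x ∈ T γ ∧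
      ((β.toLinear : Module.Dual ℂ H) = γ.toLinear - α.toLinear ∨
        (β.toLinear : Module.Dual ℂ H) = α.toLinear - γ.toLinear) ∧
      ∀ u ∈ T β, T α = s(x, u) ∨ T γ = s(x, u) := by
  have key : ∀ β' γ : Weight ℂ H L, β'.IsNonZero → T β' = T β → (γ : H → ℂ) = β' + α →
      γ.IsNonZero ∧ x ∈ T γ ∧ ∀ u ∈ T β, T α = s(x, u) ∨ T γ = s(x, u) := by
    intro β' γ hβ' hq hs
    have hγ : γ.IsNonZero := by
      by_contra hγ
      exact hxβ (hq ▸ (hT.pair_eq_of_add_isZero hβ' hs hγ).2 ▸ hx)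
    obtain ⟨a, b, c, h1, h2, h3⟩ := hT.triangle β' α γ hβ' hα hγ hs.symm
    rw [← hq] at hxβ ⊢
    rw [h1, Sym2.mem_iff] at hxβ
    rw [h2, Sym2.mem_iff] at hx
    -- The pairs of β', α, γ are {a, b}, {b, c}, {a, c}, and x is neither a nor b. So x = c is a
    -- time of γ, and each time of β is paired with x by α or by γ.
    obtain rfl : x = c := by tauto
    refine ⟨hγ, by rw [h3]; simp, fun u hu => ?_⟩
    rw [h1, Sym2.mem_iff] at hu
    rw [h2, h3]
    rcases hu with rfl | rfl
    · exact Or.inr Sym2.eq_swap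
    · exact Or.inl Sym2.eq_swap
  rcases exists_add_or_sub hβ h with ⟨γ, hγ⟩ | ⟨γ, hγ⟩
  · obtain ⟨h1, h2, h3⟩ := key β γ hβ rfl hγ
    refine ⟨γ, h1, h2, Or.inl ?_, h3⟩
    ext z
    have := congrFun hγ z
    simp only [Pi.add_apply] at this
    simp [this]
  · obtain ⟨h1, h2, h3⟩ := key (-β) γ hβ.neg (hT.neg β hβ) (by rw [Weight.coe_neg]; exact hγ)
    refine ⟨γ, h1, h2, Or.inr ?_, h3⟩
    ext z
    have := congrFun hγ z
    simp only [Pi.add_apply, Pi.neg_apply] at this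
    simp [this]

/-- On a simple Lie algebra any two distinct times form the pair of some root. -/
theorem exists_pair_eq (hT : IsTimesSystem H W P T) [IsSimple ℂ L] {x y : ℂ} (hxy : x ≠ y)
    {α β : Weight ℂ H L} (hα : α.IsNonZero) (hβ : β.IsNonZero) (hx : x ∈ T α) (hy : y ∈ T β) :
    ∃ γ : Weight ℂ H L, γ.IsNonZero ∧ T γ = s(x, y) := by
  by_cases hxβ : x ∈ T β
  · exact ⟨β, hβ, (Sym2.mem_and_mem_iff hxy).mp ⟨hxβ, hy⟩⟩
  -- The span of the roots with time x. A root not orthogonal to one of them either has the time x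
  -- or is a difference of two such roots, so q is invariant under all reflections; irreducibility
  -- of the root system makes it everything.
  let q : Submodule ℂ (Module.Dual ℂ H) :=
    Submodule.span ℂ ((fun α => α.toLinear) '' {α : Weight ℂ H L | α.IsNonZero ∧ x ∈ T α})
  have hmem : ∀ α : Weight ℂ H L, α.IsNonZero → x ∈ T α → (α.toLinear : Module.Dual ℂ H) ∈ q :=
    fun α hα hx => Submodule.subset_span ⟨α, ⟨hα, hx⟩, rfl⟩
  have hq : q = ⊤ := by
    refine RootPairing.IsIrreducible.eq_top_of_invtSubmodule_reflection
      (P := IsKilling.rootSystem H) q (fun i => ?_) fun hbot => ?_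
    · rw [Module.End.mem_invtSubmodule]
      refine Submodule.span_le.mpr ?_
      rintro _ ⟨α, ⟨hα, hx⟩, rfl⟩
      have hi : (i : Weight ℂ H L).IsNonZero := (Finset.mem_filter.mp i.2).2
      change (IsKilling.rootSystem H).reflection i α.toLinear ∈ q
      rw [RootPairing.reflection_apply]
      refine q.sub_mem (hmem α hα hx) ?_
      change α (IsKilling.coroot (i : Weight ℂ H L)) • (i : Weight ℂ H L).toLinear ∈ q
      by_cases h0 : α (IsKilling.coroot (i : Weight ℂ H L)) = 0
      · rw [h0, zero_smul]
        exact q.zero_mem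
      refine q.smul_mem _ ?_
      by_cases hxi : x ∈ T i
      · exact hmem i hi hxi
      obtain ⟨γ, hγ, hxγ, h | h, -⟩ := hT.exists_of_not_orthogonal hα hi h0 hx hxi
      · rw [h]
        exact q.sub_mem (hmem γ hγ hxγ) (hmem α hα hx)
      · rw [h]
        exact q.sub_mem (hmem α hα hx) (hmem γ hγ hxγ)
    · have h1 := hmem α hα hx
      rw [hbot, Submodule.mem_bot] at h1
      refine hα ?_
      ext z
      exact LinearMap.congr_fun h1 z
  by_contra hne
  -- If no root has the pair {x, y}, then all roots with time x, hence all of q, vanish on the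
  -- coroot of β. But β itself lies in q and takes the value 2 there.
  have h0 : ∀ α : Weight ℂ H L, α.IsNonZero → x ∈ T α → α (IsKilling.coroot β) = 0 := by
    intro α hα hx
    by_contra h
    obtain ⟨γ, hγ, -, -, h1⟩ := hT.exists_of_not_orthogonal hα hβ h hx hxβ
    exact (h1 y hy).elim (fun h => hne ⟨α, hα, h⟩) (fun h => hne ⟨γ, hγ, h⟩)
  have h1 : q ≤ LinearMap.ker (Module.Dual.eval ℂ H (IsKilling.coroot β)) := by
    refine Submodule.span_le.mpr ?_
    rintro _ ⟨α, ⟨hα, hx⟩, rfl⟩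
    exact h0 α hα hx
  have h2 : (β.toLinear : Module.Dual ℂ H) ∈ q := hq ▸ Submodule.mem_top
  have h3 : β (IsKilling.coroot β) = 0 := h1 h2
  rw [IsKilling.root_apply_coroot hβ] at h3
  exact two_ne_zero h3

/-- The times system of an operator on a simple Lie algebra defines a quasigrading. -/
theorem isToralQuasigrading (hT : IsTimesSystem H W P T) [IsSimple ℂ L] {X : Finset ℂ}
    (hX : ∀ x, x ∈ X ↔ ∃ α : Weight ℂ H L, α.IsNonZero ∧ x ∈ T α) :
    IsToralQuasigrading H fun p : Sym2 X => timesComponent H W T (p.map Subtype.val) := by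
  have hlift : ∀ α : Weight ℂ H L, α.IsNonZero → ∃ p : Sym2 X, p.map Subtype.val = T α := by
    intro α hα
    obtain ⟨x, y, hxy⟩ : ∃ x y, T α = s(x, y) := by
      induction T α with | _ x y => exact ⟨x, y, rfl⟩
    refine ⟨s(⟨x, (hX x).mpr ⟨α, hα, by rw [hxy]; simp⟩⟩,
      ⟨y, (hX y).mpr ⟨α, hα, by rw [hxy]; simp⟩⟩), ?_⟩
    exact hxy.symm
  have hcartan : H.toSubmodule ≤ ⨆ x : X, timesComponent H W T (s(x, x).map Subtype.val) := by
    -- Coroots span H, and each is a sum of W-eigenvectors in H whose eigenvalues are times of its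
    -- root.
    refine cartan_le_of_coroot_mem fun α hα => ?_
    obtain ⟨p, hp⟩ := hlift α hα
    induction p with | _ x y =>
    obtain ⟨u, hu, w, hw, hu', hw', huw⟩ := hT.coroot α hα x y hp.symm
    rw [huw]
    exact add_mem (Submodule.mem_iSup_of_mem x (mem_timesComponent_of_mem_cartan hu hu'))
      (Submodule.mem_iSup_of_mem y (mem_timesComponent_of_mem_cartan hw hw'))
  refine ⟨hT.iSupIndep_timesComponent.comp (Sym2.map.injective Subtype.val_injective), ?_,
    fun x y hxy => ?_, fun x y u hxu a ha b hb => ?_, fun x y a ha b hb => ?_,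
    fun p q hpq α β hα hβ hp hq a ha b hb => ?_, fun p => ?_, hcartan, fun p α hα hp => ?_⟩
  · refine eq_top_iff.mpr ((cartan_sup_rootPart (H := H)).symm.le.trans (sup_le ?_ ?_))
    · exact hcartan.trans (iSup_le fun x => le_iSup (fun p : Sym2 X => timesComponent H W T
        (p.map Subtype.val)) s(x, x))
    · refine iSup₂_le fun α hα => ?_
      obtain ⟨p, hp⟩ := hlift α hα
      exact (rootSub_le_timesComponent hα hp.symm).trans
        (le_iSup (fun p : Sym2 X => timesComponent H W T (p.map Subtype.val)) p)
  · obtain ⟨α, hα, hx⟩ := (hX x).mp x.2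
    obtain ⟨β, hβ, hy⟩ := (hX y).mp y.2
    obtain ⟨γ, hγ, h⟩ := hT.exists_pair_eq (Subtype.val_injective.ne hxy) hα hβ hx hy
    obtain ⟨e, he, he0⟩ := exists_mem_rootSub_ne_zero γ
    exact (Submodule.ne_bot_iff _).mpr ⟨e, rootSub_le_timesComponent hγ h he, he0⟩
  · exact hT.lie_mem_timesComponent (Subtype.val_injective.ne hxu) ha hb
  · exact hT.lie_mem_timesComponent_diag ha hb
  · rw [hT.rootSub_le_timesComponent_iff hα] at hp
    rw [hT.rootSub_le_timesComponent_iff hβ] at hq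
    refine hT.lie_eq_zero_of_disjoint hα hβ (fun x hx => ?_) ha hb
    rw [hp, hq, Sym2.mem_map, Sym2.mem_map] at hx
    obtain ⟨⟨z, hz, rfl⟩, w, hw, hwz⟩ := hx
    obtain rfl := Subtype.val_injective hwz
    exact hpq w ⟨hz, hw⟩
  · exact ⟨_, iSup₂_le fun x _ => inf_le_left, _, fun α hα => hα.1, rfl⟩
  · rw [hT.rootSub_le_timesComponent_iff hα] at hp
    exact rootSub_le_timesComponent hα.neg ((hT.neg α hα).trans hp)

end IsTimesSystem

theorem IsClassI.exists_isToralQuasigrading [IsSimple ℂ L] {br : L →ₗ[ℂ] L →ₗ[ℂ] L}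
    (h : IsClassI H br) : ∃ (X : Finset ℂ) (G : Sym2 X → Submodule ℂ L) (W : Module.End ℂ L),
      IsToralQuasigrading H G ∧ IsOperatorOf X G W ∧ br = modBr W := by
  obtain ⟨-, -, W, ⟨hN, rfl, hW⟩, hpg, hI⟩ := h
  obtain ⟨l, hl⟩ := hpg.exists_isRootGraded
  obtain ⟨P, hP⟩ := exists_isPrincipalPrimitive W
  obtain ⟨-, p, hp, hpn⟩ := hl.exists_primitive hP
  obtain ⟨T, hT⟩ := exists_isTimesSystem hl hW hN hP hpg.2.2
    (hl.scalar_neg_eq hW fun α β γ hα hβ hγ hs =>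
      hl.sum_eq_sum_neg hW hN hP hp hpn hI hα hβ hγ hs)
  have hfin : {x : ℂ | ∃ α : Weight ℂ H L, α.IsNonZero ∧ x ∈ T α}.Finite := by
    refine (Set.finite_iUnion fun α : Weight ℂ H L => (T α).toFinset.finite_toSet).subset ?_
    rintro x ⟨α, -, hx⟩
    exact Set.mem_iUnion.mpr ⟨α, by simpa using hx⟩
  refine ⟨hfin.toFinset, _, W, hT.isToralQuasigrading fun x => by simp, fun s t a ha => ?_, rfl⟩
  exact (hT.apply_of_mem_timesComponent ha).1

end

end BiLie

/-! ### Assembly of the three parts of the theorem -/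

theorem theorem12p7 {L : Type*} [LieRing L] [LieAlgebra ℂ L] [FiniteDimensional ℂ L]
    [LieAlgebra.IsSemisimple ℂ L] [Nontrivial L]
    (H : LieSubalgebra ℂ L) [H.IsCartanSubalgebra] :
    -- 1: from quasigradings to bi-Lie structures
    (∀ (X : Finset ℂ) (G : Sym2 X → Submodule ℂ L), BiLie.IsToralQuasigrading H G →
      (∃! W : Module.End ℂ L, BiLie.IsOperatorOf X G W) ∧
      ∀ W : Module.End ℂ L, BiLie.IsOperatorOf X G W →
        BiLie.IsBiLie (BiLie.modBr W) ∧ BiLie.IsClassI H (BiLie.modBr W) ∧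
        -- (a)
        (BiLie.times (BiLie.modBr W) = (X : Set ℂ) ∧
          (∀ t : X, G s(t, t) = BiLie.basicPart H W t) ∧
          (∀ t : X, ∃ K : LieSubalgebra ℂ L, K.toSubmodule = G s(t, t)) ∧
          BiLie.basic H (BiLie.modBr W) W = ⨆ t : X, G s(t, t) ∧
          (∃ K : LieSubalgebra ℂ L, K.toSubmodule = ⨆ t : X, G s(t, t))) ∧
        -- (b)
        (H.toSubmodule ≤ BiLie.central (BiLie.modBr W) ∧
          (∃ K : LieSubalgebra ℂ L, K.toSubmodule = BiLie.central (BiLie.modBr W)) ∧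
          iSupIndep (fun t : X => BiLie.centre (BiLie.modBr W) t) ∧
          BiLie.central (BiLie.modBr W) = ⨆ t : X, BiLie.centre (BiLie.modBr W) t ∧
          ∀ t : X, BiLie.centre (BiLie.modBr W) t =
            (G s(t, t) ⊓ H.toSubmodule) ⊔
              ⨆ α ∈ {α : LieModule.Weight ℂ H L | α.IsNonZero ∧
                BiLie.rootSub H α ≤ G s(t, t) ∧
                ∀ h : H, (h : L) ∈ ⨆ s ∈ {s : X | s ≠ t}, G s(s, s) ⊓ H.toSubmodule → α h = 0},
                BiLie.rootSub H α) ∧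
        -- (c)
        ((∀ x ∈ BiLie.cartanPerp H, W x ∈ BiLie.cartanPerp H) ∧
          (∀ x ∈ BiLie.cartanPerp H, ∀ y ∈ BiLie.cartanPerp H,
            killingForm ℂ L (W x) y = killingForm ℂ L x (W y)) ∧
          BiLie.IsPrincipalWNO (BiLie.modBr W) W)) ∧
    -- 2: every Class I bi-Lie structure on a simple Lie algebra arises in this way
    (LieAlgebra.IsSimple ℂ L → ∀ br : L →ₗ[ℂ] L →ₗ[ℂ] L, BiLie.IsClassI H br →
      ∃ (X : Finset ℂ) (G : Sym2 X → Submodule ℂ L) (W : Module.End ℂ L),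
        BiLie.IsToralQuasigrading H G ∧ BiLie.IsOperatorOf X G W ∧ br = BiLie.modBr W) ∧
    -- 3: strong isomorphism and isomorphism
    (∀ (H' : LieSubalgebra ℂ L) [H'.IsCartanSubalgebra] (X X' : Finset ℂ)
      (G : Sym2 X → Submodule ℂ L) (G' : Sym2 X' → Submodule ℂ L) (W W' : Module.End ℂ L),
      BiLie.IsToralQuasigrading H G → BiLie.IsToralQuasigrading H' G' →
      BiLie.IsOperatorOf X G W → BiLie.IsOperatorOf X' G' W' →
      (BiLie.StronglyIsomorphic (BiLie.modBr W) (BiLie.modBr W') ↔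
        X = X' ∧ ∃ χ : X ≃ X', BiLie.EquivalentVia G G' χ ∧ ∀ x : X, (χ x : ℂ) = x) ∧
      (BiLie.Isomorphic (BiLie.modBr W) (BiLie.modBr W') ↔
        ∃ χ : X ≃ X', BiLie.EquivalentVia G G' χ ∧
          ∃ c d : ℂ, ∀ x : X, (χ x : ℂ) = c * x + d)) := by
  refine ⟨fun X G hG => ⟨hG.exists_actsBy Subtype.val, fun W hW => ?_⟩,
    fun _ br h => h.exists_isToralQuasigrading, fun H' _ X X' G G' W W' hG hG' hW hW' => ⟨?_, ?_⟩⟩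
  · have hv : Function.Injective (Subtype.val : X → ℂ) := Subtype.val_injective
    have hA : BiLie.ActsBy G Subtype.val W := hW
    refine ⟨hG.isBiLie hA, hG.isClassI hv hA,
      ⟨?_, fun t => hG.basicPart_eq hv hA t, hG.exists_subalgebra_diag, hG.basic_eq hv hA,
        hG.exists_subalgebra_iSup_diag⟩,
      ⟨hG.cartan_le_central hA, BiLie.exists_subalgebra_central (hG.isPrincipal hA),
        (BiLie.iSupIndep_centre (hG.isPrincipal hA)).comp hv, hG.central_eq hA,
        fun t => hG.centre_eq hv hA t⟩,
      fun x hx => hG.cartanPerp_apply_mem hA hx, fun x hx y _ => hG.killingForm_cartanPerp hA hx y,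
      hG.isPrincipalWNO hA⟩
    rw [hG.times_eq hA]
    exact Subtype.range_coe
  · rw [hG.stronglyIsomorphic_iff Subtype.val_injective hW hG' Subtype.val_injective hW']
    refine ⟨fun ⟨χ, hχ, h⟩ => ⟨?_, χ, hχ, h⟩, fun ⟨_, h⟩ => h⟩
    ext t
    refine ⟨fun ht => by simpa only [h ⟨t, ht⟩] using (χ ⟨t, ht⟩).2, fun ht => ?_⟩
    have := h (χ.symm ⟨t, ht⟩)
    rw [χ.apply_symm_apply] at this
    simpa only [← this] using (χ.symm ⟨t, ht⟩).2
  · exact hG.isomorphic_iff Subtype.val_injective hW hG' Subtype.val_injective hW'
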